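/- **Theorem.** Let $I\subset\mathbb R$ be an interval, $\Gamma:I\to\mathbb R^2$ a $C^2$ curve, $\kappa=\det(\Gamma',\Gamma'')$, and let $I_*=\{t\in I:\kappa(t)\neq0\}$ be the set of parameters of the points of nonvanishing curvature, endowed with arclength measure $ds=|\Gamma'(t)|\,dt$. Write $\widehat\varphi(\xi)=\int_{\mathbb R^2}\varphi(x)e^{-2\pi i x\cdot\xi}\,dx$ for Schwartz functions $\varphi$, and for $f\in L^p(\mathbb R^2)$, $1\le p<\frac43$, let $\widehat f$ be its Fourier transform in the sense of tempered distributions, which is a (locally integrable) function. Let $1\le p<\frac43$, $p'=\frac p{p-1}$ ($p'=\infty$ if $p=1$) and $1\le q\le\infty$ with $3q\le p'$. Then there is a restriction operator $\mathcal R$, that is, a linear operator which maps each $f\in L^p(\mathbb R^2)$ to an (a.e. defined) measurable function on $I_*$, satisfies $\mathcal R\varphi(t)=\widehat\varphi(\Gamma(t))$ for a.e. $t\in I_*$ whenever $\varphi\in\mathcal S(\mathbb R^2)$, and is bounded from $L^p(\mathbb R^2)$ to $L^q(K,ds)$ for every compact $K\subset I_*$. For every such $\mathcal R$ and every $f\in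 L^p(\mathbb R^2)$: (i) If $\chi\in\mathcal S(\mathbb R^2)$, $\int\chi=1$ and $\chi_\varepsilon(x)=\varepsilon^{-2}\chi(x/\varepsilon)$, then, with respect to arclength measure, for almost every $t\in I_*$, $$\lim_{\varepsilon\to0^+}\widehat f*\chi_\varepsilon(\Gamma(t))=\mathcal Rf(t).$$ (ii) If moreover $p<\frac87$, then, with respect to arclength measure, for almost every $t\in I_*$ the point $\Gamma(t)$ is a Lebesgue point of $\widehat f$ with regularized value $\mathcal Rf(t)$, that is, with $B_\varepsilon(x)$ the disc of radius $\varepsilon$ centred at $x$, $$\lim_{\varepsilon\to0^+}\frac1{|B_\varepsilon(\Gamma(t))|}\int_{B_\varepsilon(\Gamma(t))}\big|\widehat f(y)-\mathcal Rf(t)\big|\,dy=0.$$ -/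

import Mathlib

open MeasureTheory Filter Topology SchwartzMap FourierTransform
open scoped ENNReal NNReal

noncomputable section

/-- The Euclidean plane. -/
abbrev Plane : Type := EuclideanSpace ℝ (Fin 2)

namespace PlaneCurve

/-- The velocity `Γ'(t)` of the curve `Γ` parametrized on the interval `I`
(one-sided at end points belonging to `I`). -/
def velocity (Γ : ℝ → Plane) (I : Set ℝ) (t : ℝ) : Plane := derivWithin Γ I t

/-- The acceleration `Γ''(t)`. -/
def acceleration (Γ : ℝ → Plane) (I : Set ℝ) (t : ℝ) : Plane :=
  derivWithin (velocity Γ I) I t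

/-- `det (Γ'(t), Γ''(t))`. It equals `|Γ'(t)|³` times the signed curvature of `Γ` at `t`;
in particular, where it is nonzero, `Γ'(t) ≠ 0`. -/
def kappa (Γ : ℝ → Plane) (I : Set ℝ) (t : ℝ) : ℝ :=
  velocity Γ I t 0 * acceleration Γ I t 1 - velocity Γ I t 1 * acceleration Γ I t 0

/-- The parameters in `I` at which the curvature does not vanish. -/
def curvedSet (Γ : ℝ → Plane) (I : Set ℝ) : Set ℝ := {t ∈ I | kappa Γ I t ≠ 0}

/-- Arclength measure `|Γ'(t)| dt` of the curve, pulled back to the parameter interval `I`. -/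
def arclength (Γ : ℝ → Plane) (I : Set ℝ) : Measure ℝ :=
  (volume.restrict I).withDensity (fun t => ‖velocity Γ I t‖ₑ)

/-- Arclength measure on the part of the curve where the curvature does not vanish. -/
def curvedArclength (Γ : ℝ → Plane) (I : Set ℝ) : Measure ℝ :=
  (arclength Γ I).restrict (curvedSet Γ I)

/-- `R` is the `L^p`-`L^q` Fourier restriction operator of the curve `Γ` (on the set of
points of nonvanishing curvature): it is linear, it maps a Schwartz function `φ` to the restriction
of `φ̂` to the curve, and it is bounded from `L^p(ℝ²)` to `L^q(K, arclength)` for each compact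
part `K` of the curve on which the curvature does not vanish. Functions on the curve are written as
functions of the parameter, up to equality almost everywhere with respect to arclength. -/
structure IsRestrictionOperator (Γ : ℝ → Plane) (I : Set ℝ) (p q : ℝ≥0∞)
    (R : Lp ℂ p (volume : Measure Plane) →ₗ[ℂ] (ℝ →ₘ[curvedArclength Γ I] ℂ)) : Prop where
  schwartz : ∀ φ : 𝓢(Plane, ℂ),
    ∀ᵐ t ∂(curvedArclength Γ I), R (φ.toLp p) t = (𝓕 φ) (Γ t)
  bounded : ∀ K : Set ℝ, IsCompact K → K ⊆ curvedSet Γ I →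
    ∃ C : ℝ≥0, ∀ f : Lp ℂ p (volume : Measure Plane),
      eLpNorm (R f) q ((curvedArclength Γ I).restrict K) ≤ C * ‖f‖ₑ

end PlaneCurve

/-- The function `F` is the Fourier transform of `f ∈ L^p`: the Fourier transform of `f` in the
sense of tempered distributions is given by integration against `F`. -/
def IsFourierTransform {p : ℝ≥0∞} [Fact (1 ≤ p)] (f : Lp ℂ p (volume : Measure Plane))
    (F : Plane → ℂ) : Prop :=
  ∀ φ : 𝓢(Plane, ℂ), Integrable (fun x => φ x * F x) ∧
    (𝓕 (f : 𝓢'(Plane, ℂ))) φ = ∫ x, φ x * F x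

/-- The dilates `χ_ε(x) = ε⁻² χ(x / ε)` of a function on the plane. -/
def dilate (χ : Plane → ℂ) (ε : ℝ) (x : Plane) : ℂ := ((ε ^ 2)⁻¹ : ℝ) * χ (ε⁻¹ • x)

/-- `x` is a Lebesgue point of `F`, and the regularized value of `F` at `x` is `c`. -/
def IsLebesguePointWithValue (F : Plane → ℂ) (x : Plane) (c : ℂ) : Prop :=
  Tendsto (fun ε : ℝ => ⨍ y in Metric.ball x ε, ‖F y - c‖) (𝓝[>] 0) (𝓝 0)

end

/-! Everything rests on a maximal form of the restriction theorem for plane curves: when `p < 4/3`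
and `3q ≤ p'`, the function sup over ε of |f̂ * χ_ε|, evaluated along the curve, is bounded from L^p
to L^q over every compact set of curved points (`exists_eLpNorm_fourierMaximal_le`). Granting it,
approximate f by Schwartz functions φ_n with errors 2^{-n}. The averages of φ̂_n converge at every
point, and the maximal bound makes the discrepancy between the averages of f̂ and of φ̂_n tend to 0
uniformly in ε at almost every point of the curve. Hence the averages of f̂ converge. Any
restriction operator satisfies φ̂_n(Γ(t)) → Rf(t) almost everywhere by its own boundedness, so the
limit is Rf(t). Existence of R comes from taking the limit of the averages as its definition.

The maximal bound is proved by linearization and duality. Choosing for each t a scale e(t) which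
nearly attains the supremum, one has to bound the adjoint E(x) = ∫_A g(t) e^{-2πi x·Γ(t)} ψ(e(t)x)
dt, where ψ = 𝓕⁻ χ and |g| ≤ 1. Its square is an integral over pairs (s,t) with frequency Γ(s) +
Γ(t). Testing this square against w produces a two-scale average of ŵ at Γ(s) + Γ(t), which the
iterated Hardy–Littlewood maximal function dominates, independently of the choice of e
(`exists_biparameter_maximal_bound`). Curvature makes (s,t) ↦ Γ(s) + Γ(t) injective for s < t with
Jacobian at least a multiple of |s − t| (`IsTurningArc.sumMapBound`), and Cauchy–Schwarz then gives
an L² bound with the weight 1/|s − t|. That weight is not integrable across the diagonal, so at each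
level of |E|² a strip of suitable width is removed and estimated trivially. Integration over the
levels gives a bound for E on sets A in L^{2ρ}, `2 < ρ < 3`
(`exists_lintegral_linearAdjoint_rpow_le`). By duality the maximal operator has weak type on the
line p' = 3q, and interpolation with the trivial bound from L¹ to L^∞ gives the strong type
(`exists_marcinkiewicz_bound`).

For Lebesgue points, quadratic means are used. The square |ψ̂|² is the Fourier transform of the
autocorrelation of ψ, which by Young's inequality lies in L^r with r = p/(2 − p) and has norm at
most ‖ψ‖_p². The condition `p < 8/7` says exactly that r < 4/3, so the maximal theorem applies to
autocorrelations and controls the averages of |f̂ − φ̂_n|² (`ae_exists_quadratic_mean_bound`).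
Cauchy–Schwarz returns to averages of |f̂ − φ̂_n|. -/

/-! ### Layer cake formulas. -/

/-- Layer cake representation of a power. -/
theorem lintegral_indicator_lt_rpow (a : ℝ≥0∞) {p : ℝ} (hp : 0 < p) :
    ∫⁻ l in Set.Ioi (0 : ℝ), (if ENNReal.ofReal l < a then ENNReal.ofReal (l ^ (p - 1)) else 0)
      = a ^ p / ENNReal.ofReal p := by
  have key : ∀ b : ℝ, 0 ≤ b →
      ∫⁻ l in Set.Ioo (0 : ℝ) b, ENNReal.ofReal (l ^ (p - 1)) = ENNReal.ofReal (b ^ p / p) := by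
    intro b hb
    rw [restrict_Ioo_eq_restrict_Ioc]
    have h1 : IntervalIntegrable (fun l : ℝ => l ^ (p - 1)) volume 0 b :=
      intervalIntegral.intervalIntegrable_rpow' (by linarith)
    rw [← ofReal_integral_eq_lintegral_ofReal]
    · rw [← intervalIntegral.integral_of_le hb, integral_rpow (Or.inl (by linarith))]
      simp [Real.zero_rpow hp.ne']
    · exact (intervalIntegrable_iff_integrableOn_Ioc_of_le hb).1 h1
    · filter_upwards [ae_restrict_mem measurableSet_Ioc] with l hl
      exact Real.rpow_nonneg hl.1.le _
  have conv : ∀ b : ℝ, (∫⁻ l in Set.Ioi (0 : ℝ),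
      (if l < b then ENNReal.ofReal (l ^ (p - 1)) else 0))
      = ∫⁻ l in Set.Ioo (0 : ℝ) b, ENNReal.ofReal (l ^ (p - 1)) := by
    intro b
    have : (fun l : ℝ => (if l < b then ENNReal.ofReal (l ^ (p - 1)) else 0))
        = (Set.Iio b).indicator (fun l => ENNReal.ofReal (l ^ (p - 1))) := by
      ext l; simp [Set.indicator_apply]
    rw [this, lintegral_indicator measurableSet_Iio, Measure.restrict_restrict measurableSet_Iio,
      Set.inter_comm, Set.Ioi_inter_Iio]
  by_cases ha : a = ∞
  · subst ha
    simp only [ENNReal.ofReal_lt_top, if_true, ENNReal.top_rpow_of_pos hp]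
    rw [ENNReal.top_div_of_ne_top ENNReal.ofReal_ne_top]
    refine ENNReal.eq_top_of_forall_nnreal_le fun r => ?_
    -- The end point b is chosen so that b^p / p = r; letting r grow shows that the integral is
    -- infinite.
    have h2 : ∫⁻ l in Set.Ioo (0 : ℝ) ((r * p) ^ (1 / p)), ENNReal.ofReal (l ^ (p - 1)) = r := by
      rw [key _ (by positivity), ← Real.rpow_mul (by positivity), one_div_mul_cancel hp.ne',
        Real.rpow_one, mul_div_cancel_right₀ _ hp.ne', ENNReal.ofReal_coe_nnreal]
    rw [← h2]
    exact lintegral_mono_set (fun x hx => hx.1)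
  · lift a to ℝ≥0 using ha
    have : ∀ l : ℝ, l ∈ Set.Ioi (0 : ℝ) → ((if ENNReal.ofReal l < (a : ℝ≥0∞)
        then ENNReal.ofReal (l ^ (p - 1)) else 0)
        = (if l < (a : ℝ) then ENNReal.ofReal (l ^ (p - 1)) else 0)) := by
      intro l hl
      have : ENNReal.ofReal l < (a : ℝ≥0∞) ↔ l < (a : ℝ) := by
        rw [← ENNReal.ofReal_coe_nnreal, ENNReal.ofReal_lt_ofReal_iff_of_nonneg (le_of_lt hl)]
      simp [this]
    rw [setLIntegral_congr_fun measurableSet_Ioi this, conv, key a a.2,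
      ENNReal.ofReal_div_of_pos hp, ← ENNReal.ofReal_rpow_of_nonneg a.coe_nonneg hp.le,
      ENNReal.ofReal_coe_nnreal]

/-- Layer cake formula for `ℝ≥0∞`-valued functions. -/
theorem lintegral_rpow_eq_lintegral_measure_lt {α : Type*} [MeasurableSpace α] (μ : Measure α)
    [SFinite μ] {G : α → ℝ≥0∞} (hG : Measurable G) {p : ℝ} (hp : 0 < p) :
    ∫⁻ x, G x ^ p ∂μ = ENNReal.ofReal p *
      ∫⁻ l in Set.Ioi (0 : ℝ), μ {x | ENNReal.ofReal l < G x} * ENNReal.ofReal (l ^ (p - 1)) := by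
  have hp0 : ENNReal.ofReal p ≠ 0 := by simpa using hp
  have h1 : ∀ x, G x ^ p = ENNReal.ofReal p * ∫⁻ l in Set.Ioi (0 : ℝ),
      (if ENNReal.ofReal l < G x then ENNReal.ofReal (l ^ (p - 1)) else 0) := fun x => by
    rw [lintegral_indicator_lt_rpow _ hp, ENNReal.mul_div_cancel hp0 ENNReal.ofReal_ne_top]
  have hset : MeasurableSet {z : α × ℝ | ENNReal.ofReal z.2 < G z.1} :=
    measurableSet_lt (by fun_prop) (by fun_prop)
  have hm : Measurable (fun z : α × ℝ =>
      if ENNReal.ofReal z.2 < G z.1 then ENNReal.ofReal (z.2 ^ (p - 1)) else 0) :=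
    Measurable.ite hset (by fun_prop) measurable_const
  simp_rw [h1]
  rw [lintegral_const_mul' _ _ ENNReal.ofReal_ne_top, lintegral_lintegral_swap hm.aemeasurable]
  congr 1
  refine lintegral_congr fun l => ?_
  have : (fun x => if ENNReal.ofReal l < G x then ENNReal.ofReal (l ^ (p - 1)) else 0)
      = {x | ENNReal.ofReal l < G x}.indicator (fun _ => ENNReal.ofReal (l ^ (p - 1))) := by
    ext x; simp [Set.indicator_apply]
  rw [this, lintegral_indicator_const (measurableSet_lt measurable_const hG), mul_comm]

/-! ### The Hardy–Littlewood maximal function and averages against Schwartz functions. -/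

/-- The uncentred Hardy–Littlewood maximal function. -/
noncomputable def maximalFunction (H : Plane → ℝ≥0∞) (x : Plane) : ℝ≥0∞ :=
  ⨆ (c : Plane) (r : ℝ) (_ : x ∈ Metric.ball c r), ⨍⁻ y, H y ∂(volume.restrict (Metric.ball c r))

theorem laverage_ball_le_maximalFunction (H : Plane → ℝ≥0∞) {x c : Plane} {r : ℝ}
    (hx : x ∈ Metric.ball c r) : ⨍⁻ y, H y ∂(volume.restrict (Metric.ball c r)) ≤ maximalFunction H x :=
  le_iSup_of_le c (le_iSup_of_le r (le_iSup_of_le hx le_rfl))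

theorem lintegral_ball_le_maximalFunction (H : Plane → ℝ≥0∞) {x c : Plane} {r : ℝ}
    (hx : x ∈ Metric.ball c r) :
    ∫⁻ y in Metric.ball c r, H y ≤ volume (Metric.ball c r) * maximalFunction H x := by
  have : IsFiniteMeasure (volume.restrict (Metric.ball c r)) :=
    ⟨by rw [Measure.restrict_apply_univ]; exact measure_ball_lt_top⟩
  rw [← measure_mul_laverage, Measure.restrict_apply_univ]
  gcongr
  exact laverage_ball_le_maximalFunction H hx

theorem lt_maximalFunction_iff {H : Plane → ℝ≥0∞} {x : Plane} {l : ℝ≥0∞} :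
    l < maximalFunction H x ↔
      ∃ c r, x ∈ Metric.ball c r ∧ l < ⨍⁻ y, H y ∂(volume.restrict (Metric.ball c r)) := by
  simp [maximalFunction, lt_iSup_iff]

/-- A ball whose average exceeds l witnesses the bound at all of its points. With uncentred balls
measurability therefore costs nothing, even when H is not measurable. -/
theorem isOpen_lt_maximalFunction (H : Plane → ℝ≥0∞) (l : ℝ≥0∞) :
    IsOpen {x | l < maximalFunction H x} := by
  rw [isOpen_iff_forall_mem_open]
  intro x hx
  obtain ⟨c, r, hxc, hl⟩ := lt_maximalFunction_iff.1 hx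
  exact ⟨Metric.ball c r, fun y hy => lt_maximalFunction_iff.2 ⟨c, r, hy, hl⟩,
    Metric.isOpen_ball, hxc⟩

theorem measurable_maximalFunction (H : Plane → ℝ≥0∞) : Measurable (maximalFunction H) :=
  measurable_of_Ioi fun l => (isOpen_lt_maximalFunction H l).measurableSet

/-- The weak type `(1,1)` inequality for the maximal function. -/
theorem mul_measure_lt_maximalFunction_le (H : Plane → ℝ≥0∞) (l : ℝ≥0∞) :
    l * volume {x | l < maximalFunction H x} ≤ 25 * ∫⁻ x, H x := by
  classical
  -- Inner regularity reduces to a compact K, which finitely many of the large-average balls cover;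
  -- their radii are then bounded, as Vitali's lemma requires.
  rw [(isOpen_lt_maximalFunction H l).measure_eq_iSup_isCompact]
  simp only [ENNReal.mul_iSup]
  refine iSup_le fun K => iSup_le fun hK => iSup_le fun hKc => ?_
  have hch : ∀ x : K, ∃ cr : Plane × ℝ, (x : Plane) ∈ Metric.ball cr.1 cr.2 ∧
      l < ⨍⁻ y, H y ∂(volume.restrict (Metric.ball cr.1 cr.2)) := fun x => by
    obtain ⟨c, r, h⟩ := lt_maximalFunction_iff.1 (hK x.2)
    exact ⟨(c, r), h⟩
  choose b hb using hch
  obtain ⟨t, ht⟩ := hKc.elim_finite_subcover (fun x : K => Metric.ball (b x).1 (b x).2)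
    (fun _ => Metric.isOpen_ball) (fun x hx => Set.mem_iUnion.2 ⟨⟨x, hx⟩, (hb ⟨x, hx⟩).1⟩)
  obtain ⟨R, hR⟩ := (t.finite_toSet.image (fun x => (b x).2)).bddAbove
  obtain ⟨u, hut, hdisj, hcov⟩ := Vitali.exists_disjoint_subfamily_covering_enlargement_closedBall
    (t : Set K) (fun x => (b x).1) (fun x => (b x).2) R
    (fun a ha => hR (Set.mem_image_of_mem _ ha)) 5 (by norm_num)
  have hpos : ∀ x, 0 < (b x).2 := fun x => Metric.pos_of_mem_ball (hb x).1
  have hufin : u.Finite := t.finite_toSet.subset hut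
  -- The Vitali dilation factor 5 enters the area squared, whence the constant 25.
  have hvol : ∀ x, volume (Metric.closedBall (b x).1 (5 * (b x).2))
      = 25 * volume (Metric.ball (b x).1 (b x).2) := fun x => by
    rw [Measure.addHaar_closedBall _ _ (by linarith [hpos x]),
      Measure.addHaar_ball _ _ (hpos x).le, ← mul_assoc]
    congr 1
    simp only [finrank_euclideanSpace, Fintype.card_fin, mul_pow]
    rw [ENNReal.ofReal_mul (by norm_num)]
    norm_num
  have hball : ∀ x, l * volume (Metric.ball (b x).1 (b x).2)
      ≤ ∫⁻ y in Metric.ball (b x).1 (b x).2, H y := fun x => by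
    have : IsFiniteMeasure (volume.restrict (Metric.ball (b x).1 (b x).2)) :=
      ⟨by rw [Measure.restrict_apply_univ]; exact measure_ball_lt_top⟩
    rw [← measure_mul_laverage, Measure.restrict_apply_univ, mul_comm]
    gcongr
    exact (hb x).2.le
  have hKsub : K ⊆ ⋃ x ∈ hufin.toFinset, Metric.closedBall (b x).1 (5 * (b x).2) := by
    intro y hy
    obtain ⟨x, hx⟩ := Set.mem_iUnion.1 (ht hy)
    obtain ⟨hxt, hyx⟩ := Set.mem_iUnion.1 hx
    obtain ⟨z, hz, hsub⟩ := hcov x hxt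
    exact Set.mem_biUnion (by simpa using hz) (hsub (Metric.ball_subset_closedBall hyx))
  calc l * volume K ≤ l * ∑ x ∈ hufin.toFinset, volume (Metric.closedBall (b x).1 (5 * (b x).2)) := by
        gcongr
        exact (measure_mono hKsub).trans (measure_biUnion_finset_le _ _)
    _ = 25 * ∑ x ∈ hufin.toFinset, l * volume (Metric.ball (b x).1 (b x).2) := by
        simp only [hvol, Finset.mul_sum]
        exact Finset.sum_congr rfl fun x _ => by ring
    _ ≤ 25 * ∑ x ∈ hufin.toFinset, ∫⁻ y in Metric.ball (b x).1 (b x).2, H y := by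
        gcongr with x
        exact hball x
    _ = 25 * ∫⁻ y in ⋃ x ∈ hufin.toFinset, Metric.ball (b x).1 (b x).2, H y := by
        rw [lintegral_biUnion_finset]
        · intro x hx y hy hxy
          exact (hdisj (by simpa using hx) (by simpa using hy) hxy).mono
            Metric.ball_subset_closedBall Metric.ball_subset_closedBall
        · exact fun _ _ => measurableSet_ball
    _ ≤ 25 * ∫⁻ x, H x := by
        gcongr
        exact Measure.restrict_le_self

/-- The maximal function is bounded on `L²`. -/
theorem lintegral_maximalFunction_sq_le {H : Plane → ℝ≥0∞} (hH : Measurable H) :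
    ∫⁻ x, maximalFunction H x ^ (2 : ℝ) ≤ 200 * ∫⁻ x, H x ^ (2 : ℝ) := by
  -- Discarding the values of H below height l lowers every average by at most l. With l/2 in place
  -- of l, the level set at l only sees the part of H above l/2.
  have hsplit : ∀ l : ℝ≥0∞, ∀ x, maximalFunction H x
      ≤ maximalFunction ({y | l < H y}.indicator H) x + l := by
    intro l x
    refine iSup_le fun c => iSup_le fun r => iSup_le fun hx => ?_
    have hr : 0 < r := Metric.pos_of_mem_ball hx
    have hne : volume.restrict (Metric.ball c r) ≠ 0 := by
      rw [Ne, Measure.restrict_eq_zero]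
      exact (Metric.measure_ball_pos volume c hr).ne'
    have hfin : IsFiniteMeasure (volume.restrict (Metric.ball c r)) :=
      ⟨by rw [Measure.restrict_apply_univ]; exact measure_ball_lt_top⟩
    have : NeZero (volume.restrict (Metric.ball c r)) := ⟨hne⟩
    calc ⨍⁻ y, H y ∂(volume.restrict (Metric.ball c r))
        ≤ ⨍⁻ y, ({y | l < H y}.indicator H y + l) ∂(volume.restrict (Metric.ball c r)) := by
          refine laverage_mono_ae (ae_of_all _ fun y => ?_)
          by_cases hy : l < H y
          · simp [hy]
          · simp [hy, not_lt.1 hy]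
      _ = (⨍⁻ y, {y | l < H y}.indicator H y ∂(volume.restrict (Metric.ball c r))) + l := by
          rw [laverage, lintegral_add_left, ← laverage, lintegral_const, measure_univ, mul_one]
          exact (hH.indicator (measurableSet_lt measurable_const hH))
      _ ≤ _ := by
          gcongr
          exact laverage_ball_le_maximalFunction _ hx
  have hlevel : ∀ l ∈ Set.Ioi (0 : ℝ),
      volume {x | ENNReal.ofReal l < maximalFunction H x} * ENNReal.ofReal (l ^ ((2 : ℝ) - 1))
      ≤ 50 * ∫⁻ x, {y | ENNReal.ofReal (l / 2) < H y}.indicator H x := by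
    intro l hl
    have hl0 : (0 : ℝ) < l := hl
    have hhalf : ENNReal.ofReal l = ENNReal.ofReal (l / 2) + ENNReal.ofReal (l / 2) := by
      rw [← ENNReal.ofReal_add (by positivity) (by positivity)]; ring_nf
    have hsub : {x | ENNReal.ofReal l < maximalFunction H x} ⊆ {x | ENNReal.ofReal (l / 2) <
        maximalFunction ({y | ENNReal.ofReal (l / 2) < H y}.indicator H) x} := by
      intro x hx
      have h1 := lt_of_lt_of_le (show ENNReal.ofReal l < _ from hx)
        (hsplit (ENNReal.ofReal (l / 2)) x)
      rw [hhalf] at h1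
      exact lt_of_add_lt_add_right h1
    have h2 := mul_measure_lt_maximalFunction_le
      ({y | ENNReal.ofReal (l / 2) < H y}.indicator H) (ENNReal.ofReal (l / 2))
    have h3 : ENNReal.ofReal (l ^ ((2 : ℝ) - 1)) = 2 * ENNReal.ofReal (l / 2) := by
      rw [two_mul, ← hhalf]; norm_num
    rw [h3]
    calc _ ≤ volume {x | ENNReal.ofReal (l / 2) <
        maximalFunction ({y | ENNReal.ofReal (l / 2) < H y}.indicator H) x}
          * (2 * ENNReal.ofReal (l / 2)) := by gcongr
      _ = 2 * (ENNReal.ofReal (l / 2) * volume {x | ENNReal.ofReal (l / 2) <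
        maximalFunction ({y | ENNReal.ofReal (l / 2) < H y}.indicator H) x}) := by ring
      _ ≤ 2 * (25 * ∫⁻ x, {y | ENNReal.ofReal (l / 2) < H y}.indicator H x) := by gcongr
      _ = _ := by ring
  rw [lintegral_rpow_eq_lintegral_measure_lt volume (measurable_maximalFunction H) two_pos]
  have hm : Measurable (fun z : ℝ × Plane =>
      {y | ENNReal.ofReal (z.1 / 2) < H y}.indicator H z.2) := by
    have : (fun z : ℝ × Plane => {y | ENNReal.ofReal (z.1 / 2) < H y}.indicator H z.2)
        = {z : ℝ × Plane | ENNReal.ofReal (z.1 / 2) < H z.2}.indicator (fun z => H z.2) := by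
      ext z; simp [Set.indicator_apply]
    rw [this]
    exact (hH.comp measurable_snd).indicator (measurableSet_lt (by fun_prop) (by fun_prop))
  have hinner : ∀ x, ∫⁻ l in Set.Ioi (0 : ℝ), {y | ENNReal.ofReal (l / 2) < H y}.indicator H x
      = 2 * H x ^ (2 : ℝ) := by
    intro x
    have h5 : ∀ l : ℝ, l ∈ Set.Ioi (0 : ℝ) → {y | ENNReal.ofReal (l / 2) < H y}.indicator H x
        = H x * (if ENNReal.ofReal l < 2 * H x then ENNReal.ofReal (l ^ ((1 : ℝ) - 1)) else 0) := by
      intro l hl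
      have : ENNReal.ofReal (l / 2) < H x ↔ ENNReal.ofReal l < 2 * H x := by
        rw [ENNReal.ofReal_div_of_pos two_pos, ENNReal.ofReal_ofNat,
          ENNReal.div_lt_iff (by simp) (by simp), mul_comm]
      simp [Set.indicator_apply, this]
    rw [setLIntegral_congr_fun measurableSet_Ioi h5, lintegral_const_mul, lintegral_indicator_lt_rpow _ one_pos]
    · simp; rw [sq]; ring
    · exact Measurable.ite (measurableSet_lt (by fun_prop) (by fun_prop)) (by fun_prop) (by fun_prop)
  -- The constant is 2 · 50 · 2: the exponent in the layer cake formula, the weak type constant with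
  -- l = 2(l/2), and the length 2H(x) of the range of l for which x counts.
  calc ENNReal.ofReal 2 * ∫⁻ l in Set.Ioi (0 : ℝ),
        volume {x | ENNReal.ofReal l < maximalFunction H x} * ENNReal.ofReal (l ^ ((2 : ℝ) - 1))
      ≤ ENNReal.ofReal 2 * ∫⁻ l in Set.Ioi (0 : ℝ),
        50 * ∫⁻ x, {y | ENNReal.ofReal (l / 2) < H y}.indicator H x := by
        gcongr ENNReal.ofReal 2 * ?_
        exact setLIntegral_mono' measurableSet_Ioi hlevel
    _ = 100 * ∫⁻ x, ∫⁻ l in Set.Ioi (0 : ℝ), {y | ENNReal.ofReal (l / 2) < H y}.indicator H x := by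
        rw [lintegral_const_mul' _ _ (by simp), lintegral_lintegral_swap hm.aemeasurable,
          ← mul_assoc]
        norm_num
    _ = 200 * ∫⁻ x, H x ^ (2 : ℝ) := by
        simp_rw [hinner]
        rw [lintegral_const_mul' _ _ (by simp), ← mul_assoc]
        norm_num

theorem lintegral_comp_sub_smul {G : Plane → ℝ≥0∞} (hG : Measurable G) (x : Plane) {ε : ℝ}
    (hε : 0 < ε) : ∫⁻ y, G (x - ε • y) = ENNReal.ofReal ((ε ^ 2)⁻¹) * ∫⁻ y, G y := by
  have h1 : ∫⁻ y, G (x - ε • y) = ∫⁻ y, G (x - y) ∂(Measure.map (ε • ·) volume) := by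
    rw [lintegral_map (by fun_prop) (by fun_prop)]
  rw [h1, Measure.map_addHaar_smul _ hε.ne', lintegral_smul_measure,
    lintegral_sub_left_eq_self, finrank_euclideanSpace, Fintype.card_fin,
    abs_of_nonneg (by positivity), smul_eq_mul]

/-- Dilated averages against a Schwartz function are dominated by the maximal function. -/
theorem SchwartzMap.exists_lintegral_enorm_mul_le_maximalFunction (χ : 𝓢(Plane, ℂ)) :
    ∃ C : ℝ≥0, ∀ H : Plane → ℝ≥0∞, Measurable H → ∀ ε : ℝ, 0 < ε → ∀ x,
      ∫⁻ y, ‖χ y‖ₑ * H (x - ε • y) ≤ C * maximalFunction H x := by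
  obtain ⟨C₀, hC₀, h0⟩ := χ.decay 0 0
  obtain ⟨C₃, hC₃, h3⟩ := χ.decay 3 0
  simp only [pow_zero, one_mul, norm_iteratedFDeriv_zero] at h0 h3
  -- If j is the least index with ‖y‖ < 2^j, then |χ(y)| ≤ D 8^{-j}: C₀ serves j = 0, and for j > 0
  -- third-order decay with ‖y‖ ≥ 2^{j−1} costs the factor 8. Against disc areas of size 4^j the
  -- series converges like 2^{-j}.
  set D : ℝ := 8 * (C₀ + C₃)
  have hpt : ∀ y : Plane, ‖χ y‖ₑ ≤ ∑' j : ℕ, ENNReal.ofReal D * (1 / 8) ^ j *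
      (Metric.ball (0 : Plane) (2 ^ j)).indicator 1 y := by
    intro y
    have hex : ∃ j : ℕ, ‖y‖ < 2 ^ j := pow_unbounded_of_one_lt _ one_lt_two
    classical
    set j := Nat.find hex
    have hj : ‖y‖ < 2 ^ j := Nat.find_spec hex
    refine le_trans ?_ (ENNReal.le_tsum j)
    have hmem : y ∈ Metric.ball (0 : Plane) (2 ^ j) := by simpa using hj
    rw [Set.indicator_of_mem hmem, Pi.one_apply, mul_one]
    have hreal : ‖χ y‖ ≤ D * (1 / 8) ^ j := by
      rcases Nat.eq_zero_or_pos j with h | h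
      · rw [h, pow_zero, mul_one]
        have := h0 y
        simp only [D]; linarith
      · have h2 : (2 : ℝ) ^ (j - 1) ≤ ‖y‖ := not_lt.1 (Nat.find_min hex (Nat.sub_lt h one_pos))
        have h5 : ((2 : ℝ) ^ (j - 1)) ^ 3 * ‖χ y‖ ≤ C₃ := le_trans (by gcongr) (h3 y)
        have h6 : ((2 : ℝ) ^ (j - 1)) ^ 3 * 8 = 8 ^ j := by
          obtain ⟨k, hk⟩ := Nat.exists_eq_succ_of_ne_zero h.ne'
          rw [hk, Nat.succ_sub_one, ← pow_mul, mul_comm k 3, pow_mul, pow_succ (8 : ℝ)]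
          norm_num
        have h7 : (8 : ℝ) ^ j * ‖χ y‖ ≤ D := by
          rw [← h6]; simp only [D]; nlinarith
        rw [one_div, inv_pow, ← div_eq_mul_inv, le_div_iff₀ (by positivity), mul_comm]
        exact h7
    calc ‖χ y‖ₑ = ENNReal.ofReal ‖χ y‖ := (ofReal_norm _).symm
      _ ≤ ENNReal.ofReal (D * (1 / 8) ^ j) := ENNReal.ofReal_le_ofReal hreal
      _ = _ := by
        rw [ENNReal.ofReal_mul (by positivity), ENNReal.ofReal_pow (by positivity),
          ENNReal.ofReal_div_of_pos (by norm_num)]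
        simp
  set V : ℝ≥0∞ := volume (Metric.ball (0 : Plane) 1)
  have hV : V ≠ ∞ := measure_ball_lt_top.ne
  have hsum : (∑' j : ℕ, ENNReal.ofReal D * (1 / 8) ^ j * (4 ^ j * V)) ≠ ∞ := by
    have : ∀ j : ℕ, ENNReal.ofReal D * (1 / 8) ^ j * (4 ^ j * V)
        = ENNReal.ofReal D * V * (2⁻¹) ^ j := by
      intro j
      have : ((1 : ℝ≥0∞) / 8) ^ j * 4 ^ j = 2⁻¹ ^ j := by
        rw [← mul_pow]
        congr 1
        rw [one_div, ← ENNReal.toReal_eq_toReal_iff' (by finiteness) (by simp)]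
        simp; norm_num
      rw [← this]; ring
    simp_rw [this]
    rw [ENNReal.tsum_mul_left, ENNReal.tsum_geometric]
    refine ENNReal.mul_ne_top (ENNReal.mul_ne_top ENNReal.ofReal_ne_top hV) ?_
    simp
  refine ⟨(∑' j : ℕ, ENNReal.ofReal D * (1 / 8) ^ j * (4 ^ j * V)).toNNReal, ?_⟩
  intro H hH ε hε x
  rw [ENNReal.coe_toNNReal hsum, ← ENNReal.tsum_mul_right]
  calc ∫⁻ y, ‖χ y‖ₑ * H (x - ε • y)
      ≤ ∫⁻ y, ∑' j : ℕ, ENNReal.ofReal D * (1 / 8) ^ j *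
        ((Metric.ball (0 : Plane) (2 ^ j)).indicator 1 y * H (x - ε • y)) := by
        refine lintegral_mono fun y => ?_
        simp_rw [← mul_assoc]
        rw [ENNReal.tsum_mul_right]
        gcongr
        exact hpt y
    _ = ∑' j : ℕ, ENNReal.ofReal D * (1 / 8) ^ j * ∫⁻ y,
        ((Metric.ball (0 : Plane) (2 ^ j)).indicator 1 y * H (x - ε • y)) := by
        have hmeas : ∀ j : ℕ, Measurable fun y : Plane =>
            (Metric.ball (0 : Plane) (2 ^ j)).indicator 1 y * H (x - ε • y) := fun j =>
          (measurable_one.indicator measurableSet_ball).mul (by fun_prop)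
        rw [lintegral_tsum fun j => ((hmeas j).const_mul _).aemeasurable]
        exact tsum_congr fun j => lintegral_const_mul _ (hmeas j)
    _ ≤ _ := by
        refine ENNReal.tsum_le_tsum fun j => ?_
        rw [mul_assoc (ENNReal.ofReal D * (1 / 8) ^ j)]
        refine mul_le_mul_right ?_ _
        have hfun : ∀ y : Plane, (Metric.ball (0 : Plane) (2 ^ j)).indicator 1 y * H (x - ε • y)
            = (Metric.ball x (ε * 2 ^ j)).indicator H (x - ε • y) := by
          intro y
          have : x - ε • y ∈ Metric.ball x (ε * 2 ^ j) ↔ y ∈ Metric.ball (0 : Plane) (2 ^ j) := by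
            simp [Metric.mem_ball, dist_eq_norm, norm_smul, abs_of_pos hε, hε]
          by_cases hy : y ∈ Metric.ball (0 : Plane) (2 ^ j)
          · rw [Set.indicator_of_mem hy, Set.indicator_of_mem (this.2 hy), Pi.one_apply, one_mul]
          · rw [Set.indicator_of_notMem hy, Set.indicator_of_notMem (fun h => hy (this.1 h)),
              zero_mul]
        rw [lintegral_congr hfun]
        have hR : 0 < ε * 2 ^ j := by positivity
        rw [lintegral_comp_sub_smul (hH.indicator measurableSet_ball) x hε,
          lintegral_indicator measurableSet_ball]
        refine (mul_le_mul_right (lintegral_ball_le_maximalFunction H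
          (Metric.mem_ball_self hR)) _).trans_eq ?_
        rw [← mul_assoc, Measure.addHaar_ball _ _ hR.le, ← mul_assoc,
          ← ENNReal.ofReal_mul (by positivity), finrank_euclideanSpace, Fintype.card_fin]
        congr 2
        have : (ε ^ 2)⁻¹ * (ε * 2 ^ j) ^ 2 = 4 ^ j := by
          rw [mul_pow, ← mul_assoc, inv_mul_cancel₀ (by positivity), one_mul, ← pow_mul,
            mul_comm, pow_mul]
          norm_num
        rw [this, ENNReal.ofReal_pow (by norm_num)]
        norm_num

/-! ### The Fourier transform on integrable and square integrable functions. -/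

theorem locallyIntegrable_of_forall_schwartz {F : Plane → ℂ}
    (hF : ∀ φ : 𝓢(Plane, ℂ), Integrable (fun x => φ x * F x)) : LocallyIntegrable F := by
  intro x
  let b : ContDiffBump x := ⟨1, 2, by norm_num, by norm_num⟩
  let φ : 𝓢(Plane, ℂ) := HasCompactSupport.toSchwartzMap (f := fun y => ((b y : ℝ) : ℂ))
    (b.hasCompactSupport.comp_left Complex.ofReal_zero)
    (Complex.ofRealCLM.contDiff.comp b.contDiff)
  refine ⟨Metric.closedBall x 1, Metric.closedBall_mem_nhds x one_pos, ?_⟩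
  refine (hF φ).integrableOn.congr_fun (fun y hy => ?_) measurableSet_closedBall
  have : φ y = ((b y : ℝ) : ℂ) := rfl
  simp [this, b.one_of_mem_closedBall hy]

/-- Smooth compactly supported functions are Schwartz and already separate locally integrable
functions. This makes the function representing a tempered distribution unique almost everywhere. -/
theorem ae_eq_of_forall_schwartz {F G : Plane → ℂ}
    (hF : ∀ φ : 𝓢(Plane, ℂ), Integrable (fun x => φ x * F x))
    (hG : ∀ φ : 𝓢(Plane, ℂ), Integrable (fun x => φ x * G x))
    (h : ∀ φ : 𝓢(Plane, ℂ), ∫ x, φ x * F x = ∫ x, φ x * G x) : F =ᵐ[volume] G := by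
  refine ae_eq_of_integral_contDiff_smul_eq (locallyIntegrable_of_forall_schwartz hF)
    (locallyIntegrable_of_forall_schwartz hG) fun g hg hgc => ?_
  let φ : 𝓢(Plane, ℂ) := HasCompactSupport.toSchwartzMap (f := fun y => ((g y : ℝ) : ℂ))
    (hgc.comp_left Complex.ofReal_zero) (Complex.ofRealCLM.contDiff.comp hg)
  have hφ : ∀ y, φ y = ((g y : ℝ) : ℂ) := fun _ => rfl
  simpa [hφ] using h φ

theorem continuous_fourier_of_integrable {w : Plane → ℂ} (hw : Integrable w) :
    Continuous (𝓕 w) :=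
  VectorFourier.fourierIntegral_continuous Real.continuous_fourierChar
    (by exact continuous_inner) hw

theorem norm_fourier_le {w : Plane → ℂ} (ξ : Plane) : ‖𝓕 w ξ‖ ≤ ∫ x, ‖w x‖ :=
  VectorFourier.norm_fourierIntegral_le_integral_norm _ _ _ _ _

theorem integral_schwartz_mul_fourier {w : Plane → ℂ} (hw : Integrable w) (φ : 𝓢(Plane, ℂ)) :
    ∫ x, φ x * 𝓕 w x = ∫ x, (𝓕 φ) x * w x := by
  have := VectorFourier.integral_fourierIntegral_smul_eq_flip (L := innerₗ Plane)
    Real.continuous_fourierChar continuous_inner (φ.integrable (μ := volume)) hw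
  rw [flip_innerₗ] at this
  exact this.symm

theorem integrable_schwartz_mul_bounded (φ : 𝓢(Plane, ℂ)) {F : Plane → ℂ}
    (hF : AEStronglyMeasurable F) {C : ℝ} (hC : ∀ x, ‖F x‖ ≤ C) :
    Integrable (fun x => φ x * F x) :=
  φ.integrable.mul_bdd hF (ae_of_all _ hC)

theorem integrable_schwartz_mul_memLp (φ : 𝓢(Plane, ℂ)) {p : ℝ≥0∞} (hp : 1 ≤ p) {F : Plane → ℂ}
    (hF : MemLp F p) : Integrable (fun x => φ x * F x) := by
  have : p.conjExponent.HolderConjugate p := (ENNReal.HolderConjugate.conjExponent hp).symm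
  exact (φ.memLp p.conjExponent volume).integrable_mul hF

/-- The integral formula and the L² extension represent the same tempered distribution. Plancherel
can thus be used for the pointwise defined transform, which is needed at the points of a null set,
the curve. -/
theorem fourier_ae_eq_fourier_toLp {w : Plane → ℂ} (hw : Integrable w) (hw2 : MemLp w 2) :
    𝓕 w =ᵐ[volume] (𝓕 (hw2.toLp w) : Lp ℂ 2 (volume : Measure Plane)) := by
  refine ae_eq_of_forall_schwartz (fun φ => integrable_schwartz_mul_bounded φ
    (continuous_fourier_of_integrable hw).aestronglyMeasurable norm_fourier_le)
    (fun φ => integrable_schwartz_mul_memLp φ one_le_two (Lp.memLp _)) fun φ => ?_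
  have h1 := Lp.toTemperedDistribution_apply (𝓕 (hw2.toLp w)) φ
  rw [← Lp.fourier_toTemperedDistribution_eq, TemperedDistribution.fourier_apply,
    Lp.toTemperedDistribution_apply] at h1
  simp only [smul_eq_mul] at h1
  rw [← h1, integral_schwartz_mul_fourier hw]
  refine integral_congr_ae ?_
  filter_upwards [hw2.coeFn_toLp] with x hx
  rw [hx]

theorem lintegral_enorm_sq_fourier {w : Plane → ℂ} (hw : Integrable w) (hw2 : MemLp w 2) :
    ∫⁻ ξ, ‖𝓕 w ξ‖ₑ ^ (2 : ℝ) = ∫⁻ x, ‖w x‖ₑ ^ (2 : ℝ) := by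
  have h1 : eLpNorm (𝓕 w) 2 volume = eLpNorm w 2 volume := by
    rw [eLpNorm_congr_ae (fourier_ae_eq_fourier_toLp hw hw2), ← Lp.enorm_def,
      ← eLpNorm_congr_ae hw2.coeFn_toLp, ← Lp.enorm_def, ← ofReal_norm, ← ofReal_norm,
      Lp.norm_fourier_eq]
  have h2 : ∀ F : Plane → ℂ, ∫⁻ x, ‖F x‖ₑ ^ (2 : ℝ) = eLpNorm F 2 volume ^ (2 : ℝ) := fun F => by
    rw [eLpNorm_eq_lintegral_rpow_enorm_toReal two_ne_zero ENNReal.ofNat_ne_top,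
      ← ENNReal.rpow_mul]
    simp
  rw [h2, h2, h1]

/-- Multiplication by a dilate of `𝓕⁻ χ` averages the Fourier transform. -/
theorem fourier_fourierInv_smul_mul (χ : 𝓢(Plane, ℂ)) {w : Plane → ℂ} (hw : Integrable w)
    (ε : ℝ) (ξ : Plane) :
    𝓕 (fun x => (𝓕⁻ χ) (ε • x) * w x) ξ = ∫ y, χ y * 𝓕 w (ξ - ε • y) := by
  have hint : Integrable (Function.uncurry fun x y : Plane =>
      (Real.fourierChar (-inner ℝ x (ξ - ε • y)) : ℂ) * (w x * χ y)) := by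
    have h1 : Integrable (fun z : Plane × Plane => w z.1 * χ z.2) := hw.mul_prod χ.integrable
    refine h1.bdd_mul (c := 1) ?_ (ae_of_all _ fun z => (Circle.norm_coe _).le)
    refine Continuous.aestronglyMeasurable ?_
    exact continuous_subtype_val.comp (Real.continuous_fourierChar.comp (by fun_prop))
  calc 𝓕 (fun x => (𝓕⁻ χ) (ε • x) * w x) ξ
      = ∫ x, ∫ y, (Real.fourierChar (-inner ℝ x (ξ - ε • y)) : ℂ) * (w x * χ y) := by
        rw [Real.fourier_eq]
        refine integral_congr_ae (ae_of_all _ fun x => ?_)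
        simp only [SchwartzMap.fourierInv_coe, Real.fourierInv_eq]
        rw [Circle.smul_def, smul_eq_mul, ← integral_mul_const, ← integral_const_mul]
        refine integral_congr_ae (ae_of_all _ fun y => ?_)
        have : -inner ℝ x (ξ - ε • y) = -inner ℝ x ξ + inner ℝ y (ε • x) := by
          rw [inner_sub_right, real_inner_smul_right, real_inner_smul_right, real_inner_comm x y]
          ring
        simp only [this, AddChar.map_add_eq_mul, Circle.coe_mul, Circle.smul_def, smul_eq_mul]
        ring
    _ = ∫ y, ∫ x, (Real.fourierChar (-inner ℝ x (ξ - ε • y)) : ℂ) * (w x * χ y) :=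
        integral_integral_swap hint
    _ = _ := by
        refine integral_congr_ae (ae_of_all _ fun y => ?_)
        simp only [Real.fourier_eq]
        rw [← integral_const_mul]
        refine integral_congr_ae (ae_of_all _ fun x => ?_)
        simp only [Circle.smul_def, smul_eq_mul]
        ring

theorem SchwartzMap.exists_norm_le (χ : 𝓢(Plane, ℂ)) : ∃ B : ℝ, 0 < B ∧ ∀ x, ‖χ x‖ ≤ B := by
  obtain ⟨B, hB, h⟩ := χ.decay 0 0
  exact ⟨B, hB, fun x => by simpa using h x⟩

theorem integrable_dilate_mul (ψ : 𝓢(Plane, ℂ)) {w : Plane → ℂ} (hw : Integrable w) (ε : ℝ) :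
    Integrable (fun x => ψ (ε • x) * w x) := by
  obtain ⟨B, -, hB⟩ := ψ.exists_norm_le
  exact hw.bdd_mul (c := B) (by fun_prop) (ae_of_all _ fun x => hB _)

/-- The maximal function `sup_{ε, δ} |ŵ * χ_ε * χ_δ|` is bounded on `L²`. -/
theorem exists_biparameter_maximal_bound (χ : 𝓢(Plane, ℂ)) :
    ∃ C : ℝ≥0, ∀ w : Plane → ℂ, Integrable w → MemLp w 2 → ∃ N : Plane → ℝ≥0∞, Measurable N ∧
      (∀ ε δ : ℝ, 0 < ε → 0 < δ → ∀ ξ,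
        ‖𝓕 (fun x => (𝓕⁻ χ) (ε • x) * ((𝓕⁻ χ) (δ • x) * w x)) ξ‖ₑ ≤ N ξ) ∧
      ∫⁻ ξ, N ξ ^ (2 : ℝ) ≤ C * ∫⁻ x, ‖w x‖ₑ ^ (2 : ℝ) := by
  obtain ⟨D, hD⟩ := χ.exists_lintegral_enorm_mul_le_maximalFunction
  refine ⟨(D * D) ^ (2 : ℝ) * (200 * 200), fun w hw hw2 => ?_⟩
  have hm0 : Measurable (fun ξ => ‖𝓕 w ξ‖ₑ) :=
    (continuous_fourier_of_integrable hw).measurable.enorm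
  have hm1 := measurable_maximalFunction (fun ξ => ‖𝓕 w ξ‖ₑ)
  have step : ∀ (v : Plane → ℂ), Integrable v → ∀ ε : ℝ, 0 < ε → ∀ ξ,
      ‖𝓕 (fun x => (𝓕⁻ χ) (ε • x) * v x) ξ‖ₑ ≤ ∫⁻ y, ‖χ y‖ₑ * ‖𝓕 v (ξ - ε • y)‖ₑ := by
    intro v hv ε hε ξ
    rw [fourier_fourierInv_smul_mul χ hv]
    refine (enorm_integral_le_lintegral_enorm _).trans_eq ?_
    simp_rw [enorm_mul]
  -- Each of the two averages costs one maximal function and one factor D. The iterated maximal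
  -- function does not depend on ε and δ, so they may later vary with s and t.
  refine ⟨fun ξ => D * D * maximalFunction (maximalFunction (fun ξ => ‖𝓕 w ξ‖ₑ)) ξ,
    (measurable_maximalFunction _).const_mul _, ?_, ?_⟩
  · intro ε δ hε hδ ξ
    refine (step _ (integrable_dilate_mul _ hw δ) ε hε ξ).trans ?_
    calc _ ≤ ∫⁻ y, ‖χ y‖ₑ * (D * maximalFunction (fun ξ => ‖𝓕 w ξ‖ₑ) (ξ - ε • y)) := by
          refine lintegral_mono fun y => ?_
          gcongr
          exact (step w hw δ hδ _).trans (hD _ hm0 δ hδ _)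
      _ = D * ∫⁻ y, ‖χ y‖ₑ * maximalFunction (fun ξ => ‖𝓕 w ξ‖ₑ) (ξ - ε • y) := by
          rw [← lintegral_const_mul' _ _ ENNReal.coe_ne_top]
          exact lintegral_congr fun y => by ring
      _ ≤ _ := by
          beta_reduce
          rw [mul_assoc]
          gcongr
          exact hD _ hm1 ε hε ξ
  · simp_rw [ENNReal.mul_rpow_of_nonneg _ _ (zero_le_two (α := ℝ))]
    rw [lintegral_const_mul' _ _ (by finiteness)]
    calc _ ≤ ((D : ℝ≥0∞) ^ (2 : ℝ) * (D : ℝ≥0∞) ^ (2 : ℝ))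
          * (200 * (200 * ∫⁻ ξ, ‖𝓕 w ξ‖ₑ ^ (2 : ℝ))) := by
          gcongr
          refine (lintegral_maximalFunction_sq_le hm1).trans ?_
          gcongr
          exact lintegral_maximalFunction_sq_le hm0
      _ = _ := by
          rw [lintegral_enorm_sq_fourier hw hw2]
          rw [ENNReal.coe_mul, ENNReal.coe_rpow_of_nonneg _ zero_le_two, ENNReal.coe_mul,
            ENNReal.mul_rpow_of_nonneg _ _ zero_le_two]
          push_cast
          ring

/-! ### The squared adjoint operator in L². -/

/-- The change of variables estimate for the map `(s, t) ↦ Γ s + Γ t`, which encodes the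
curvature of `Γ` over `J`. -/
def SumMapBound (Γ : ℝ → Plane) (J : Set ℝ) (C : ℝ≥0) : Prop :=
  ∀ N : Plane → ℝ≥0∞, Measurable N →
    ∫⁻ z in J ×ˢ J, edist z.1 z.2 * N (Γ z.1 + Γ z.2) ≤ C * ∫⁻ ξ, N ξ

/-- The kernel of the linearized adjoint maximal operator. -/
noncomputable def adjointKernel (ψ : Plane → ℂ) (Γ : ℝ → Plane) (g : ℝ → ℂ) (e : ℝ → ℝ)
    (t : ℝ) (x : Plane) : ℂ :=
  g t * (Real.fourierChar (-inner ℝ x (Γ t)) * ψ (e t • x))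

section

variable {ψ : Plane → ℂ} {Γ : ℝ → Plane} {g : ℝ → ℂ} {e : ℝ → ℝ}

theorem measurable_adjointKernel (hψ : Continuous ψ) (hΓ : Measurable Γ) (hg : Measurable g)
    (he : Measurable e) :
    Measurable (fun z : ℝ × Plane => adjointKernel ψ Γ g e z.1 z.2) := by
  refine (hg.comp measurable_fst).mul (Measurable.mul ?_ ?_)
  · exact (continuous_subtype_val.comp Real.continuous_fourierChar).measurable.comp
      (measurable_snd.inner (hΓ.comp measurable_fst)).neg
  · exact hψ.measurable.comp ((he.comp measurable_fst).smul measurable_snd)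

theorem norm_adjointKernel_le {B : ℝ} (hB : ∀ x, ‖ψ x‖ ≤ B) (hg : ∀ t, ‖g t‖ ≤ 1) (t : ℝ)
    (x : Plane) : ‖adjointKernel ψ Γ g e t x‖ ≤ B := by
  have hB0 : 0 ≤ B := (norm_nonneg _).trans (hB 0)
  rw [adjointKernel, norm_mul, norm_mul, Circle.norm_coe, one_mul]
  calc _ ≤ 1 * B := mul_le_mul (hg t) (hB _) (norm_nonneg _) zero_le_one
    _ = B := one_mul B

/-- `∫∫_S k(s, x) k(t, x) ds dt` for the adjoint kernel `k`. -/
noncomputable def bilinearAdjoint (ψ : Plane → ℂ) (Γ : ℝ → Plane) (g : ℝ → ℂ) (e : ℝ → ℝ)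
    (S : Set (ℝ × ℝ)) (x : Plane) : ℂ :=
  ∫ z in S, adjointKernel ψ Γ g e z.1 x * adjointKernel ψ Γ g e z.2 x

theorem measurable_adjointKernel_mul (hψ : Continuous ψ) (hΓ : Measurable Γ) (hg : Measurable g)
    (he : Measurable e) : Measurable (fun z : Plane × (ℝ × ℝ) =>
      adjointKernel ψ Γ g e z.2.1 z.1 * adjointKernel ψ Γ g e z.2.2 z.1) := by
  have h := measurable_adjointKernel hψ hΓ hg he
  exact (h.comp (f := fun z : Plane × (ℝ × ℝ) => (z.2.1, z.1)) (by fun_prop)).mul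
    (h.comp (f := fun z : Plane × (ℝ × ℝ) => (z.2.2, z.1)) (by fun_prop))

theorem measurable_bilinearAdjoint (hψ : Continuous ψ) (hΓ : Measurable Γ) (hg : Measurable g)
    (he : Measurable e) (S : Set (ℝ × ℝ)) : Measurable (bilinearAdjoint ψ Γ g e S) :=
  ((measurable_adjointKernel_mul hψ hΓ hg he).stronglyMeasurable.integral_prod_right
    (ν := volume.restrict S)).measurable

theorem norm_adjointKernel_mul_le {B : ℝ} (hB : ∀ x, ‖ψ x‖ ≤ B) (hg : ∀ t, ‖g t‖ ≤ 1)
    (s t : ℝ) (x : Plane) :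
    ‖adjointKernel ψ Γ g e s x * adjointKernel ψ Γ g e t x‖ ≤ B ^ 2 := by
  rw [norm_mul, sq]
  exact mul_le_mul (norm_adjointKernel_le hB hg _ _) (norm_adjointKernel_le hB hg _ _)
    (norm_nonneg _) ((norm_nonneg _).trans (hB 0))

theorem norm_bilinearAdjoint_le {B : ℝ} (hB : ∀ x, ‖ψ x‖ ≤ B) (hg : ∀ t, ‖g t‖ ≤ 1)
    {S : Set (ℝ × ℝ)} (hS : volume S < ∞) (x : Plane) :
    ‖bilinearAdjoint ψ Γ g e S x‖ ≤ B ^ 2 * volume.real S :=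
  norm_setIntegral_le_of_norm_le_const hS fun _ _ => norm_adjointKernel_mul_le hB hg _ _ _

end

theorem lintegral_mul_le_sqrt {α : Type*} [MeasurableSpace α] {μ : Measure α} {f g : α → ℝ≥0∞}
    (hf : AEMeasurable f μ) (hg : AEMeasurable g μ) :
    (∫⁻ x, f x * g x ∂μ) ^ (2 : ℝ)
      ≤ (∫⁻ x, f x ^ (2 : ℝ) ∂μ) * ∫⁻ x, g x ^ (2 : ℝ) ∂μ := by
  have h := ENNReal.lintegral_mul_le_Lp_mul_Lq μ Real.HolderConjugate.two_two hf hg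
  calc _ ≤ ((∫⁻ x, f x ^ (2 : ℝ) ∂μ) ^ (1 / (2 : ℝ))
        * (∫⁻ x, g x ^ (2 : ℝ) ∂μ) ^ (1 / (2 : ℝ))) ^ (2 : ℝ) := by
        gcongr
        exact h
    _ = _ := by
        rw [ENNReal.mul_rpow_of_nonneg _ _ zero_le_two, ← ENNReal.rpow_mul, ← ENNReal.rpow_mul]
        norm_num

/-- `L²` bound for the part of the squared adjoint operator away from the diagonal. -/
theorem exists_lintegral_bilinearAdjoint_sq_le (χ : 𝓢(Plane, ℂ)) (C₀ : ℝ≥0) :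
    ∃ C : ℝ≥0, ∀ (Γ : ℝ → Plane) (J : Set ℝ), Measurable Γ → MeasurableSet J →
      SumMapBound Γ J C₀ → ∀ (g : ℝ → ℂ) (e : ℝ → ℝ), Measurable g → Measurable e →
      (∀ t, ‖g t‖ ≤ 1) → (∀ t, 0 < e t) → ∀ S : Set (ℝ × ℝ), MeasurableSet S → volume S < ∞ →
      S ⊆ J ×ˢ J → (∀ z ∈ S, z.1 ≠ z.2) →
      ∫⁻ x, ‖bilinearAdjoint (𝓕⁻ χ : 𝓢(Plane, ℂ)) Γ g e S x‖ₑ ^ (2 : ℝ)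
        ≤ C * ∫⁻ z in S, (edist z.1 z.2)⁻¹ := by
  obtain ⟨C₁, hC₁⟩ := exists_biparameter_maximal_bound χ
  refine ⟨C₀ * C₁, ?_⟩
  intro Γ J hΓ hJ hCV g e hg he hg1 he0 S hS hSfin hSJ hdiag
  set ψ : 𝓢(Plane, ℂ) := 𝓕⁻ χ with hψdef
  obtain ⟨B, hBpos, hB⟩ := ψ.exists_norm_le
  set u := bilinearAdjoint ψ Γ g e S with hu
  have hum : Measurable u := measurable_bilinearAdjoint ψ.continuous hΓ hg he S
  have hub : ∀ x, ‖u x‖ ≤ B ^ 2 * volume.real S := norm_bilinearAdjoint_le hB hg1 hSfin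
  -- Restricting to sets of finite measure, where the bounded function u is square integrable, makes
  -- a finite, so that it can be cancelled at the end.
  refine lintegral_le_of_forall_fin_meas_le _ ?_
  intro s hs hsfin
  -- Dual function: w u = |u|² on s, so a equals the pairing of w with u, and ‖w‖₂² = a.
  set w : Plane → ℂ := s.indicator (fun x => starRingEnd ℂ (u x)) with hw
  have hwm : Measurable w := (RCLike.continuous_conj.measurable.comp hum).indicator hs
  have hwb : ∀ x, ‖w x‖ ≤ B ^ 2 * volume.real S := fun x => by
    rw [hw]
    refine (norm_indicator_le_norm_self _ _).trans ?_
    rw [RCLike.norm_conj]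
    exact hub x
  have hsf : IsFiniteMeasure (volume.restrict s) :=
    ⟨by rw [Measure.restrict_apply_univ]; exact hsfin.lt_top⟩
  have hwint : Integrable w := by
    rw [hw, integrable_indicator_iff hs]
    refine Integrable.of_bound (RCLike.continuous_conj.measurable.comp hum).aestronglyMeasurable
      (B ^ 2 * volume.real S) (ae_of_all _ fun x => ?_)
    simpa using hub x
  have hw2 : MemLp w 2 := by
    rw [hw, memLp_indicator_iff_restrict hs]
    refine MemLp.of_bound (RCLike.continuous_conj.measurable.comp hum).aestronglyMeasurable
      (B ^ 2 * volume.real S) (ae_of_all _ fun x => ?_)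
    simpa using hub x
  have hwsq : ∫⁻ x, ‖w x‖ₑ ^ (2 : ℝ) = ∫⁻ x in s, ‖u x‖ₑ ^ (2 : ℝ) := by
    rw [← lintegral_indicator hs]
    refine lintegral_congr fun x => ?_
    by_cases hx : x ∈ s
    · simp [hw, hx]
    · simp [hw, hx]
  obtain ⟨N, hNm, hN, hN2⟩ := hC₁ w hwint hw2
  set a := ∫⁻ x in s, ‖u x‖ₑ ^ (2 : ℝ) with ha
  have hafin : a ≠ ∞ := by
    rw [← hwsq]
    have := hw2.eLpNorm_lt_top
    rw [eLpNorm_lt_top_iff_lintegral_rpow_enorm_lt_top two_ne_zero ENNReal.ofNat_ne_top] at this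
    simpa using this.ne
  have hSf : IsFiniteMeasure (volume.restrict S) :=
    ⟨by rw [Measure.restrict_apply_univ]; exact hSfin⟩
  have hfub : ∫ x, w x * u x = ∫ z in S, ∫ x, w x *
      (adjointKernel ψ Γ g e z.1 x * adjointKernel ψ Γ g e z.2 x) := by
    have hint : Integrable (Function.uncurry fun (x : Plane) (z : ℝ × ℝ) => w x *
        (adjointKernel ψ Γ g e z.1 x * adjointKernel ψ Γ g e z.2 x))
        (volume.prod (volume.restrict S)) := by
      have h1 : Integrable (fun q : Plane × (ℝ × ℝ) => w q.1)
          (volume.prod (volume.restrict S)) := hwint.comp_fst _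
      exact h1.mul_bdd (c := B ^ 2)
        (measurable_adjointKernel_mul ψ.continuous hΓ hg he).aestronglyMeasurable
        (ae_of_all _ fun q => norm_adjointKernel_mul_le hB hg1 _ _ _)
    rw [← integral_integral_swap hint]
    refine integral_congr_ae (ae_of_all _ fun x => ?_)
    simp only [hu, bilinearAdjoint, integral_const_mul]
  have hker : ∀ z : ℝ × ℝ, ‖∫ x, w x *
      (adjointKernel ψ Γ g e z.1 x * adjointKernel ψ Γ g e z.2 x)‖ₑ ≤ N (Γ z.1 + Γ z.2) := by
    -- The product of the two kernels carries the character at Γ(s) + Γ(t). The inner integral is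
    -- hence a two-scale average of ŵ at that point, with scales e(s) and e(t).
    intro z
    have h1 : ∫ x, w x * (adjointKernel ψ Γ g e z.1 x * adjointKernel ψ Γ g e z.2 x)
        = (g z.1 * g z.2) *
          𝓕 (fun x => ψ (e z.1 • x) * (ψ (e z.2 • x) * w x)) (Γ z.1 + Γ z.2) := by
      rw [Real.fourier_eq, ← integral_const_mul]
      refine integral_congr_ae (ae_of_all _ fun x => ?_)
      simp only [adjointKernel, inner_add_right, neg_add, AddChar.map_add_eq_mul, Circle.smul_def,
        Circle.coe_mul, smul_eq_mul]
      ring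
    rw [h1, enorm_mul]
    refine le_trans ?_ (hN _ _ (he0 z.1) (he0 z.2) _)
    have : ‖g z.1 * g z.2‖ₑ ≤ 1 := by
      rw [← ofReal_norm, ← ENNReal.ofReal_one, norm_mul]
      exact ENNReal.ofReal_le_ofReal (mul_le_one₀ (hg1 _) (norm_nonneg _) (hg1 _))
    calc _ ≤ 1 * ‖𝓕 (fun x => ψ (e z.1 • x) * (ψ (e z.2 • x) * w x)) (Γ z.1 + Γ z.2)‖ₑ := by
          gcongr
      _ = _ := one_mul _
  have hleft : a ≤ ‖∫ x, w x * u x‖ₑ := by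
    have h1 : ∀ x, w x * u x = ((s.indicator (fun x => ‖u x‖ ^ 2) x : ℝ) : ℂ) := by
      intro x
      by_cases hx : x ∈ s
      · simp [hw, hx, RCLike.conj_mul]
      · simp [hw, hx]
    simp_rw [h1]
    rw [integral_complex_ofReal, integral_indicator hs, ← ofReal_norm, Complex.norm_real,
      Real.norm_of_nonneg (integral_nonneg fun _ => by positivity),
      ofReal_integral_eq_lintegral_ofReal, ha]
    · refine lintegral_mono fun x => ?_
      rw [← ofReal_norm, ENNReal.ofReal_rpow_of_nonneg (norm_nonneg _) zero_le_two]
      simp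
    · refine Integrable.of_bound (hum.norm.pow_const 2).aestronglyMeasurable
        ((B ^ 2 * volume.real S) ^ 2) (ae_of_all _ fun x => ?_)
      rw [Real.norm_of_nonneg (by positivity)]
      gcongr
      exact hub x
    · exact ae_of_all _ fun _ => by positivity
  have hNΓ : Measurable (fun z : ℝ × ℝ => N (Γ z.1 + Γ z.2)) :=
    hNm.comp ((hΓ.comp measurable_fst).add (hΓ.comp measurable_snd))
  have hmain : a ≤ ∫⁻ z in S, N (Γ z.1 + Γ z.2) := by
    refine hleft.trans ?_
    rw [hfub]
    exact (enorm_integral_le_lintegral_enorm _).trans (lintegral_mono fun z => hker z)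
  have hedm : Measurable (fun z : ℝ × ℝ => edist z.1 z.2) := measurable_edist
  -- Cauchy–Schwarz with the weight |s − t|, which is the lower bound for the Jacobian of the sum
  -- map: one factor is the integral of 1/|s − t|, the other is bounded by ‖N‖₂² after changing
  -- variables. Off the diagonal the weight may be inserted and removed.
  have hCS : a ^ (2 : ℝ) ≤ (∫⁻ z in S, (edist z.1 z.2)⁻¹) * (C₀ * C₁ * a) := by
    calc a ^ (2 : ℝ) ≤ (∫⁻ z in S, N (Γ z.1 + Γ z.2)) ^ (2 : ℝ) := by gcongr
      _ = (∫⁻ z in S, (edist z.1 z.2) ^ (-(1 / 2) : ℝ) *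
          ((edist z.1 z.2) ^ ((1 / 2) : ℝ) * N (Γ z.1 + Γ z.2))) ^ (2 : ℝ) := by
          congr 1
          refine setLIntegral_congr_fun hS fun z hz => ?_
          have h0 : edist z.1 z.2 ≠ 0 := fun h => hdiag z hz (edist_eq_zero.1 h)
          rw [← mul_assoc, ← ENNReal.rpow_add _ _ h0 (edist_ne_top _ _)]
          simp
      _ ≤ _ := by
          refine (lintegral_mul_le_sqrt (hedm.pow_const _).aemeasurable
            ((hedm.pow_const _).mul hNΓ).aemeasurable).trans ?_
          gcongr ?_ * ?_
          · refine lintegral_mono fun z => ?_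
            rw [← ENNReal.rpow_mul, ← ENNReal.rpow_neg_one]
            norm_num
          · calc _ = ∫⁻ z in S, edist z.1 z.2 * N (Γ z.1 + Γ z.2) ^ (2 : ℝ) := by
                  refine lintegral_congr fun z => ?_
                  rw [Pi.mul_apply, ENNReal.mul_rpow_of_nonneg _ _ zero_le_two, ← ENNReal.rpow_mul]
                  norm_num
              _ ≤ ∫⁻ z in J ×ˢ J, edist z.1 z.2 * N (Γ z.1 + Γ z.2) ^ (2 : ℝ) :=
                  lintegral_mono_set hSJ
              _ ≤ C₀ * ∫⁻ ξ, N ξ ^ (2 : ℝ) := hCV _ (hNm.pow_const _)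
              _ ≤ C₀ * (C₁ * a) := by
                  gcongr
                  exact hN2.trans_eq (by rw [hwsq])
              _ = _ := by ring
  rcases eq_or_ne a 0 with h0 | h0
  · rw [h0]; exact zero_le
  · have h3 : a * a ≤ (↑(C₀ * C₁) * ∫⁻ z in S, (edist z.1 z.2)⁻¹) * a := by
      calc a * a = a ^ (2 : ℝ) := by rw [ENNReal.rpow_two, sq]
        _ ≤ _ := hCS
        _ = _ := by push_cast; ring
    exact (ENNReal.mul_le_mul_iff_left h0 hafin).1 h3

/-! ### Riesz potentials and the restricted strong type estimate. -/

/-- Rearrangement bound for the Riesz potential of a set. -/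
theorem lintegral_edist_rpow_le (A : Set ℝ) (hA0 : volume A ≠ 0)
    (hAfin : volume A ≠ ∞) (s : ℝ) {b : ℝ} (hb0 : 0 < b) (hb1 : b < 1) :
    ∫⁻ t in A, edist s t ^ (b - 1) ≤ (2 / ENNReal.ofReal b + 1) * volume A ^ b := by
  set m := volume A with hm
  have hhalf : ∫⁻ l in Set.Ioi (0 : ℝ),
      (if ENNReal.ofReal l < m then ENNReal.ofReal (l ^ (b - 1)) else 0)
        = m ^ b / ENNReal.ofReal b := lintegral_indicator_lt_rpow m hb0
  -- The kernel |l|^{b−1} is cut at distance m = |A|: inside, its full integral is 2m^b/b; outside,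
  -- it is at most m^{b−1} and the set has measure m.
  set h : ℝ → ℝ≥0∞ := fun l => if ENNReal.ofReal |l| < m then ENNReal.ofReal |l| ^ (b - 1) else 0
    with hh
  have hhm : Measurable h := Measurable.ite (measurableSet_lt (by fun_prop) measurable_const)
    (by fun_prop) measurable_const
  have hpos : ∫⁻ l in Set.Ioi (0 : ℝ), h l = m ^ b / ENNReal.ofReal b := by
    rw [← hhalf]
    refine setLIntegral_congr_fun measurableSet_Ioi fun l hl => ?_
    have hl0 : (0 : ℝ) < l := hl
    simp only [hh, abs_of_pos hl0, ENNReal.ofReal_rpow_of_pos hl0]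
  have hneg : ∫⁻ l in Set.Iio (0 : ℝ), h l = m ^ b / ENNReal.ofReal b := by
    rw [← hpos, ← lintegral_indicator measurableSet_Iio, ← lintegral_indicator measurableSet_Ioi,
      ← lintegral_neg_eq_self]
    refine lintegral_congr fun l => ?_
    simp [Set.indicator_apply, hh]
  have htot : ∫⁻ l, h l = 2 / ENNReal.ofReal b * m ^ b := by
    rw [← lintegral_add_compl h (measurableSet_Ioi (a := (0 : ℝ))), Set.compl_Ioi,
      ← restrict_Iio_eq_restrict_Iic, hpos, hneg, ENNReal.div_eq_inv_mul, ENNReal.div_eq_inv_mul]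
    ring
  calc ∫⁻ t in A, edist s t ^ (b - 1)
      ≤ ∫⁻ t in A, (h (s - t) + m ^ (b - 1)) := by
        refine lintegral_mono fun t => ?_
        rw [edist_dist, Real.dist_eq]
        by_cases hlt : ENNReal.ofReal |s - t| < m
        · simp [hh, hlt]
        · simp only [hh, hlt, if_false, zero_add]
          rw [show b - 1 = -(1 - b) by ring, ENNReal.rpow_neg, ENNReal.rpow_neg]
          exact ENNReal.inv_le_inv.2 (ENNReal.rpow_le_rpow (not_lt.1 hlt) (by linarith))
    _ ≤ (∫⁻ t, h (s - t)) + m ^ (b - 1) * m := by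
        rw [lintegral_add_right _ measurable_const, setLIntegral_const]
        gcongr
        exact Measure.restrict_le_self
    _ = _ := by
        rw [lintegral_sub_left_eq_self h s, htot, add_mul, one_mul]
        congr 1
        conv_lhs => rw [← ENNReal.rpow_one m, ← ENNReal.rpow_mul, ← ENNReal.rpow_add _ _ hA0 hAfin]
        simp

theorem lintegral_prod_edist_rpow_le (A : Set ℝ) (hA0 : volume A ≠ 0)
    (hAfin : volume A ≠ ∞) {b : ℝ} (hb0 : 0 < b) (hb1 : b < 1) :
    ∫⁻ z in A ×ˢ A, edist z.1 z.2 ^ (b - 1)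
      ≤ (2 / ENNReal.ofReal b + 1) * volume A ^ (b + 1) := by
  rw [Measure.volume_eq_prod, ← Measure.prod_restrict,
    lintegral_prod _ (by fun_prop)]
  calc _ ≤ ∫⁻ _ in A, (2 / ENNReal.ofReal b + 1) * volume A ^ b :=
        lintegral_mono fun s => lintegral_edist_rpow_le A hA0 hAfin s hb0 hb1
    _ = _ := by
        rw [setLIntegral_const, mul_assoc]
        conv_lhs => enter [2, 2]; rw [← ENNReal.rpow_one (volume A)]
        rw [← ENNReal.rpow_add _ _ hA0 hAfin]

/-- Each slice of the strip lies in an interval of length 2δ. -/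
theorem volume_prod_near_diagonal_le (A : Set ℝ) (hA : MeasurableSet A) (δ : ℝ) :
    volume ((A ×ˢ A) ∩ {z : ℝ × ℝ | dist z.1 z.2 ≤ δ}) ≤ volume A * ENNReal.ofReal (2 * δ) := by
  have hS : MeasurableSet {z : ℝ × ℝ | dist z.1 z.2 ≤ δ} :=
    measurableSet_le (by fun_prop) measurable_const
  rw [Measure.volume_eq_prod, Measure.prod_apply ((hA.prod hA).inter hS)]
  calc _ ≤ ∫⁻ s, A.indicator (fun _ => ENNReal.ofReal (2 * δ)) s := by
        refine lintegral_mono fun s => ?_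
        by_cases hs : s ∈ A
        · rw [Set.indicator_of_mem hs, ← Real.volume_closedBall (a := s)]
          refine measure_mono fun t ht => ?_
          rw [Metric.mem_closedBall, dist_comm]
          exact ht.2
        · rw [Set.indicator_of_notMem hs]
          refine le_of_eq (measure_mono_null (t := ∅) (fun t ht => hs ht.1.1) measure_empty)
    _ = _ := by rw [lintegral_indicator_const hA, mul_comm]

/-- The adjoint operator. -/
noncomputable def linearAdjoint (ψ : Plane → ℂ) (Γ : ℝ → Plane) (g : ℝ → ℂ) (e : ℝ → ℝ)
    (A : Set ℝ) (x : Plane) : ℂ :=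
  ∫ t in A, adjointKernel ψ Γ g e t x

theorem measurable_linearAdjoint {ψ : Plane → ℂ} {Γ : ℝ → Plane} {g : ℝ → ℂ} {e : ℝ → ℝ}
    (hψ : Continuous ψ) (hΓ : Measurable Γ) (hg : Measurable g) (he : Measurable e) (A : Set ℝ) :
    Measurable (linearAdjoint ψ Γ g e A) :=
  ((measurable_adjointKernel hψ hΓ hg he).stronglyMeasurable.integral_prod_left
    (μ := volume.restrict A)).measurable

/-- Restricted strong type estimate for the linearized adjoint maximal operator. -/
theorem exists_lintegral_linearAdjoint_rpow_le (χ : 𝓢(Plane, ℂ)) (C₀ : ℝ≥0) {ρ : ℝ} (hρ2 : 2 < ρ)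
    (hρ3 : ρ < 3) :
    ∃ C : ℝ≥0, ∀ (Γ : ℝ → Plane) (J : Set ℝ), Measurable Γ → MeasurableSet J →
      SumMapBound Γ J C₀ → ∀ (g : ℝ → ℂ) (e : ℝ → ℝ), Measurable g → Measurable e →
      (∀ t, ‖g t‖ ≤ 1) → (∀ t, 0 < e t) → ∀ A : Set ℝ, MeasurableSet A → volume A ≠ ∞ →
      A ⊆ J →
      ∫⁻ x, ‖linearAdjoint (𝓕⁻ χ : 𝓢(Plane, ℂ)) Γ g e A x‖ₑ ^ (2 * ρ)
        ≤ C * volume A ^ (2 * ρ - 3) := by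
  obtain ⟨C₁, hC₁⟩ := exists_lintegral_bilinearAdjoint_sq_le χ C₀
  obtain ⟨B, hBpos, hB⟩ := (𝓕⁻ χ : 𝓢(Plane, ℂ)).exists_norm_le
  set K : ℝ≥0∞ := ENNReal.ofReal ρ * (4 * C₁ * (ENNReal.ofReal (4 * B ^ 2) ^ (ρ - 2) /
    ENNReal.ofReal (ρ - 2))) * (2 / ENNReal.ofReal (ρ - 2) + 1) with hK
  have hρ2' : 0 < ρ - 2 := by linarith
  have hK' : ENNReal.ofReal (ρ - 2) ≠ 0 := by simpa using hρ2'
  have hKfin : K ≠ ∞ := by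
    have : ENNReal.ofReal (4 * B ^ 2) ^ (ρ - 2) ≠ ∞ :=
      ENNReal.rpow_ne_top_of_nonneg hρ2'.le ENNReal.ofReal_ne_top
    rw [hK]
    finiteness
  refine ⟨K.toNNReal, ?_⟩
  rw [ENNReal.coe_toNNReal hKfin]
  intro Γ J hΓ hJ hCV g e hg he hg1 he0 A hA hAfin hAJ
  set ψ : 𝓢(Plane, ℂ) := 𝓕⁻ χ with hψ
  set E := linearAdjoint ψ Γ g e A with hE
  have hEm : Measurable E := measurable_linearAdjoint ψ.continuous hΓ hg he A
  rcases eq_or_ne (volume A) 0 with hA0 | hA0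
  · have : ∀ x, E x = 0 := fun x => by
      rw [hE, linearAdjoint, Measure.restrict_eq_zero.2 hA0, integral_zero_measure]
    simp only [this, enorm_zero]
    rw [ENNReal.zero_rpow_of_pos (by linarith)]
    simp
  have hmpos : 0 < volume.real A := ENNReal.toReal_pos hA0 hAfin
  set m := volume.real A with hm
  have hmE : volume A = ENNReal.ofReal m := (ENNReal.ofReal_toReal hAfin).symm
  have hAAfin : volume (A ×ˢ A) < ∞ := by
    rw [Measure.volume_eq_prod, Measure.prod_prod]
    exact ENNReal.mul_lt_top hAfin.lt_top hAfin.lt_top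
  have hAAf : IsFiniteMeasure (volume.restrict (A ×ˢ A)) :=
    ⟨by rw [Measure.restrict_apply_univ]; exact hAAfin⟩
  have hsq : ∀ x, E x * E x = bilinearAdjoint ψ Γ g e (A ×ˢ A) x := fun x => by
    rw [bilinearAdjoint, Measure.volume_eq_prod]
    exact (setIntegral_prod_mul _ _ A A).symm
  have hlevel : ∀ l ∈ Set.Ioi (0 : ℝ),
      volume {x | ENNReal.ofReal l < ‖E x‖ₑ ^ (2 : ℝ)} * ENNReal.ofReal (l ^ (ρ - 1))
      ≤ ∫⁻ z in A ×ˢ A, 4 * C₁ * (edist z.1 z.2)⁻¹ *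
        (if ENNReal.ofReal l < ENNReal.ofReal (4 * B ^ 2 * m) * edist z.1 z.2
          then ENNReal.ofReal (l ^ ((ρ - 2) - 1)) else 0) := by
    intro l hl
    have hl0 : (0 : ℝ) < l := hl
    -- The strip |s − t| ≤ δ has area at most 2mδ and the kernel product is at most B², so it
    -- contributes at most l/2 to E². The far part must then exceed l/2 wherever |E|² > l.
    set δ : ℝ := l / (4 * B ^ 2 * m) with hδ
    have hδ0 : 0 < δ := by positivity
    set near : Set (ℝ × ℝ) := {z | dist z.1 z.2 ≤ δ} with hnear
    have hnearm : MeasurableSet near := measurableSet_le (by fun_prop) measurable_const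
    set far : Set (ℝ × ℝ) := (A ×ˢ A) ∩ nearᶜ with hfar
    have hfarm : MeasurableSet far := (hA.prod hA).inter hnearm.compl
    have hfarfin : volume far < ∞ := (measure_mono Set.inter_subset_left).trans_lt hAAfin
    have hnb : ∀ x, ‖bilinearAdjoint ψ Γ g e ((A ×ˢ A) ∩ near) x‖ ≤ l / 2 := fun x => by
      refine (norm_bilinearAdjoint_le hB hg1
        ((measure_mono Set.inter_subset_left).trans_lt hAAfin) x).trans ?_
      have h1 : volume.real ((A ×ˢ A) ∩ near) ≤ m * (2 * δ) := by
        refine ENNReal.toReal_le_of_le_ofReal (by positivity) ?_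
        rw [ENNReal.ofReal_mul hmpos.le, ← hmE]
        exact volume_prod_near_diagonal_le A hA δ
      calc B ^ 2 * volume.real ((A ×ˢ A) ∩ near) ≤ B ^ 2 * (m * (2 * δ)) := by gcongr
        _ = l / 2 := by rw [hδ]; field_simp; ring
    have hsplit : ∀ x, E x * E x = bilinearAdjoint ψ Γ g e ((A ×ˢ A) ∩ near) x
        + bilinearAdjoint ψ Γ g e far x := fun x => by
      rw [hsq x]
      refine (integral_inter_add_sdiff (s := A ×ˢ A) (t := near) hnearm ?_).symm
      refine Integrable.of_bound ?_ (B ^ 2) (ae_of_all _ fun z =>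
        norm_adjointKernel_mul_le hB hg1 _ _ _)
      exact ((measurable_adjointKernel_mul ψ.continuous hΓ hg he).comp
        (measurable_prodMk_left (x := x))).aestronglyMeasurable
    have hsub : {x | ENNReal.ofReal l < ‖E x‖ₑ ^ (2 : ℝ)} ⊆ {x | ENNReal.ofReal (l / 2) ^ (2 : ℝ)
        ≤ ‖bilinearAdjoint ψ Γ g e far x‖ₑ ^ (2 : ℝ)} := by
      intro x hx
      have h1 : l < ‖E x * E x‖ := by
        have h2 : ENNReal.ofReal l < ‖E x‖ₑ ^ (2 : ℝ) := hx
        rw [ENNReal.rpow_two, sq, ← enorm_mul, ← ofReal_norm] at h2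
        exact (ENNReal.ofReal_lt_ofReal_iff_of_nonneg hl0.le).1 h2
      rw [hsplit x] at h1
      have h3 := norm_add_le (bilinearAdjoint ψ Γ g e ((A ×ˢ A) ∩ near) x)
        (bilinearAdjoint ψ Γ g e far x)
      have h4 : l / 2 ≤ ‖bilinearAdjoint ψ Γ g e far x‖ := by linarith [hnb x]
      refine ENNReal.rpow_le_rpow ?_ zero_le_two
      rw [← ofReal_norm]
      exact ENNReal.ofReal_le_ofReal h4
    have hcheb := mul_meas_ge_le_lintegral₀ (μ := volume)
      ((measurable_bilinearAdjoint ψ.continuous hΓ hg he far).enorm.pow_const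
        (2 : ℝ)).aemeasurable (ENNReal.ofReal (l / 2) ^ (2 : ℝ))
    have hL2 := hC₁ Γ J hΓ hJ hCV g e hg he hg1 he0 far hfarm hfarfin
      (Set.inter_subset_left.trans (Set.prod_mono hAJ hAJ)) (fun z hz hzz => hz.2 (by
        change dist z.1 z.2 ≤ δ; rw [hzz, dist_self]; exact hδ0.le))
    -- Chebyshev's inequality uses up (l/2)² of the power, leaving 4 l^{ρ−3}.
    have hpow : ENNReal.ofReal (l ^ (ρ - 1))
        = ENNReal.ofReal (l / 2) ^ (2 : ℝ) * (4 * ENNReal.ofReal (l ^ ((ρ - 2) - 1))) := by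
      rw [ENNReal.ofReal_rpow_of_pos (by positivity), ← ENNReal.ofReal_ofNat,
        ← ENNReal.ofReal_mul (by norm_num), ← ENNReal.ofReal_mul (by positivity)]
      congr 1
      have : ρ - 1 = 2 + (ρ - 2 - 1) := by ring
      rw [this, Real.rpow_add hl0, Real.rpow_two, Real.rpow_two]
      ring
    calc _ ≤ volume {x | ENNReal.ofReal (l / 2) ^ (2 : ℝ)
        ≤ ‖bilinearAdjoint ψ Γ g e far x‖ₑ ^ (2 : ℝ)} * ENNReal.ofReal (l ^ (ρ - 1)) := by gcongr
      _ = (ENNReal.ofReal (l / 2) ^ (2 : ℝ) * volume {x | ENNReal.ofReal (l / 2) ^ (2 : ℝ)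
        ≤ ‖bilinearAdjoint ψ Γ g e far x‖ₑ ^ (2 : ℝ)}) *
          (4 * ENNReal.ofReal (l ^ ((ρ - 2) - 1))) := by rw [hpow]; ring
      _ ≤ (C₁ * ∫⁻ z in far, (edist z.1 z.2)⁻¹) * (4 * ENNReal.ofReal (l ^ ((ρ - 2) - 1))) := by
        exact mul_le_mul_left (hcheb.trans hL2) _
      _ = ∫⁻ z in far, 4 * C₁ * (edist z.1 z.2)⁻¹ * ENNReal.ofReal (l ^ ((ρ - 2) - 1)) := by
        rw [lintegral_mul_const' _ _ ENNReal.ofReal_ne_top, lintegral_const_mul' _ _ (by finiteness)]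
        ring
      _ = ∫⁻ z in far, 4 * C₁ * (edist z.1 z.2)⁻¹ *
        (if ENNReal.ofReal l < ENNReal.ofReal (4 * B ^ 2 * m) * edist z.1 z.2
          then ENNReal.ofReal (l ^ ((ρ - 2) - 1)) else 0) := by
        refine setLIntegral_congr_fun hfarm fun z hz => ?_
        have h1 : δ < dist z.1 z.2 := not_le.1 hz.2
        have h2 : ENNReal.ofReal l < ENNReal.ofReal (4 * B ^ 2 * m) * edist z.1 z.2 := by
          rw [edist_dist, ← ENNReal.ofReal_mul (by positivity),
            ENNReal.ofReal_lt_ofReal_iff_of_nonneg hl0.le]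
          rwa [hδ, div_lt_iff₀' (by positivity)] at h1
        simp only [h2, if_true]
      _ ≤ _ := lintegral_mono_set Set.inter_subset_left
  have hEsq : Measurable (fun x => ‖E x‖ₑ ^ (2 : ℝ)) := hEm.enorm.pow_const _
  have hmeas : Measurable (fun q : ℝ × (ℝ × ℝ) => 4 * (C₁ : ℝ≥0∞) * (edist q.2.1 q.2.2)⁻¹ *
        (if ENNReal.ofReal q.1 < ENNReal.ofReal (4 * B ^ 2 * m) * edist q.2.1 q.2.2
          then ENNReal.ofReal (q.1 ^ ((ρ - 2) - 1)) else 0)) := by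
    refine Measurable.mul (by fun_prop) (Measurable.ite (measurableSet_lt ?_ ?_) ?_ ?_) <;> fun_prop
  calc ∫⁻ x, ‖E x‖ₑ ^ (2 * ρ) = ∫⁻ x, (‖E x‖ₑ ^ (2 : ℝ)) ^ ρ := by simp_rw [ENNReal.rpow_mul]
    _ = ENNReal.ofReal ρ * ∫⁻ l in Set.Ioi (0 : ℝ),
        volume {x | ENNReal.ofReal l < ‖E x‖ₑ ^ (2 : ℝ)} * ENNReal.ofReal (l ^ (ρ - 1)) :=
        lintegral_rpow_eq_lintegral_measure_lt volume hEsq (by linarith)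
    _ ≤ ENNReal.ofReal ρ * ∫⁻ l in Set.Ioi (0 : ℝ), ∫⁻ z in A ×ˢ A,
        4 * C₁ * (edist z.1 z.2)⁻¹ *
        (if ENNReal.ofReal l < ENNReal.ofReal (4 * B ^ 2 * m) * edist z.1 z.2
          then ENNReal.ofReal (l ^ ((ρ - 2) - 1)) else 0) := by
        gcongr ENNReal.ofReal ρ * ?_
        exact setLIntegral_mono' measurableSet_Ioi hlevel
    -- Integrating in l first: a pair (s,t) counts only for l < 4B²m|s − t|, and l^{ρ−3} is
    -- integrable at 0 since ρ > 2. The gain |s − t|^{ρ−2} turns the singularity 1/|s − t| into the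
    -- integrable |s − t|^{ρ−3}.
    _ = ENNReal.ofReal ρ * ∫⁻ z in A ×ˢ A, 4 * C₁ * (edist z.1 z.2)⁻¹ *
        ((ENNReal.ofReal (4 * B ^ 2 * m) * edist z.1 z.2) ^ (ρ - 2) / ENNReal.ofReal (ρ - 2)) := by
        rw [lintegral_lintegral_swap hmeas.aemeasurable]
        congr 1
        refine lintegral_congr fun z => ?_
        rw [lintegral_const_mul, lintegral_indicator_lt_rpow _ hρ2']
        exact Measurable.ite (measurableSet_lt (by fun_prop) (by fun_prop)) (by fun_prop)
          (by fun_prop)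
    _ ≤ ENNReal.ofReal ρ * ∫⁻ z in A ×ˢ A, 4 * C₁ * (ENNReal.ofReal (4 * B ^ 2 * m) ^ (ρ - 2) /
        ENNReal.ofReal (ρ - 2)) * edist z.1 z.2 ^ ((ρ - 2) - 1) := by
        gcongr ENNReal.ofReal ρ * ?_
        refine lintegral_mono fun z => ?_
        have h1 : (edist z.1 z.2)⁻¹ * edist z.1 z.2 ^ (ρ - 2) ≤ edist z.1 z.2 ^ ((ρ - 2) - 1) := by
          rcases eq_or_ne (edist z.1 z.2) 0 with h | h
          · rw [h, ENNReal.zero_rpow_of_pos hρ2', mul_zero]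
            exact zero_le
          · rw [ENNReal.rpow_sub (ρ - 2) 1 h (edist_ne_top _ _), ENNReal.rpow_one, ENNReal.div_eq_inv_mul]
        rw [ENNReal.mul_rpow_of_nonneg _ _ hρ2'.le]
        calc _ = 4 * C₁ * (ENNReal.ofReal (4 * B ^ 2 * m) ^ (ρ - 2) / ENNReal.ofReal (ρ - 2)) *
              ((edist z.1 z.2)⁻¹ * edist z.1 z.2 ^ (ρ - 2)) := by
              simp only [div_eq_mul_inv]; ring
          _ ≤ _ := by gcongr
    _ ≤ ENNReal.ofReal ρ * (4 * C₁ * (ENNReal.ofReal (4 * B ^ 2 * m) ^ (ρ - 2) /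
        ENNReal.ofReal (ρ - 2)) * ((2 / ENNReal.ofReal (ρ - 2) + 1) *
          volume A ^ ((ρ - 2) + 1))) := by
        gcongr ENNReal.ofReal ρ * ?_
        have : ENNReal.ofReal (4 * B ^ 2 * m) ^ (ρ - 2) ≠ ∞ :=
          ENNReal.rpow_ne_top_of_nonneg hρ2'.le ENNReal.ofReal_ne_top
        rw [lintegral_const_mul' _ _ (by finiteness)]
        gcongr
        exact lintegral_prod_edist_rpow_le A hA0 hAfin hρ2' (by linarith)
    _ = K * volume A ^ (2 * ρ - 3) := by
        have hV : volume A ^ (2 * ρ - 3) = volume A ^ (ρ - 2) * volume A ^ (ρ - 2 + 1) := by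
          rw [← ENNReal.rpow_add _ _ hA0 hAfin]
          ring_nf
        rw [ENNReal.ofReal_mul (by positivity), ← hmE, ENNReal.mul_rpow_of_nonneg _ _ hρ2'.le,
          hV, hK]
        generalize volume A ^ (ρ - 2 + 1) = Y
        simp only [div_eq_mul_inv]
        ring

/-! ### Interpolation. -/

/-- Off-diagonal Marcinkiewicz interpolation between a strong type `(1, ∞)` and a weak type
`(p₁, q₁)` bound, for a function of unit `L^p` norm. -/
theorem exists_marcinkiewicz_bound {p p₁ q q₁ : ℝ} (hp : 1 < p) (hpp₁ : p < p₁) (hpq₁ : p₁ ≤ q₁)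
    (hq : 0 < q) (hrel : (q - q₁) * ((p - 1) * p₁) = q₁ * (p₁ - p)) (B C : ℝ≥0) (hB : 0 < B) :
    ∃ D : ℝ≥0, ∀ {α β : Type} [MeasurableSpace α] [MeasurableSpace β] (μ : Measure α)
      (ν : Measure β) [SFinite μ] [SFinite ν] (T : (β → ℂ) → α → ℝ≥0∞) (f : β → ℂ),
      Measurable f → Measurable (T f) → ∫⁻ x, ‖f x‖ₑ ^ p ∂ν = 1 →
      (∀ γ : ℝ≥0∞, ∀ t, T f t
        ≤ T ({x | ‖f x‖ₑ < γ}.indicator f) t + T ({x | γ ≤ ‖f x‖ₑ}.indicator f) t) →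
      (∀ γ : ℝ≥0∞, ∀ t, T ({x | γ ≤ ‖f x‖ₑ}.indicator f) t
        ≤ B * ∫⁻ x in {x | γ ≤ ‖f x‖ₑ}, ‖f x‖ₑ ∂ν) →
      (∀ γ : ℝ≥0∞, ∀ l : ℝ, 0 < l → ENNReal.ofReal l ^ q₁ *
        μ {t | ENNReal.ofReal l < T ({x | ‖f x‖ₑ < γ}.indicator f) t}
          ≤ C * (∫⁻ x in {x | ‖f x‖ₑ < γ}, ‖f x‖ₑ ^ p₁ ∂ν) ^ (q₁ / p₁)) →
      ∫⁻ t, T f t ^ q ∂μ ≤ D := by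
  have hp1 : 0 < p - 1 := by linarith
  have hp₁0 : 0 < p₁ := by linarith
  set θ : ℝ := (p₁ - p) * (q₁ / p₁ - 1) with hθ
  set σ : ℝ := (p₁ - p) / (p - 1) with hσ
  have hσ0 : 0 < σ := div_pos (by linarith) hp1
  have hθ0 : 0 ≤ q₁ / p₁ - 1 := by
    rw [sub_nonneg, le_div_iff₀ hp₁0]; linarith
  -- The relation `hrel` says that (1/p, 1/q) lies on the line through (1, 0) and (1/p₁, 1/q₁). This
  -- is what makes the powers of l, and later those of |f|, match.
  have hexp : q - q₁ - θ / (p - 1) = σ := by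
    rw [hθ, hσ]
    field_simp
    linarith
  set M : ℝ≥0∞ := ENNReal.ofReal q * (C * 2 ^ q₁ * ENNReal.ofReal ((2 * B) ^ (θ / (p - 1))) *
    (ENNReal.ofReal (2 * B) ^ σ / ENNReal.ofReal σ)) with hM
  have hMfin : M ≠ ∞ := by
    have h1 : ENNReal.ofReal (2 * B) ^ σ ≠ ∞ :=
      ENNReal.rpow_ne_top_of_nonneg hσ0.le ENNReal.ofReal_ne_top
    have h2 : ENNReal.ofReal σ ≠ 0 := by simpa using hσ0
    have h3 : (2 : ℝ≥0∞) ^ q₁ ≠ ∞ := ENNReal.rpow_ne_top_of_nonneg (by linarith) (by simp)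
    rw [hM]
    finiteness
  refine ⟨M.toNNReal, ?_⟩
  rw [ENNReal.coe_toNNReal hMfin]
  intro α β _ _ μ ν _ _ T f hf hTf hnorm hsub hstrong hweak
  have hBr : (0 : ℝ) < B := hB
  have hfe : Measurable (fun x => ‖f x‖ₑ) := hf.enorm
  have hlevel : ∀ l ∈ Set.Ioi (0 : ℝ),
      μ {t | ENNReal.ofReal l < T f t} * ENNReal.ofReal (l ^ (q - 1))
      ≤ ∫⁻ x, (C * 2 ^ q₁ * ENNReal.ofReal ((2 * B) ^ (θ / (p - 1)))) * ‖f x‖ₑ ^ p₁ *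
        (if ENNReal.ofReal l < ENNReal.ofReal (2 * B) * ‖f x‖ₑ ^ (-(p - 1))
          then ENNReal.ofReal (l ^ (σ - 1)) else 0) ∂ν := by
    intro l hl
    have hl0 : (0 : ℝ) < l := hl
    -- The cut-off height varies with the level: γ^{p−1} = 2B/l gives B ∫_{|f| ≥ γ} |f| ≤ B γ^{1−p}
    -- = l/2, so the large part of f never accounts for more than half of the level.
    set γ : ℝ := (2 * B / l) ^ (1 / (p - 1)) with hγ
    have hγ0 : 0 < γ := by positivity
    have hγp : γ ^ (p - 1) = 2 * B / l := by
      rw [hγ, ← Real.rpow_mul (by positivity), one_div_mul_cancel hp1.ne', Real.rpow_one]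
    set G := ENNReal.ofReal γ with hG
    have hG0 : G ≠ 0 := by simpa [hG] using hγ0
    have hGt : G ≠ ∞ := ENNReal.ofReal_ne_top
    have hhi_set : MeasurableSet {x | G ≤ ‖f x‖ₑ} := measurableSet_le measurable_const hfe
    have hlo_set : MeasurableSet {x | ‖f x‖ₑ < G} := measurableSet_lt hfe measurable_const
    have hhi : ∫⁻ x in {x | G ≤ ‖f x‖ₑ}, ‖f x‖ₑ ∂ν ≤ G ^ (-(p - 1)) := by
      calc _ ≤ ∫⁻ x in {x | G ≤ ‖f x‖ₑ}, G ^ (-(p - 1)) * ‖f x‖ₑ ^ p ∂ν := by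
            refine setLIntegral_mono' hhi_set fun x hx => ?_
            have hx' : G ≤ ‖f x‖ₑ := hx
            have h0 : ‖f x‖ₑ ≠ 0 := (lt_of_lt_of_le (pos_iff_ne_zero.2 hG0) hx').ne'
            have h1 : 1 ≤ G ^ (-(p - 1)) * ‖f x‖ₑ ^ (p - 1) := by
              rw [ENNReal.rpow_neg, ← ENNReal.div_eq_inv_mul, ENNReal.le_div_iff_mul_le
                (Or.inl (by simp [hG0, hGt])) (Or.inl (by simp [hG0, hGt])), one_mul]
              exact ENNReal.rpow_le_rpow hx' hp1.le
            calc ‖f x‖ₑ = 1 * ‖f x‖ₑ := (one_mul _).symm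
              _ ≤ (G ^ (-(p - 1)) * ‖f x‖ₑ ^ (p - 1)) * ‖f x‖ₑ := by gcongr
              _ = _ := by
                rw [mul_assoc]
                congr 1
                conv_lhs => enter [2]; rw [← ENNReal.rpow_one ‖f x‖ₑ]
                rw [← ENNReal.rpow_add _ _ h0 enorm_ne_top]
                ring_nf
        _ ≤ ∫⁻ x, G ^ (-(p - 1)) * ‖f x‖ₑ ^ p ∂ν :=
            lintegral_mono' Measure.restrict_le_self le_rfl
        _ = G ^ (-(p - 1)) := by
            rw [lintegral_const_mul _ (by fun_prop), hnorm, mul_one]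
    have hGneg : (B : ℝ≥0∞) * G ^ (-(p - 1)) = ENNReal.ofReal (l / 2) := by
      rw [hG, ENNReal.ofReal_rpow_of_pos hγ0, Real.rpow_neg hγ0.le, hγp,
        ← ENNReal.ofReal_coe_nnreal, ← ENNReal.ofReal_mul hBr.le]
      congr 1
      field_simp
    have hincl : {t | ENNReal.ofReal l < T f t} ⊆
        {t | ENNReal.ofReal (l / 2) < T ({x | ‖f x‖ₑ < G}.indicator f) t} := by
      intro t ht
      have h1 : ENNReal.ofReal l < T f t := ht
      have h2 : T f t ≤ T ({x | ‖f x‖ₑ < G}.indicator f) t + ENNReal.ofReal (l / 2) := by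
        refine (hsub G t).trans ?_
        gcongr
        refine (hstrong G t).trans ?_
        rw [← hGneg]
        gcongr
      have h3 : ENNReal.ofReal l = ENNReal.ofReal (l / 2) + ENNReal.ofReal (l / 2) := by
        rw [← ENNReal.ofReal_add (by positivity) (by positivity)]; ring_nf
      have h4 := h1.trans_le h2
      rw [h3] at h4
      exact lt_of_add_lt_add_right h4
    set L := ∫⁻ x in {x | ‖f x‖ₑ < G}, ‖f x‖ₑ ^ p₁ ∂ν with hL
    have hLle : L ≤ G ^ (p₁ - p) := by
      calc L ≤ ∫⁻ x in {x | ‖f x‖ₑ < G}, G ^ (p₁ - p) * ‖f x‖ₑ ^ p ∂ν := by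
            refine setLIntegral_mono' hlo_set fun x hx => ?_
            have hx' : ‖f x‖ₑ < G := hx
            have : ‖f x‖ₑ ^ p₁ = ‖f x‖ₑ ^ (p₁ - p) * ‖f x‖ₑ ^ p := by
              rw [← ENNReal.rpow_add_of_nonneg _ _ (by linarith) (by linarith)]
              ring_nf
            rw [this]
            gcongr
        _ ≤ ∫⁻ x, G ^ (p₁ - p) * ‖f x‖ₑ ^ p ∂ν :=
            lintegral_mono' Measure.restrict_le_self le_rfl
        _ = G ^ (p₁ - p) := by
            rw [lintegral_const_mul _ (by fun_prop), hnorm, mul_one]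
    -- Since q₁ ≥ p₁, all but one power of L can be replaced by its bound γ^{p₁−p}. The estimate
    -- becomes linear in L, and the order of integration in l and x can then be exchanged.
    have hLpow : L ^ (q₁ / p₁) ≤ G ^ θ * L := by
      calc L ^ (q₁ / p₁) = L ^ (q₁ / p₁ - 1) * L := by
            conv_rhs => enter [2]; rw [← ENNReal.rpow_one L]
            rw [← ENNReal.rpow_add_of_nonneg _ _ hθ0 zero_le_one]
            ring_nf
        _ ≤ (G ^ (p₁ - p)) ^ (q₁ / p₁ - 1) * L := by gcongr
        _ = G ^ θ * L := by rw [← ENNReal.rpow_mul]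
    have hsc : ENNReal.ofReal (l ^ (q - 1)) * G ^ θ = ENNReal.ofReal (l / 2) ^ q₁ *
        (2 ^ q₁ * ENNReal.ofReal ((2 * B) ^ (θ / (p - 1))) * ENNReal.ofReal (l ^ (σ - 1))) := by
      have h2 : (2 : ℝ≥0∞) ^ q₁ = ENNReal.ofReal (2 ^ q₁) := by
        rw [← ENNReal.ofReal_rpow_of_pos two_pos, ENNReal.ofReal_ofNat]
      rw [hG, ENNReal.ofReal_rpow_of_pos hγ0, ENNReal.ofReal_rpow_of_pos (by positivity), h2,
        ← ENNReal.ofReal_mul (by positivity), ← ENNReal.ofReal_mul (by positivity),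
        ← ENNReal.ofReal_mul (by positivity), ← ENNReal.ofReal_mul (by positivity)]
      congr 1
      have h3 : γ ^ θ = (2 * B) ^ (θ / (p - 1)) * l ^ (-(θ / (p - 1))) := by
        rw [hγ, ← Real.rpow_mul (by positivity), div_eq_mul_inv (2 * (B : ℝ)) l,
          Real.mul_rpow (by positivity) (by positivity), Real.inv_rpow hl0.le,
          ← Real.rpow_neg hl0.le]
        ring_nf
      have h4 : (l / 2) ^ q₁ * 2 ^ q₁ = l ^ q₁ := by
        rw [← Real.mul_rpow (by positivity) (by positivity)]
        ring_nf
      have h5 : l ^ (q - 1) * l ^ (-(θ / (p - 1))) = l ^ q₁ * l ^ (σ - 1) := by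
        rw [← Real.rpow_add hl0, ← Real.rpow_add hl0]
        congr 1
        linarith
      rw [h3]
      calc _ = (2 * (B : ℝ)) ^ (θ / (p - 1)) * (l ^ (q - 1) * l ^ (-(θ / (p - 1)))) := by ring
        _ = ((l / 2) ^ q₁ * 2 ^ q₁) * ((2 * (B : ℝ)) ^ (θ / (p - 1)) * l ^ (σ - 1)) := by
            rw [h5, h4]; ring
        _ = _ := by ring
    have hw := hweak G (l / 2) (by positivity)
    set X := ENNReal.ofReal (l / 2) ^ q₁ with hX
    have hX0 : X ≠ 0 := by
      rw [hX, ENNReal.ofReal_rpow_of_pos (by positivity)]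
      simp only [ne_eq, ENNReal.ofReal_eq_zero, not_le]
      positivity
    have hXt : X ≠ ∞ := ENNReal.rpow_ne_top_of_nonneg (by linarith) ENNReal.ofReal_ne_top
    set m := μ {t | ENNReal.ofReal (l / 2) < T ({x | ‖f x‖ₑ < G}.indicator f) t} with hm
    have hkey : m * ENNReal.ofReal (l ^ (q - 1))
        ≤ (C * 2 ^ q₁ * ENNReal.ofReal ((2 * B) ^ (θ / (p - 1)))) * L *
          ENNReal.ofReal (l ^ (σ - 1)) := by
      rw [← ENNReal.mul_le_mul_iff_right hX0 hXt]
      calc X * (m * ENNReal.ofReal (l ^ (q - 1)))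
          = (X * m) * ENNReal.ofReal (l ^ (q - 1)) := by ring
        _ ≤ (C * (G ^ θ * L)) * ENNReal.ofReal (l ^ (q - 1)) := by
            refine mul_le_mul_left (hw.trans ?_) _
            exact mul_le_mul_right hLpow _
        _ = C * L * (ENNReal.ofReal (l ^ (q - 1)) * G ^ θ) := by ring
        _ = _ := by rw [hsc]; ring
    calc μ {t | ENNReal.ofReal l < T f t} * ENNReal.ofReal (l ^ (q - 1))
        ≤ m * ENNReal.ofReal (l ^ (q - 1)) := mul_le_mul_left (measure_mono hincl) _
      _ ≤ _ := hkey
      _ = ∫⁻ x in {x | ‖f x‖ₑ < G}, (C * 2 ^ q₁ * ENNReal.ofReal ((2 * B) ^ (θ / (p - 1))))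
          * ‖f x‖ₑ ^ p₁ * ENNReal.ofReal (l ^ (σ - 1)) ∂ν := by
          rw [lintegral_mul_const _ (by fun_prop), lintegral_const_mul _ (by fun_prop)]
      _ = ∫⁻ x in {x | ‖f x‖ₑ < G}, (C * 2 ^ q₁ * ENNReal.ofReal ((2 * B) ^ (θ / (p - 1))))
          * ‖f x‖ₑ ^ p₁ * (if ENNReal.ofReal l < ENNReal.ofReal (2 * B) * ‖f x‖ₑ ^ (-(p - 1))
          then ENNReal.ofReal (l ^ (σ - 1)) else 0) ∂ν := by
          refine setLIntegral_congr_fun hlo_set fun x hx => ?_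
          have hx' : ‖f x‖ₑ < G := hx
          have : ENNReal.ofReal l < ENNReal.ofReal (2 * B) * ‖f x‖ₑ ^ (-(p - 1)) := by
            have h2B : ENNReal.ofReal (2 * B) ≠ 0 := by
              simp only [ne_eq, ENNReal.ofReal_eq_zero, not_le]; positivity
            have h1 : G ^ (-(p - 1)) < ‖f x‖ₑ ^ (-(p - 1)) := by
              rw [ENNReal.rpow_neg, ENNReal.rpow_neg]
              exact ENNReal.inv_lt_inv.2 (ENNReal.rpow_lt_rpow hx' hp1)
            have h2 : ENNReal.ofReal l = ENNReal.ofReal (2 * B) * G ^ (-(p - 1)) := by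
              rw [ENNReal.ofReal_mul zero_le_two, ENNReal.ofReal_coe_nnreal, mul_assoc, hGneg,
                ← ENNReal.ofReal_mul zero_le_two]
              ring_nf
            rw [h2]
            exact (ENNReal.mul_lt_mul_iff_right h2B ENNReal.ofReal_ne_top).2 h1
          simp only [this, if_true]
      _ ≤ _ := lintegral_mono' Measure.restrict_le_self le_rfl
  have hmeas : Measurable (fun z : ℝ × β =>
      (C * 2 ^ q₁ * ENNReal.ofReal ((2 * B) ^ (θ / (p - 1)))) * ‖f z.2‖ₑ ^ p₁ *
        (if ENNReal.ofReal z.1 < ENNReal.ofReal (2 * B) * ‖f z.2‖ₑ ^ (-(p - 1))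
          then ENNReal.ofReal (z.1 ^ (σ - 1)) else 0)) := by
    refine Measurable.mul (by fun_prop) (Measurable.ite (measurableSet_lt ?_ ?_) ?_ ?_) <;> fun_prop
  rw [lintegral_rpow_eq_lintegral_measure_lt μ hTf hq, hM]
  refine mul_le_mul_right ?_ _
  refine (setLIntegral_mono' measurableSet_Ioi hlevel).trans ?_
  rw [lintegral_lintegral_swap hmeas.aemeasurable]
  have hinner : ∀ x, ∫⁻ l in Set.Ioi (0 : ℝ),
      (C * 2 ^ q₁ * ENNReal.ofReal ((2 * B) ^ (θ / (p - 1)))) * ‖f x‖ₑ ^ p₁ *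
        (if ENNReal.ofReal l < ENNReal.ofReal (2 * B) * ‖f x‖ₑ ^ (-(p - 1))
          then ENNReal.ofReal (l ^ (σ - 1)) else 0)
      ≤ (C * 2 ^ q₁ * ENNReal.ofReal ((2 * B) ^ (θ / (p - 1))) *
        (ENNReal.ofReal (2 * B) ^ σ / ENNReal.ofReal σ)) * ‖f x‖ₑ ^ p := by
    intro x
    rw [lintegral_const_mul _ (Measurable.ite (measurableSet_lt (by fun_prop) (by fun_prop))
      (by fun_prop) (by fun_prop)), lintegral_indicator_lt_rpow _ hσ0,
      ENNReal.mul_rpow_of_nonneg _ _ hσ0.le, ← ENNReal.rpow_mul]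
    -- As (p − 1)σ = p₁ − p, exactly |f|^p remains, whose integral is 1. Where f vanishes only the
    -- inequality holds.
    have h1 : ‖f x‖ₑ ^ p₁ * ‖f x‖ₑ ^ (-(p - 1) * σ) ≤ ‖f x‖ₑ ^ p := by
      rcases eq_or_ne ‖f x‖ₑ 0 with h | h
      · rw [h, ENNReal.zero_rpow_of_pos hp₁0, zero_mul]
        exact zero_le
      · rw [← ENNReal.rpow_add _ _ h enorm_ne_top]
        refine le_of_eq ?_
        congr 1
        rw [hσ]
        field_simp
        ring
    calc _ = (C * 2 ^ q₁ * ENNReal.ofReal ((2 * B) ^ (θ / (p - 1))) *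
        (ENNReal.ofReal (2 * B) ^ σ / ENNReal.ofReal σ)) *
          (‖f x‖ₑ ^ p₁ * ‖f x‖ₑ ^ (-(p - 1) * σ)) := by
          simp only [div_eq_mul_inv]; ring
      _ ≤ _ := by gcongr
  refine (lintegral_mono hinner).trans_eq ?_
  rw [lintegral_const_mul _ (by fun_prop), hnorm, mul_one]

/-! ### The maximal restriction operator on an arc. -/

/-- The regularized Fourier transform `f̂ * χ_ε`, written as the Fourier transform of the product
of `f` with a dilate of `𝓕⁻ χ`. -/
noncomputable def regularizedFourier (χ : 𝓢(Plane, ℂ)) (ε : ℝ) (f : Plane → ℂ) (ξ : Plane) : ℂ :=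
  𝓕 (fun x => (𝓕⁻ χ) (ε • x) * f x) ξ

/-- The maximal function `sup_n |f̂ * χ_{ε n}|`. -/
noncomputable def fourierMaximal (χ : 𝓢(Plane, ℂ)) (ε : ℕ → ℝ) (f : Plane → ℂ) (ξ : Plane) :
    ℝ≥0∞ :=
  ⨆ n, ‖regularizedFourier χ (ε n) f ξ‖ₑ

theorem regularizedFourier_eq_integral (χ : 𝓢(Plane, ℂ)) (ε : ℝ) (f : Plane → ℂ) (ξ : Plane) :
    regularizedFourier χ ε f ξ
      = ∫ x, (Real.fourierChar (-inner ℝ x ξ) : ℂ) * ((𝓕⁻ χ) (ε • x) * f x) := by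
  rw [regularizedFourier, Real.fourier_eq]
  rfl

theorem continuous_regularizedFourier (χ : 𝓢(Plane, ℂ)) (ε : ℝ) {f : Plane → ℂ}
    (hf : Integrable (fun x => (𝓕⁻ χ) (ε • x) * f x)) : Continuous (regularizedFourier χ ε f) :=
  continuous_fourier_of_integrable hf

theorem measurable_fourierMaximal (χ : 𝓢(Plane, ℂ)) (ε : ℕ → ℝ) {f : Plane → ℂ}
    (hf : ∀ n, Integrable (fun x => (𝓕⁻ χ) (ε n • x) * f x)) :
    Measurable (fourierMaximal χ ε f) :=
  Measurable.iSup fun n => (continuous_regularizedFourier χ (ε n) (hf n)).measurable.enorm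

theorem regularizedFourier_add (χ : 𝓢(Plane, ℂ)) (ε : ℝ) {f g : Plane → ℂ}
    (hf : Integrable (fun x => (𝓕⁻ χ) (ε • x) * f x))
    (hg : Integrable (fun x => (𝓕⁻ χ) (ε • x) * g x)) (ξ : Plane) :
    regularizedFourier χ ε (f + g) ξ = regularizedFourier χ ε f ξ + regularizedFourier χ ε g ξ := by
  have h := VectorFourier.fourierIntegral_add (L := innerₗ Plane) Real.continuous_fourierChar
    continuous_inner hf hg
  have h2 : (fun x => (𝓕⁻ χ) (ε • x) * (f + g) x)
      = (fun x => (𝓕⁻ χ) (ε • x) * f x) + (fun x => (𝓕⁻ χ) (ε • x) * g x) := by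
    ext x; simp [mul_add]
  rw [regularizedFourier, h2]
  exact congrFun h ξ

theorem regularizedFourier_smul (χ : 𝓢(Plane, ℂ)) (ε : ℝ) (c : ℂ) (f : Plane → ℂ) (ξ : Plane) :
    regularizedFourier χ ε (c • f) ξ = c * regularizedFourier χ ε f ξ := by
  simp only [regularizedFourier_eq_integral, ← integral_const_mul, Pi.smul_apply, smul_eq_mul]
  congr 1
  ext x
  ring

theorem regularizedFourier_congr_ae (χ : 𝓢(Plane, ℂ)) (ε : ℝ) {f g : Plane → ℂ}
    (h : f =ᵐ[volume] g) (ξ : Plane) :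
    regularizedFourier χ ε f ξ = regularizedFourier χ ε g ξ :=
  Real.fourier_congr_ae (h.mono fun x hx => by simp only [hx]) ξ

theorem fourierMaximal_add_le (χ : 𝓢(Plane, ℂ)) (ε : ℕ → ℝ) {f g : Plane → ℂ}
    (hf : ∀ n, Integrable (fun x => (𝓕⁻ χ) (ε n • x) * f x))
    (hg : ∀ n, Integrable (fun x => (𝓕⁻ χ) (ε n • x) * g x)) (ξ : Plane) :
    fourierMaximal χ ε (f + g) ξ ≤ fourierMaximal χ ε f ξ + fourierMaximal χ ε g ξ := by
  refine iSup_le fun n => ?_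
  rw [regularizedFourier_add χ (ε n) (hf n) (hg n)]
  exact (enorm_add_le _ _).trans (add_le_add (le_iSup (fun n => ‖regularizedFourier χ (ε n) f ξ‖ₑ) n)
    (le_iSup (fun n => ‖regularizedFourier χ (ε n) g ξ‖ₑ) n))

theorem fourierMaximal_smul (χ : 𝓢(Plane, ℂ)) (ε : ℕ → ℝ) (c : ℂ) (f : Plane → ℂ) (ξ : Plane) :
    fourierMaximal χ ε (c • f) ξ = ‖c‖ₑ * fourierMaximal χ ε f ξ := by
  simp only [fourierMaximal, regularizedFourier_smul, enorm_mul, ENNReal.mul_iSup]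

/-- Boundedness of 𝓕⁻ χ gives the end point from L¹ to L^∞, uniformly in the scale and at every
point of the plane, whatever the curve. -/
theorem enorm_regularizedFourier_le (χ : 𝓢(Plane, ℂ)) {B : ℝ≥0}
    (hB : ∀ x, ‖(𝓕⁻ χ) x‖ ≤ B) (ε : ℝ) (f : Plane → ℂ) (ξ : Plane) :
    ‖regularizedFourier χ ε f ξ‖ₑ ≤ B * ∫⁻ x, ‖f x‖ₑ := by
  rw [regularizedFourier_eq_integral]
  refine (enorm_integral_le_lintegral_enorm _).trans ?_
  rw [← lintegral_const_mul' _ _ ENNReal.coe_ne_top]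
  refine lintegral_mono fun x => ?_
  rw [enorm_mul, enorm_mul]
  have h1 : ‖(Real.fourierChar (-inner ℝ x ξ) : ℂ)‖ₑ = 1 := by
    rw [← ofReal_norm, Circle.norm_coe, ENNReal.ofReal_one]
  rw [h1, one_mul]
  gcongr
  rw [← ofReal_norm, ← ENNReal.ofReal_coe_nnreal]
  exact ENNReal.ofReal_le_ofReal (hB _)

theorem fourierMaximal_le (χ : 𝓢(Plane, ℂ)) {B : ℝ≥0}
    (hB : ∀ x, ‖(𝓕⁻ χ) x‖ ≤ B) (ε : ℕ → ℝ) (f : Plane → ℂ) (ξ : Plane) :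
    fourierMaximal χ ε f ξ ≤ B * ∫⁻ x, ‖f x‖ₑ :=
  iSup_le fun _ => enorm_regularizedFourier_le χ hB _ _ _

/-- Weak type estimate for the maximal restriction operator. -/
theorem exists_weakType_fourierMaximal (χ : 𝓢(Plane, ℂ)) (C₀ : ℝ≥0) {ρ : ℝ} (hρ2 : 2 < ρ)
    (hρ3 : ρ < 3) :
    ∃ C : ℝ≥0, ∀ (Γ : ℝ → Plane) (J : Set ℝ), Measurable Γ → MeasurableSet J → volume J ≠ ∞ →
      SumMapBound Γ J C₀ → ∀ ε : ℕ → ℝ, (∀ n, 0 < ε n) → ∀ f : Plane → ℂ, Integrable f →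
      ∀ l : ℝ, 0 < l → ENNReal.ofReal l ^ (2 * ρ / 3) *
        volume.restrict J {t | ENNReal.ofReal l < fourierMaximal χ ε f (Γ t)}
        ≤ C * (∫⁻ x, ‖f x‖ₑ ^ (2 * ρ / (2 * ρ - 1))) ^ ((2 * ρ / 3) / (2 * ρ / (2 * ρ - 1))) := by
  classical
  obtain ⟨C₁, hC₁⟩ := exists_lintegral_linearAdjoint_rpow_le χ C₀ hρ2 hρ3
  refine ⟨C₁ ^ ((1 : ℝ) / 3), ?_⟩
  intro Γ J hΓ hJ hJfin hCV ε hε f hf l hl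
  set ψ : 𝓢(Plane, ℂ) := 𝓕⁻ χ with hψ
  obtain ⟨B, hBpos, hB⟩ := ψ.exists_norm_le
  obtain ⟨Z, hZ⟩ : ∃ Z : ℕ → ℝ → ℂ, ∀ n t, Z n t = regularizedFourier χ (ε n) f (Γ t) :=
    ⟨_, fun _ _ => rfl⟩
  have hZm : ∀ n, Measurable (Z n) := fun n => by
    rw [show Z n = fun t => regularizedFourier χ (ε n) f (Γ t) from funext (hZ n)]
    exact (continuous_regularizedFourier χ (ε n)
      (integrable_dilate_mul _ hf _)).measurable.comp hΓ
  have hUm : Measurable fun t => fourierMaximal χ ε f (Γ t) :=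
    (measurable_fourierMaximal χ ε fun n => integrable_dilate_mul _ hf _).comp hΓ
  set U : Set ℝ := {t | ENNReal.ofReal l < fourierMaximal χ ε f (Γ t)} with hU
  have hUset : MeasurableSet U := measurableSet_lt measurable_const hUm
  set A : Set ℝ := U ∩ J with hA
  have hAset : MeasurableSet A := hUset.inter hJ
  rw [Measure.restrict_apply hUset]
  have hAfin : volume A ≠ ∞ := ((measure_mono Set.inter_subset_right).trans_lt hJfin.lt_top).ne
  -- The alternative t ∉ U makes an index exist for every t, so the least index is a measurable
  -- selection on the whole line; on A it picks a scale at which the average exceeds l.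
  let P : ℝ → ℕ → Prop := fun t n => l < ‖Z n t‖ ∨ t ∉ U
  have hP : ∀ t, ∃ n, P t n := by
    intro t
    by_cases ht : t ∈ U
    · obtain ⟨n, hn⟩ := lt_iSup_iff.1
        (show ENNReal.ofReal l < ⨆ n, ‖regularizedFourier χ (ε n) f (Γ t)‖ₑ from ht)
      rw [← hZ] at hn
      refine ⟨n, Or.inl ?_⟩
      rw [← ofReal_norm] at hn
      exact (ENNReal.ofReal_lt_ofReal_iff_of_nonneg hl.le).1 hn
    · exact ⟨0, Or.inr ht⟩
  have hPm : ∀ n, MeasurableSet {t | P t n} := fun n =>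
    (measurableSet_lt measurable_const (hZm n).norm).union hUset.compl
  obtain ⟨ν, hνm, hνA⟩ : ∃ ν : ℝ → ℕ, Measurable ν ∧ ∀ t ∈ A, l < ‖Z (ν t) t‖ :=
    ⟨fun t => Nat.find (hP t), measurable_find hP hPm, fun t ht =>
      (Nat.find_spec (hP t)).resolve_right (fun h => h ht.1)⟩
  set e : ℝ → ℝ := fun t => ε (ν t) with he
  have hem : Measurable e := (measurable_from_top (f := ε)).comp hνm
  set z : ℝ → ℂ := fun t => Z (ν t) t with hz
  have hzm : Measurable z := by
    have h1 : Measurable (fun q : ℕ × ℝ => Z q.1 q.2) := measurable_from_prod_countable_right hZm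
    exact h1.comp (hνm.prodMk measurable_id)
  -- The phase that turns z into |z|, with value 0 where z vanishes.
  set g : ℝ → ℂ := fun t => starRingEnd ℂ (z t) / ‖z t‖ with hg
  have hgm : Measurable g :=
    (RCLike.continuous_conj.measurable.comp hzm).div (Complex.measurable_ofReal.comp hzm.norm)
  have hg1 : ∀ t, ‖g t‖ ≤ 1 := fun t => by
    rw [hg]
    simp only [norm_div, RCLike.norm_conj, Complex.norm_real, norm_norm]
    exact div_self_le_one _
  have hgz : ∀ t, g t * z t = (‖z t‖ : ℂ) := fun t => by
    simp only [hg]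
    rcases eq_or_ne (z t) 0 with h | h
    · simp [h]
    · have hne : (‖z t‖ : ℂ) ≠ 0 := by simpa using h
      rw [div_mul_eq_mul_div, RCLike.conj_mul, sq]
      exact mul_div_cancel_right₀ _ hne
  have hAf : IsFiniteMeasure (volume.restrict A) :=
    ⟨by rw [Measure.restrict_apply_univ]; exact hAfin.lt_top⟩
  have hfub : ∫ t in A, g t * z t = ∫ x, f x * linearAdjoint ψ Γ g e A x := by
    have hint : Integrable (Function.uncurry fun (t : ℝ) (x : Plane) =>
        f x * adjointKernel ψ Γ g e t x) ((volume.restrict A).prod volume) := by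
      have h1 : Integrable (fun q : ℝ × Plane => f q.2)
          ((volume.restrict A).prod volume) := hf.comp_snd _
      exact h1.mul_bdd (c := B)
        (measurable_adjointKernel ψ.continuous hΓ hgm hem).aestronglyMeasurable
        (ae_of_all _ fun q => norm_adjointKernel_le hB hg1 _ _)
    calc ∫ t in A, g t * z t = ∫ t in A, ∫ x, f x * adjointKernel ψ Γ g e t x := by
          refine integral_congr_ae (ae_of_all _ fun t => ?_)
          simp only [hz, hZ, regularizedFourier_eq_integral, ← integral_const_mul, adjointKernel]
          refine integral_congr_ae (ae_of_all _ fun x => ?_)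
          simp only [he, ← hψ]
          ring
      _ = ∫ x, ∫ t in A, f x * adjointKernel ψ Γ g e t x := integral_integral_swap hint
      _ = _ := by simp only [linearAdjoint, integral_const_mul]
  have hzint : IntegrableOn (fun t => ‖z t‖) A := by
    refine Integrable.of_bound hzm.norm.aestronglyMeasurable (∫ x, B * ‖f x‖)
      (ae_of_all _ fun t => ?_)
    rw [norm_norm]
    simp only [hz, hZ, regularizedFourier]
    refine (norm_fourier_le _).trans (integral_mono_of_nonneg (ae_of_all _ fun _ => norm_nonneg _)
      (hf.norm.const_mul B) (ae_of_all _ fun x => ?_))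
    simp only [norm_mul]
    exact mul_le_mul_of_nonneg_right (hB _) (norm_nonneg _)
  have hleft : ENNReal.ofReal l * volume A ≤ ‖∫ t in A, g t * z t‖ₑ := by
    simp_rw [hgz]
    rw [integral_complex_ofReal, ← ofReal_norm, Complex.norm_real,
      Real.norm_of_nonneg (integral_nonneg fun _ => norm_nonneg _),
      ofReal_integral_eq_lintegral_ofReal hzint (ae_of_all _ fun _ => norm_nonneg _),
      ← setLIntegral_const]
    exact setLIntegral_mono' hAset fun t ht => ENNReal.ofReal_le_ofReal (hνA t ht).le
  have h2ρ : (0 : ℝ) < 2 * ρ - 1 := by linarith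
  set p₁ : ℝ := 2 * ρ / (2 * ρ - 1) with hp₁
  have hconj : p₁.HolderConjugate (2 * ρ) := by
    rw [Real.holderConjugate_iff]
    refine ⟨by rw [hp₁, lt_div_iff₀ h2ρ]; linarith, ?_⟩
    rw [hp₁]
    field_simp
    ring
  set Fp := ∫⁻ x, ‖f x‖ₑ ^ p₁ with hFp
  have hholder : ENNReal.ofReal l * volume A
      ≤ Fp ^ (1 / p₁) * (C₁ * volume A ^ (2 * ρ - 3)) ^ (1 / (2 * ρ)) := by
    refine hleft.trans ?_
    rw [hfub]
    refine (enorm_integral_le_lintegral_enorm _).trans ?_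
    simp_rw [enorm_mul]
    refine (ENNReal.lintegral_mul_le_Lp_mul_Lq volume hconj
      hf.1.enorm (measurable_linearAdjoint ψ.continuous hΓ hgm hem
        A).enorm.aemeasurable).trans ?_
    gcongr
    exact hC₁ Γ J hΓ hJ hCV g e hgm hem hg1 (fun t => hε _) A hAset hAfin Set.inter_subset_right
  rcases eq_or_ne (volume A) 0 with hA0 | hA0
  · rw [hA0, mul_zero]; exact zero_le
  set V := volume A with hV
  have hρ0 : 0 < 2 * ρ := by linarith
  have hq0 : 0 ≤ 2 * ρ / 3 := by linarith
  -- Hölder leaves the power (2ρ − 3)/(2ρ) of V on the right. It may be cancelled because V is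
  -- positive and finite.
  have hstep : ENNReal.ofReal l * V ^ (3 / (2 * ρ)) ≤ Fp ^ (1 / p₁) * (C₁ : ℝ≥0∞) ^ (1 / (2 * ρ)) := by
    have hW0 : V ^ ((2 * ρ - 3) / (2 * ρ)) ≠ 0 := by simp [hA0, hAfin]
    have hWt : V ^ ((2 * ρ - 3) / (2 * ρ)) ≠ ∞ := by simp [hA0, hAfin]
    rw [← ENNReal.mul_le_mul_iff_left hW0 hWt]
    calc _ = ENNReal.ofReal l * V := by
          rw [mul_assoc, ← ENNReal.rpow_add _ _ hA0 hAfin]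
          congr 1
          have : 3 / (2 * ρ) + (2 * ρ - 3) / (2 * ρ) = 1 := by field_simp; ring
          rw [this, ENNReal.rpow_one]
      _ ≤ _ := hholder
      _ = _ := by
          rw [ENNReal.mul_rpow_of_nonneg _ _ (by positivity), ← ENNReal.rpow_mul, mul_assoc,
            mul_one_div]
  calc ENNReal.ofReal l ^ (2 * ρ / 3) * V
      = (ENNReal.ofReal l * V ^ (3 / (2 * ρ))) ^ (2 * ρ / 3) := by
        rw [ENNReal.mul_rpow_of_nonneg _ _ hq0, ← ENNReal.rpow_mul]
        congr 1
        have : 3 / (2 * ρ) * (2 * ρ / 3) = 1 := by field_simp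
        rw [this, ENNReal.rpow_one]
    _ ≤ (Fp ^ (1 / p₁) * (C₁ : ℝ≥0∞) ^ (1 / (2 * ρ))) ^ (2 * ρ / 3) := by gcongr
    _ = _ := by
        rw [ENNReal.mul_rpow_of_nonneg _ _ hq0, ← ENNReal.rpow_mul, ← ENNReal.rpow_mul,
          ENNReal.coe_rpow_of_nonneg _ (by norm_num), mul_comm]
        congr 2
        · field_simp
        · field_simp

theorem fourierMaximal_congr_ae (χ : 𝓢(Plane, ℂ)) (ε : ℕ → ℝ) {f g : Plane → ℂ}
    (h : f =ᵐ[volume] g) (ξ : Plane) : fourierMaximal χ ε f ξ = fourierMaximal χ ε g ξ := by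
  simp only [fourierMaximal, regularizedFourier_congr_ae χ _ h]

theorem SchwartzMap.exists_nnreal_norm_le (χ : 𝓢(Plane, ℂ)) :
    ∃ B : ℝ≥0, 0 < B ∧ ∀ x, ‖χ x‖ ≤ B := by
  obtain ⟨B, hB, h⟩ := χ.exists_norm_le
  exact ⟨⟨B, hB.le⟩, hB, h⟩

/-- The maximal restriction theorem on an arc, for integrable functions. -/
theorem exists_strongType_fourierMaximal_of_integrable (χ : 𝓢(Plane, ℂ)) (C₀ : ℝ≥0) {p : ℝ}
    (hp : 1 < p) (hp' : p < 4 / 3) :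
    ∃ C : ℝ≥0, ∀ (Γ : ℝ → Plane) (J : Set ℝ), Measurable Γ → MeasurableSet J → volume J ≠ ∞ →
      SumMapBound Γ J C₀ → ∀ ε : ℕ → ℝ, (∀ n, 0 < ε n) → ∀ f : Plane → ℂ, Integrable f →
      ∫⁻ x, ‖f x‖ₑ ^ p ≠ ∞ →
      ∫⁻ t in J, fourierMaximal χ ε f (Γ t) ^ (p / (3 * (p - 1)))
        ≤ C * (∫⁻ x, ‖f x‖ₑ ^ p) ^ ((p / (3 * (p - 1))) / p) := by
  have hp1 : 0 < p - 1 := by linarith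
  -- Since p < 4/3 means p' > 4, there is r = 2ρ with 4 < r < min(p', 6). Its conjugate exponent
  -- exceeds p, so p lies strictly between 1 and the exponent of the weak type bound.
  obtain ⟨r, hr2, hr⟩ := exists_between (show (4 : ℝ) < min (p / (p - 1)) 6 by
    rw [lt_min_iff, lt_div_iff₀ hp1]
    constructor <;> linarith)
  obtain ⟨hrp, hr6⟩ := lt_min_iff.1 hr
  rw [lt_div_iff₀ hp1] at hrp
  set ρ : ℝ := r / 2 with hρdef
  have hρ2 : 2 < ρ := by rw [hρdef]; linarith
  have hρ3 : ρ < 3 := by rw [hρdef]; linarith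
  have hρp : 2 * ρ * (p - 1) < p := by rw [hρdef]; linarith
  have h2ρ : 0 < 2 * ρ - 1 := by linarith
  set q : ℝ := p / (3 * (p - 1)) with hq
  have hq0 : 0 < q := by positivity
  obtain ⟨C₁, hC₁⟩ := exists_weakType_fourierMaximal χ C₀ hρ2 hρ3
  obtain ⟨B, hBpos, hB⟩ := (𝓕⁻ χ : 𝓢(Plane, ℂ)).exists_nnreal_norm_le
  obtain ⟨D, hD⟩ := exists_marcinkiewicz_bound (p := p) (p₁ := 2 * ρ / (2 * ρ - 1)) (q := q)
    (q₁ := 2 * ρ / 3) hp (by rw [lt_div_iff₀ h2ρ]; linarith)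
    (by rw [div_le_div_iff₀ h2ρ (by norm_num)]; nlinarith) hq0
    (by rw [hq]; field_simp; ring) B C₁ hBpos
  refine ⟨D, ?_⟩
  intro Γ J hΓ hJ hJfin hCV ε hε f₀ hf₀ hfin₀
  obtain ⟨f, hfm, hff⟩ := hf₀.1
  have hcongr : ∫⁻ x, ‖f₀ x‖ₑ ^ p = ∫⁻ x, ‖f x‖ₑ ^ p :=
    lintegral_congr_ae (hff.mono fun x hx => by simp only [hx])
  rw [hcongr] at hfin₀ ⊢
  simp_rw [fourierMaximal_congr_ae χ ε hff]
  have hf : Integrable f := hf₀.congr hff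
  replace hfm : Measurable f := hfm.measurable
  set n := ∫⁻ x, ‖f x‖ₑ ^ p with hn
  rcases eq_or_ne n 0 with hn0 | hn0
  · have h0 : f =ᵐ[volume] (0 : Plane → ℂ) := by
      have := (lintegral_eq_zero_iff (by fun_prop)).1 hn0
      filter_upwards [this] with x hx
      have hx' : ‖f x‖ₑ ^ p = 0 := hx
      simpa [ENNReal.rpow_eq_zero_iff, (by linarith : ¬ p < 0), (by linarith : 0 < p)] using hx'
    have hT : ∀ ξ, fourierMaximal χ ε f ξ = 0 := fun ξ => by
      rw [fourierMaximal_congr_ae χ ε h0, ← zero_smul ℂ (0 : Plane → ℂ), fourierMaximal_smul]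
      simp
    simp [hT, ENNReal.zero_rpow_of_pos hq0]
  -- Interpolation is stated for unit norm; homogeneity of the maximal operator restores the general
  -- case.
  set c : ℝ := n.toReal ^ (-(1 / p)) with hc
  have hnr : 0 < n.toReal := ENNReal.toReal_pos hn0 hfin₀
  have hc0 : 0 < c := Real.rpow_pos_of_pos hnr _
  have hce : ‖(c : ℂ)‖ₑ = n ^ (-(1 / p)) := by
    rw [← ofReal_norm, Complex.norm_real, Real.norm_of_nonneg hc0.le, hc,
      ← ENNReal.ofReal_rpow_of_pos hnr, ENNReal.ofReal_toReal hfin₀]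
  set f₁ : Plane → ℂ := (c : ℂ) • f with hf₁
  have hf₁m : Measurable f₁ := hfm.const_smul (c : ℂ)
  have hf₁i : Integrable f₁ := hf.smul (c : ℂ)
  have hnorm : ∫⁻ x, ‖f₁ x‖ₑ ^ p = 1 := by
    simp only [hf₁, Pi.smul_apply, enorm_smul]
    simp_rw [ENNReal.mul_rpow_of_nonneg _ _ (by linarith : (0 : ℝ) ≤ p)]
    rw [lintegral_const_mul _ (by fun_prop), hce, ← ENNReal.rpow_mul, ← hn,
      show -(1 / p) * p = -1 by field_simp, ENNReal.rpow_neg_one, ENNReal.inv_mul_cancel hn0 hfin₀]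
  have hmain := hD (volume.restrict J) volume (fun h t => fourierMaximal χ ε h (Γ t)) f₁ hf₁m
    ((measurable_fourierMaximal χ ε fun n => integrable_dilate_mul _ hf₁i _).comp hΓ) hnorm
    (fun γ t => by
      have hs : MeasurableSet {x | ‖f₁ x‖ₑ < γ} := measurableSet_lt hf₁m.enorm measurable_const
      have hdec : f₁ = {x | ‖f₁ x‖ₑ < γ}.indicator f₁ + {x | γ ≤ ‖f₁ x‖ₑ}.indicator f₁ := by
        have : {x | γ ≤ ‖f₁ x‖ₑ} = {x | ‖f₁ x‖ₑ < γ}ᶜ := by ext x; simp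
        rw [this, Set.indicator_self_add_compl]
      have hs' : MeasurableSet {x | γ ≤ ‖f₁ x‖ₑ} := measurableSet_le measurable_const hf₁m.enorm
      conv_lhs => rw [hdec]
      exact fourierMaximal_add_le χ ε (fun n => integrable_dilate_mul _ (hf₁i.indicator hs) _)
        (fun n => integrable_dilate_mul _ (hf₁i.indicator hs') _) _)
    (fun γ t => by
      have hs' : MeasurableSet {x | γ ≤ ‖f₁ x‖ₑ} := measurableSet_le measurable_const hf₁m.enorm
      refine (fourierMaximal_le χ hB ε _ _).trans_eq ?_
      rw [← lintegral_indicator hs']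
      simp_rw [enorm_indicator_eq_indicator_enorm])
    (fun γ l hl => by
      have hs : MeasurableSet {x | ‖f₁ x‖ₑ < γ} := measurableSet_lt hf₁m.enorm measurable_const
      refine (hC₁ Γ J hΓ hJ hJfin hCV ε hε _ (hf₁i.indicator hs) l hl).trans_eq ?_
      congr 2
      rw [← lintegral_indicator hs]
      refine lintegral_congr fun x => ?_
      by_cases hx : x ∈ {x | ‖f₁ x‖ₑ < γ}
      · rw [Set.indicator_of_mem hx, Set.indicator_of_mem hx]
      · rw [Set.indicator_of_notMem hx, Set.indicator_of_notMem hx, enorm_zero,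
          ENNReal.zero_rpow_of_pos (by positivity)])
  simp only [hf₁, fourierMaximal_smul, hce] at hmain
  simp_rw [ENNReal.mul_rpow_of_nonneg _ _ hq0.le, ← ENNReal.rpow_mul] at hmain
  have hn1 : n ^ (-(1 / p) * q) ≠ ∞ := by simp [hn0, hfin₀]
  rw [lintegral_const_mul' _ _ hn1] at hmain
  calc _ = n ^ (q / p) * (n ^ (-(1 / p) * q) * ∫⁻ t in J, fourierMaximal χ ε f (Γ t) ^ q) := by
        rw [← mul_assoc, ← ENNReal.rpow_add _ _ hn0 hfin₀,
          show q / p + -(1 / p) * q = 0 by ring, ENNReal.rpow_zero, one_mul]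
    _ ≤ n ^ (q / p) * D := by gcongr
    _ = _ := mul_comm _ _

/-! ### Curvature and the sum map. -/

/-- The determinant of two vectors of the plane. -/
noncomputable def planeDet (u v : Plane) : ℝ := u 0 * v 1 - u 1 * v 0

theorem planeDet_sub_right (u v w : Plane) : planeDet u (v - w) = planeDet u v - planeDet u w := by
  simp [planeDet]; ring

theorem planeDet_self (u : Plane) : planeDet u u = 0 := by
  simp [planeDet]; ring

theorem planeDet_swap (u v : Plane) : planeDet u v = -planeDet v u := by
  simp [planeDet]; ring

theorem HasDerivAt.plane_coord {Γ : ℝ → Plane} {v : Plane} {t : ℝ} (h : HasDerivAt Γ v t)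
    (i : Fin 2) : HasDerivAt (fun s => Γ s i) (v i) t :=
  (EuclideanSpace.proj (𝕜 := ℝ) i).hasFDerivAt.comp_hasDerivAt t h

theorem HasDerivAt.planeDet_const_left {Γ : ℝ → Plane} {v : Plane} {t : ℝ} (h : HasDerivAt Γ v t)
    (u : Plane) : HasDerivAt (fun s => planeDet u (Γ s)) (planeDet u v) t :=
  ((h.plane_coord 1).const_mul _).sub ((h.plane_coord 0).const_mul _)

/-- Differentiable arcs whose velocity turns at a definite rate. -/
structure IsTurningArc (Γ V A : ℝ → Plane) (J : Set ℝ) (k : ℝ) (v₀ : Plane) : Prop where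
  ordConnected : J.OrdConnected
  isOpen : IsOpen J
  hasDerivAt : ∀ t ∈ J, HasDerivAt Γ (V t) t
  hasDerivAt' : ∀ t ∈ J, HasDerivAt V (A t) t
  ne_zero : k ≠ 0
  det_bound : ∀ s ∈ J, ∀ t ∈ J, k ^ 2 / 2 ≤ k * planeDet (V s) (A t)
  forward : ∀ t ∈ J, 0 < inner ℝ v₀ (V t)

namespace IsTurningArc

variable {Γ V A : ℝ → Plane} {J : Set ℝ} {k : ℝ} {v₀ : Plane}

/-- Mean value theorem for τ ↦ det(V(s), V(τ)), which vanishes at τ = s and has derivative det(V(s),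
A(τ)). -/
theorem planeDet_velocity (h : IsTurningArc Γ V A J k v₀) {s t : ℝ} (hs : s ∈ J) (ht : t ∈ J)
    (hst : s < t) : k ^ 2 / 2 * (t - s) ≤ k * planeDet (V s) (V t) := by
  have hsub : Set.Icc s t ⊆ J := h.ordConnected.out hs ht
  have hd : ∀ τ ∈ Set.Icc s t,
      HasDerivAt (fun τ => planeDet (V s) (V τ)) (planeDet (V s) (A τ)) τ :=
    fun τ hτ => (h.hasDerivAt' τ (hsub hτ)).planeDet_const_left _
  obtain ⟨c, hc, hc'⟩ := exists_hasDerivAt_eq_slope _ _ hst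
    (fun τ hτ => (hd τ hτ).continuousAt.continuousWithinAt)
    (fun τ hτ => hd τ (Set.Ioo_subset_Icc_self hτ))
  rw [planeDet_self, sub_zero, eq_div_iff (by linarith)] at hc'
  rw [← hc', ← mul_assoc]
  exact mul_le_mul_of_nonneg_right (h.det_bound s hs c (hsub (Set.Ioo_subset_Icc_self hc)))
    (by linarith)

theorem abs_planeDet_velocity (h : IsTurningArc Γ V A J k v₀) {s t : ℝ} (hs : s ∈ J)
    (ht : t ∈ J) : |k| / 2 * |s - t| ≤ |planeDet (V s) (V t)| := by
  have hk : 0 < |k| := abs_pos.2 h.ne_zero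
  have key : ∀ a ∈ J, ∀ b ∈ J, a < b → |k| / 2 * |a - b| ≤ |planeDet (V a) (V b)| := by
    intro a ha b hb hab
    have h1 := h.planeDet_velocity ha hb hab
    have h2 : k * planeDet (V a) (V b) ≤ |k| * |planeDet (V a) (V b)| := by
      rw [← abs_mul]; exact le_abs_self _
    have h3 : |k| * (|k| / 2 * |a - b|) ≤ |k| * |planeDet (V a) (V b)| := by
      rw [abs_sub_comm, abs_of_pos (by linarith : 0 < b - a)]
      calc _ = k ^ 2 / 2 * (b - a) := by rw [← sq_abs k]; ring
        _ ≤ _ := h1.trans h2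
    exact le_of_mul_le_mul_left h3 hk
  rcases lt_trichotomy s t with hst | hst | hst
  · exact key s hs t ht hst
  · simp [hst]
  · rw [planeDet_swap, abs_neg, abs_sub_comm]
    exact key t ht s hs hst

theorem inner_chord_pos (h : IsTurningArc Γ V A J k v₀) {s t : ℝ} (hs : s ∈ J) (ht : t ∈ J)
    (hst : s < t) : 0 < inner ℝ v₀ (Γ t - Γ s) := by
  have hsub : Set.Icc s t ⊆ J := h.ordConnected.out hs ht
  have hd : ∀ τ ∈ Set.Icc s t, HasDerivAt (fun τ => inner ℝ v₀ (Γ τ)) (inner ℝ v₀ (V τ)) τ :=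
    fun τ hτ => (innerSL ℝ v₀).hasFDerivAt.comp_hasDerivAt τ (h.hasDerivAt τ (hsub hτ))
  obtain ⟨c, hc, hc'⟩ := exists_hasDerivAt_eq_slope _ _ hst
    (fun τ hτ => (hd τ hτ).continuousAt.continuousWithinAt)
    (fun τ hτ => hd τ (Set.Ioo_subset_Icc_self hτ))
  rw [eq_div_iff (by linarith)] at hc'
  rw [inner_sub_right, ← hc']
  exact mul_pos (h.forward c (hsub (Set.Ioo_subset_Icc_self hc))) (by linarith)

/-- Two applications of the mean value theorem turn the determinant of the chords into a nonzero
multiple of det(V(x), V(y)), where a < x < b and c < y < d. As x < y, the velocity has turned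
strictly between them. -/
theorem planeDet_chord_ne_zero (h : IsTurningArc Γ V A J k v₀) {a b c d : ℝ} (ha : a ∈ J)
    (hd : d ∈ J) (hab : a < b) (hbc : b < c) (hcd : c < d) :
    planeDet (Γ b - Γ a) (Γ d - Γ c) ≠ 0 := by
  have hsub : Set.Icc a d ⊆ J := h.ordConnected.out ha hd
  have hab' : Set.Icc a b ⊆ Set.Icc a d := Set.Icc_subset_Icc_right (by linarith)
  have hcd' : Set.Icc c d ⊆ Set.Icc a d := Set.Icc_subset_Icc_left (by linarith)
  have hd1 : ∀ τ ∈ Set.Icc a b, HasDerivAt (fun τ => planeDet (Γ d - Γ c) (Γ τ))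
      (planeDet (Γ d - Γ c) (V τ)) τ :=
    fun τ hτ => (h.hasDerivAt τ (hsub (hab' hτ))).planeDet_const_left _
  obtain ⟨x, hx, hx'⟩ := exists_hasDerivAt_eq_slope _ _ hab
    (fun τ hτ => (hd1 τ hτ).continuousAt.continuousWithinAt)
    (fun τ hτ => hd1 τ (Set.Ioo_subset_Icc_self hτ))
  have hd2 : ∀ τ ∈ Set.Icc c d, HasDerivAt (fun τ => planeDet (V x) (Γ τ))
      (planeDet (V x) (V τ)) τ :=
    fun τ hτ => (h.hasDerivAt τ (hsub (hcd' hτ))).planeDet_const_left _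
  obtain ⟨y, hy, hy'⟩ := exists_hasDerivAt_eq_slope _ _ hcd
    (fun τ hτ => (hd2 τ hτ).continuousAt.continuousWithinAt)
    (fun τ hτ => hd2 τ (Set.Ioo_subset_Icc_self hτ))
  have hxy : x < y := by linarith [hx.2, hy.1]
  have hpos := h.planeDet_velocity (hsub (hab' (Set.Ioo_subset_Icc_self hx)))
    (hsub (hcd' (Set.Ioo_subset_Icc_self hy))) hxy
  have hne : planeDet (V x) (V y) ≠ 0 := by
    intro h0
    rw [h0, mul_zero] at hpos
    have := sq_pos_of_ne_zero h.ne_zero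
    nlinarith
  rw [← planeDet_sub_right, eq_div_iff (by linarith)] at hx' hy'
  intro h0
  rw [planeDet_swap, neg_eq_zero, ← hx', planeDet_swap, ← hy'] at h0
  rcases mul_eq_zero.1 h0 with h1 | h1
  · rcases mul_eq_zero.1 (neg_eq_zero.1 h1) with h2 | h2
    · exact hne h2
    · linarith
  · linarith

/-- Equal sums give equal chords Γ(s₂) − Γ(s₁) = Γ(t₁) − Γ(t₂). Suppose s₁ < s₂. If t₁ < t₂ the
chords point in opposite directions relative to v₀, if t₁ = t₂ one of them vanishes, and if t₂ < t₁
they are parallel chords over the disjoint intervals [s₁, s₂] and [t₂, t₁]. -/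
theorem injOn_sum (h : IsTurningArc Γ V A J k v₀) :
    Set.InjOn (fun z : ℝ × ℝ => Γ z.1 + Γ z.2) {z | z.1 ∈ J ∧ z.2 ∈ J ∧ z.1 < z.2} := by
  have key : ∀ s₁ t₁ s₂ t₂ : ℝ, s₁ ∈ J → t₁ ∈ J → s₂ ∈ J → t₂ ∈ J → s₁ < t₁ → s₂ < t₂ →
      Γ s₁ + Γ t₁ = Γ s₂ + Γ t₂ → ¬ s₁ < s₂ := by
    intro s₁ t₁ s₂ t₂ hs₁ ht₁ hs₂ ht₂ h₁ h₂ heq hlt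
    have hch : Γ s₂ - Γ s₁ = Γ t₁ - Γ t₂ := by
      rw [sub_eq_sub_iff_add_eq_add, ← heq]; abel
    have hpos := h.inner_chord_pos hs₁ hs₂ hlt
    rcases lt_trichotomy t₁ t₂ with ht | ht | ht
    · have := h.inner_chord_pos ht₁ ht₂ ht
      rw [hch, ← neg_sub, inner_neg_right] at hpos
      linarith
    · rw [hch, ht, sub_self, inner_zero_right] at hpos
      exact lt_irrefl _ hpos
    · have := h.planeDet_chord_ne_zero hs₁ ht₁ hlt h₂ ht
      rw [hch, planeDet_self] at this
      exact this rfl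
  rintro ⟨s₁, t₁⟩ ⟨hs₁, ht₁, h₁⟩ ⟨s₂, t₂⟩ ⟨hs₂, ht₂, h₂⟩ heq
  simp only at hs₁ ht₁ h₁ hs₂ ht₂ h₂ heq
  have hs : s₁ = s₂ := le_antisymm
    (not_lt.1 (key s₂ t₂ s₁ t₁ hs₂ ht₂ hs₁ ht₁ h₂ h₁ heq.symm))
    (not_lt.1 (key s₁ t₁ s₂ t₂ hs₁ ht₁ hs₂ ht₂ h₁ h₂ heq))
  subst hs
  have heq' : Γ t₁ = Γ t₂ := add_left_cancel heq
  rcases lt_trichotomy t₁ t₂ with ht | ht | ht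
  · have := h.inner_chord_pos ht₁ ht₂ ht
    rw [heq', sub_self, inner_zero_right] at this
    exact absurd this (lt_irrefl _)
  · rw [ht]
  · have := h.inner_chord_pos ht₂ ht₁ ht
    rw [heq', sub_self, inner_zero_right] at this
    exact absurd this (lt_irrefl _)

/-- The Jacobian determinant of the sum map is det(V(s), V(t)), at least |k||s − t|/2 in absolute
value. The weight |s − t| is thus absorbed, and the change of variables for injective maps applies.
-/
theorem lintegral_edist_mul_le (h : IsTurningArc Γ V A J k v₀) {S : Set (ℝ × ℝ)}
    (hS : MeasurableSet S) (hSJ : S ⊆ J ×ˢ J)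
    (hinj : Set.InjOn (fun z : ℝ × ℝ => Γ z.1 + Γ z.2) S) (N : Plane → ℝ≥0∞) :
    ∫⁻ z in S, edist z.1 z.2 * N (Γ z.1 + Γ z.2) ≤ ENNReal.ofReal (2 / |k|) * ∫⁻ ξ, N ξ := by
  have hk : 0 < |k| := abs_pos.2 h.ne_zero
  set L : Plane ≃ᵐ ℝ × ℝ :=
    (MeasurableEquiv.toLp 2 (Fin 2 → ℝ)).symm.trans MeasurableEquiv.finTwoArrow with hL
  have hLmp : MeasurePreserving L :=
    (volume_preserving_finTwoArrow ℝ).comp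
      (EuclideanSpace.volume_preserving_symm_measurableEquiv_toLp (Fin 2))
  have hLapp : ∀ u : Plane, L u = (u 0, u 1) := fun u => rfl
  set Φ : ℝ × ℝ → ℝ × ℝ := fun z => (Γ z.1 0 + Γ z.2 0, Γ z.1 1 + Γ z.2 1) with hΦ
  have hΦL : ∀ z, Φ z = L (Γ z.1 + Γ z.2) := fun z => by rw [hLapp]; simp [hΦ]
  set Φ' : ℝ × ℝ → ℝ × ℝ →L[ℝ] ℝ × ℝ := fun z =>
    (Matrix.toLin (.finTwoProd ℝ) (.finTwoProd ℝ)
      !![V z.1 0, V z.2 0; V z.1 1, V z.2 1]).toContinuousLinearMap with hΦ'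
  have hder : ∀ z ∈ S, HasFDerivWithinAt Φ (Φ' z) S z := by
    intro z hz
    obtain ⟨h1, h2⟩ := hSJ hz
    refine HasFDerivAt.hasFDerivWithinAt ?_
    simp only [hΦ']
    rw [Matrix.toLin_finTwoProd_toContinuousLinearMap]
    have c : ∀ i, HasFDerivAt (fun z : ℝ × ℝ => Γ z.1 i + Γ z.2 i)
        (V z.1 i • ContinuousLinearMap.fst ℝ ℝ ℝ + V z.2 i • ContinuousLinearMap.snd ℝ ℝ ℝ) z :=
      fun i => (((h.hasDerivAt _ h1).plane_coord i).comp_hasFDerivAt z hasFDerivAt_fst).add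
        (((h.hasDerivAt _ h2).plane_coord i).comp_hasFDerivAt z hasFDerivAt_snd)
    exact (c 0).prodMk (c 1)
  have hdet : ∀ z, (Φ' z).det = planeDet (V z.1) (V z.2) := fun z => by
    simp only [hΦ', LinearMap.det_toContinuousLinearMap, LinearMap.det_toLin,
      Matrix.det_fin_two_of, planeDet]
    ring
  have hinjΦ : Set.InjOn Φ S := by
    intro z hz z' hz' heq
    rw [hΦL, hΦL] at heq
    exact hinj hz hz' (L.injective heq)
  have hcv := lintegral_image_eq_lintegral_abs_det_fderiv_mul volume hS hder hinjΦ
    (fun y => N (L.symm y))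
  calc ∫⁻ z in S, edist z.1 z.2 * N (Γ z.1 + Γ z.2)
      ≤ ∫⁻ z in S, ENNReal.ofReal (2 / |k|) *
        (ENNReal.ofReal |(Φ' z).det| * N (L.symm (Φ z))) := by
        refine setLIntegral_mono' hS fun z hz => ?_
        obtain ⟨h1, h2⟩ := hSJ hz
        rw [hΦL, MeasurableEquiv.symm_apply_apply, ← mul_assoc,
          ← ENNReal.ofReal_mul (by positivity), hdet, edist_dist, Real.dist_eq]
        gcongr
        have := h.abs_planeDet_velocity h1 h2
        rw [div_mul_eq_mul_div, le_div_iff₀ hk]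
        linarith
    _ = ENNReal.ofReal (2 / |k|) * ∫⁻ y in Φ '' S, N (L.symm y) := by
        rw [lintegral_const_mul' _ _ ENNReal.ofReal_ne_top, hcv]
    _ ≤ ENNReal.ofReal (2 / |k|) * ∫⁻ y, N (L.symm y) := by
        gcongr
        exact Measure.restrict_le_self
    _ = _ := by
        rw [← hLmp.lintegral_comp_emb L.measurableEmbedding]
        simp

theorem sumMapBound (h : IsTurningArc Γ V A J k v₀) :
    SumMapBound Γ J (2 * (2 / |k|)).toNNReal := by
  intro N hN
  have hJ : MeasurableSet J := h.isOpen.measurableSet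
  have hk : 0 < |k| := abs_pos.2 h.ne_zero
  set S₁ : Set (ℝ × ℝ) := (J ×ˢ J) ∩ {z | z.1 < z.2} with hS₁
  set S₂ : Set (ℝ × ℝ) := (J ×ˢ J) ∩ {z | z.2 < z.1} with hS₂
  set S₀ : Set (ℝ × ℝ) := {z | z.1 = z.2} with hS₀
  have hS₁m : MeasurableSet S₁ :=
    (hJ.prod hJ).inter (measurableSet_lt measurable_fst measurable_snd)
  have hS₂m : MeasurableSet S₂ :=
    (hJ.prod hJ).inter (measurableSet_lt measurable_snd measurable_fst)
  have hS₀m : MeasurableSet S₀ := measurableSet_eq_fun measurable_fst measurable_snd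
  have hi₁ : Set.InjOn (fun z : ℝ × ℝ => Γ z.1 + Γ z.2) S₁ :=
    h.injOn_sum.mono fun z hz =>
      show z.1 ∈ J ∧ z.2 ∈ J ∧ z.1 < z.2 from ⟨hz.1.1, hz.1.2, hz.2⟩
  have hi₂ : Set.InjOn (fun z : ℝ × ℝ => Γ z.1 + Γ z.2) S₂ := by
    intro z hz z' hz' heq
    have hw : ∀ w ∈ S₂, w.swap ∈ {z : ℝ × ℝ | z.1 ∈ J ∧ z.2 ∈ J ∧ z.1 < z.2} := fun w hw =>
      show w.2 ∈ J ∧ w.1 ∈ J ∧ w.2 < w.1 from ⟨hw.1.2, hw.1.1, hw.2⟩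
    have := h.injOn_sum (hw z hz) (hw z' hz') (by simpa [add_comm] using heq)
    exact Prod.swap_injective this
  -- The sum map is two-to-one off the diagonal, so the two triangles are treated separately; on the
  -- diagonal the weight vanishes. This doubles the constant 2/|k|.
  have hsub : J ×ˢ J ⊆ S₁ ∪ (S₂ ∪ S₀) := by
    intro z hz
    rcases lt_trichotomy z.1 z.2 with hlt | heq | hlt
    · exact Or.inl ⟨hz, hlt⟩
    · exact Or.inr (Or.inr heq)
    · exact Or.inr (Or.inl ⟨hz, hlt⟩)
  have h0 : ∫⁻ z in S₀, edist z.1 z.2 * N (Γ z.1 + Γ z.2) = 0 := by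
    rw [setLIntegral_congr_fun hS₀m (g := fun _ => 0) (fun z hz => by
      have : z.1 = z.2 := hz
      simp [this])]
    simp
  calc _ ≤ ∫⁻ z in S₁ ∪ (S₂ ∪ S₀), edist z.1 z.2 * N (Γ z.1 + Γ z.2) := lintegral_mono_set hsub
    _ ≤ (∫⁻ z in S₁, edist z.1 z.2 * N (Γ z.1 + Γ z.2)) +
        ((∫⁻ z in S₂, edist z.1 z.2 * N (Γ z.1 + Γ z.2)) +
          ∫⁻ z in S₀, edist z.1 z.2 * N (Γ z.1 + Γ z.2)) :=
        (lintegral_union_le _ _ _).trans (by gcongr; exact lintegral_union_le _ _ _)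
    _ ≤ ENNReal.ofReal (2 / |k|) * (∫⁻ ξ, N ξ) + (ENNReal.ofReal (2 / |k|) * (∫⁻ ξ, N ξ) + 0) := by
        gcongr
        · exact h.lintegral_edist_mul_le hS₁m Set.inter_subset_left hi₁ N
        · exact h.lintegral_edist_mul_le hS₂m Set.inter_subset_left hi₂ N
        · exact h0.le
    _ = _ := by
        have : ((2 * (2 / |k|)).toNNReal : ℝ≥0∞) = 2 * ENNReal.ofReal (2 / |k|) := by
          change ENNReal.ofReal (2 * (2 / |k|)) = _
          rw [ENNReal.ofReal_mul zero_le_two, ENNReal.ofReal_ofNat]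
        rw [this]
        ring

end IsTurningArc

/-! ### From integrable functions to L^p. -/

theorem SchwartzMap.exists_dilation (ψ : 𝓢(Plane, ℂ)) {ε : ℝ} (hε : ε ≠ 0) :
    ∃ φ : 𝓢(Plane, ℂ), ∀ x, φ x = ψ (ε • x) :=
  ⟨SchwartzMap.compCLMOfContinuousLinearEquiv ℂ
    (ContinuousLinearEquiv.smulLeft (Units.mk0 ε hε)) ψ, fun _ => rfl⟩

theorem integrable_dilate_mul_memLp (ψ : 𝓢(Plane, ℂ)) {p : ℝ≥0∞} (hp : 1 ≤ p) {f : Plane → ℂ}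
    (hf : MemLp f p) {ε : ℝ} (hε : 0 < ε) : Integrable (fun x => ψ (ε • x) * f x) := by
  obtain ⟨φ, hφ⟩ := ψ.exists_dilation hε.ne'
  simpa only [hφ] using integrable_schwartz_mul_memLp φ hp hf

theorem tendsto_regularizedFourier_indicator (χ : 𝓢(Plane, ℂ)) {p : ℝ≥0∞} (hp : 1 ≤ p)
    {f : Plane → ℂ} (hf : MemLp f p) {ε : ℝ} (hε : 0 < ε) (ξ : Plane) :
    Tendsto (fun n : ℕ => regularizedFourier χ ε ((Metric.ball (0 : Plane) n).indicator f) ξ)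
      atTop (𝓝 (regularizedFourier χ ε f ξ)) := by
  simp only [regularizedFourier_eq_integral]
  generalize (𝓕⁻ χ : 𝓢(Plane, ℂ)) = ψ
  have hint := integrable_dilate_mul_memLp ψ hp hf hε
  refine tendsto_integral_of_dominated_convergence (fun x => ‖ψ (ε • x) * f x‖) ?_
    hint.norm ?_ ?_
  · intro n
    refine AEStronglyMeasurable.mul (Continuous.aestronglyMeasurable ?_)
      (AEStronglyMeasurable.mul (Continuous.aestronglyMeasurable (by fun_prop))
        (hf.1.indicator measurableSet_ball))
    exact continuous_subtype_val.comp (Real.continuous_fourierChar.comp (by fun_prop))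
  · refine fun n => ae_of_all _ fun x => ?_
    rw [norm_mul, Circle.norm_coe, one_mul, norm_mul, norm_mul]
    gcongr
    exact norm_indicator_le_norm_self _ _
  · refine ae_of_all _ fun x => ?_
    refine tendsto_const_nhds.congr' ?_
    obtain ⟨N, hN⟩ := exists_nat_gt ‖x‖
    filter_upwards [eventually_ge_atTop N] with n hn
    have hx : x ∈ Metric.ball (0 : Plane) n := by
      rw [mem_ball_zero_iff]
      exact hN.trans_le (by exact_mod_cast hn)
    rw [Set.indicator_of_mem hx]

theorem integrable_indicator_ball_of_memLp {p : ℝ≥0∞} (hp : 1 ≤ p) {f : Plane → ℂ}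
    (hf : MemLp f p) (r : ℝ) : Integrable ((Metric.ball (0 : Plane) r).indicator f) := by
  rw [integrable_indicator_iff measurableSet_ball]
  have : IsFiniteMeasure (volume.restrict (Metric.ball (0 : Plane) r)) :=
    ⟨by rw [Measure.restrict_apply_univ]; exact measure_ball_lt_top⟩
  exact (hf.restrict _).integrable hp

/-- The maximal restriction theorem on an arc. -/
theorem exists_strongType_fourierMaximal (χ : 𝓢(Plane, ℂ)) (C₀ : ℝ≥0) {p : ℝ}
    (hp : 1 < p) (hp' : p < 4 / 3) :
    ∃ C : ℝ≥0, ∀ (Γ : ℝ → Plane) (J : Set ℝ), Measurable Γ → MeasurableSet J → volume J ≠ ∞ →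
      SumMapBound Γ J C₀ → ∀ ε : ℕ → ℝ, (∀ n, 0 < ε n) → ∀ f : Plane → ℂ,
      MemLp f (ENNReal.ofReal p) →
      ∫⁻ t in J, fourierMaximal χ ε f (Γ t) ^ (p / (3 * (p - 1)))
        ≤ C * (∫⁻ x, ‖f x‖ₑ ^ p) ^ ((p / (3 * (p - 1))) / p) := by
  obtain ⟨C, hC⟩ := exists_strongType_fourierMaximal_of_integrable χ C₀ hp hp'
  refine ⟨C, fun Γ J hΓ hJ hJfin hCV ε hε f hf => ?_⟩
  have hp1 : 0 < p - 1 := by linarith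
  have hpE : 1 ≤ ENNReal.ofReal p := by simpa using hp.le
  set q : ℝ := p / (3 * (p - 1)) with hq
  have hq0 : 0 < q := by positivity
  have hfin : ∫⁻ x, ‖f x‖ₑ ^ p ≠ ∞ := by
    have := hf.eLpNorm_lt_top
    rw [eLpNorm_lt_top_iff_lintegral_rpow_enorm_lt_top (by simpa using (by linarith : 0 < p))
      ENNReal.ofReal_ne_top, ENNReal.toReal_ofReal (by linarith)] at this
    exact this.ne
  set F : ℕ → Plane → ℂ := fun n => (Metric.ball (0 : Plane) n).indicator f with hF
  have hFint : ∀ n, Integrable (F n) := fun n => integrable_indicator_ball_of_memLp hpE hf n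
  have hFle : ∀ n, ∫⁻ x, ‖F n x‖ₑ ^ p ≤ ∫⁻ x, ‖f x‖ₑ ^ p := fun n => by
    refine lintegral_mono fun x => ENNReal.rpow_le_rpow ?_ (by linarith)
    exact enorm_indicator_le_enorm_self _ _
  -- The truncations of f to discs are integrable and their averages converge at every scale, so the
  -- maximal function is lower semicontinuous along them and Fatou's lemma carries the bound over to
  -- f.
  have hpt : ∀ t, fourierMaximal χ ε f (Γ t) ^ q
      ≤ liminf (fun n => fourierMaximal χ ε (F n) (Γ t) ^ q) atTop := by
    intro t
    have h1 : fourierMaximal χ ε f (Γ t)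
        ≤ liminf (fun n => fourierMaximal χ ε (F n) (Γ t)) atTop := by
      refine iSup_le fun k => ?_
      have hlim := (tendsto_regularizedFourier_indicator χ hpE hf (hε k) (Γ t)).enorm
      rw [← hlim.liminf_eq]
      exact liminf_le_liminf (Eventually.of_forall fun n =>
        le_iSup (fun k => ‖regularizedFourier χ (ε k) (F n) (Γ t)‖ₑ) k)
    refine (ENNReal.rpow_le_rpow h1 hq0.le).trans_eq ?_
    exact (ENNReal.orderIsoRpow q hq0).liminf_apply
  calc _ ≤ ∫⁻ t in J, liminf (fun n => fourierMaximal χ ε (F n) (Γ t) ^ q) atTop :=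
        lintegral_mono hpt
    _ ≤ liminf (fun n => ∫⁻ t in J, fourierMaximal χ ε (F n) (Γ t) ^ q) atTop := by
        refine lintegral_liminf_le fun n => ?_
        exact ((measurable_fourierMaximal χ ε fun k =>
          integrable_dilate_mul _ (hFint n) _).comp hΓ).pow_const _
    _ ≤ liminf (fun _ : ℕ => C * (∫⁻ x, ‖f x‖ₑ ^ p) ^ (q / p)) atTop := by
        refine liminf_le_liminf (Eventually.of_forall fun n => ?_)
        refine (hC Γ J hΓ hJ hJfin hCV ε hε (F n) (hFint n)
          ((hFle n).trans_lt hfin.lt_top).ne).trans ?_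
        exact mul_le_mul_right (ENNReal.rpow_le_rpow (hFle n) (by positivity)) _
    _ = _ := liminf_const _

/-! ### Localization to compact sets of curved points. -/

namespace PlaneCurve

variable {Γ : ℝ → Plane} {I : Set ℝ}

/-- On a one-point interval the derivative within I is 0, hence so is `kappa`. A curved point thus
forces I to have interior, which makes one-sided derivatives meaningful. -/
theorem uniqueDiffOn_of_mem_curvedSet (hI : I.OrdConnected) {t₀ : ℝ} (ht₀ : t₀ ∈ curvedSet Γ I) :
    UniqueDiffOn ℝ I := by
  have hconv : Convex ℝ I := hI.convex
  refine uniqueDiffOn_convex hconv (hconv.nontrivial_iff_nonempty_interior.1 ?_)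
  by_contra hnt
  rw [Set.not_nontrivial_iff] at hnt
  refine ht₀.2 ?_
  have hv : velocity Γ I t₀ = 0 := by
    refine derivWithin_zero_of_not_accPt fun hacc => ?_
    obtain ⟨y, hy⟩ := (accPt_iff_nhds.1 hacc) Set.univ Filter.univ_mem
    exact hy.2 (hnt hy.1.2 ht₀.1)
  simp [kappa, hv]

/-- By continuity of the velocity and the acceleration at t₀. The determinant is controlled at pairs
(s, t), not just on the diagonal, and the constant k²/2 is half of its value k² at (t₀, t₀). -/
theorem exists_isTurningArc (hI : I.OrdConnected) (hΓ : ContDiffOn ℝ 2 Γ I) {t₀ : ℝ}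
    (ht₀ : t₀ ∈ curvedSet Γ I) :
    ∃ δ > 0, ∃ M : ℝ≥0, IsTurningArc Γ (velocity Γ I) (acceleration Γ I)
      (interior I ∩ Set.Ioo (t₀ - δ) (t₀ + δ)) (kappa Γ I t₀) (velocity Γ I t₀) ∧
      ∀ t ∈ I ∩ Set.Ioo (t₀ - δ) (t₀ + δ), ‖velocity Γ I t‖ₑ ≤ M := by
  have hU := uniqueDiffOn_of_mem_curvedSet hI ht₀
  have ht₀I : t₀ ∈ I := ht₀.1
  set V := velocity Γ I with hV
  set A := acceleration Γ I with hA
  set k := kappa Γ I t₀ with hk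
  have hk0 : k ≠ 0 := ht₀.2
  have hVdiff : ContDiffOn ℝ 1 V I := hΓ.derivWithin hU (by norm_num)
  have hVc : ContinuousOn V I := hVdiff.continuousOn
  have hAc : ContinuousOn A I := hVdiff.continuousOn_derivWithin hU le_rfl
  have hkdet : k = planeDet (V t₀) (A t₀) := rfl
  have hdetc : ContinuousWithinAt (fun z : ℝ × ℝ => k * planeDet (V z.1) (A z.2)) (I ×ˢ I)
      (t₀, t₀) := by
    have h1 : ContinuousWithinAt (fun z : ℝ × ℝ => V z.1) (I ×ˢ I) (t₀, t₀) :=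
      (hVc t₀ ht₀I).comp (t := I) continuous_fst.continuousWithinAt (fun z hz => hz.1)
    have h2 : ContinuousWithinAt (fun z : ℝ × ℝ => A z.2) (I ×ˢ I) (t₀, t₀) :=
      (hAc t₀ ht₀I).comp (t := I) continuous_snd.continuousWithinAt (fun z hz => hz.2)
    have c : ∀ i : Fin 2, Continuous (fun v : Plane => v i) := fun i => by fun_prop
    have h1c := fun i => (c i).continuousAt.comp_continuousWithinAt h1
    have h2c := fun i => (c i).continuousAt.comp_continuousWithinAt h2
    exact continuousWithinAt_const.mul (((h1c 0).mul (h2c 1)).sub ((h1c 1).mul (h2c 0)))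
  have hev1 : ∀ᶠ z in 𝓝[I ×ˢ I] ((t₀, t₀) : ℝ × ℝ),
      k ^ 2 / 2 < k * planeDet (V z.1) (A z.2) := by
    refine hdetc.eventually (lt_mem_nhds ?_)
    simp only [← hkdet]
    have := sq_pos_of_ne_zero hk0
    nlinarith
  have hVne : V t₀ ≠ 0 := by
    intro h0
    refine hk0 ?_
    rw [hkdet, h0]
    simp [planeDet]
  have hev2 : ∀ᶠ t in 𝓝[I] t₀, 0 < inner ℝ (V t₀) (V t) := by
    have hc : ContinuousWithinAt (fun t => inner ℝ (V t₀) (V t)) I t₀ :=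
      continuousWithinAt_const.inner (𝕜 := ℝ) (hVc t₀ ht₀I)
    refine hc.eventually (lt_mem_nhds ?_)
    exact real_inner_self_pos.2 hVne
  have hev3 : ∀ᶠ t in 𝓝[I] t₀, ‖V t‖ < ‖V t₀‖ + 1 :=
    (hVc t₀ ht₀I).norm.eventually (gt_mem_nhds (by linarith))
  rw [nhdsWithin_prod_eq, (nhdsWithin_hasBasis Metric.nhds_basis_ball I).prod_self.eventually_iff]
    at hev1
  obtain ⟨δ₁, hδ₁, h1⟩ := hev1
  obtain ⟨δ₂, hδ₂, h2⟩ :=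
    ((nhdsWithin_hasBasis Metric.nhds_basis_ball I).eventually_iff).1 (hev2.and hev3)
  refine ⟨min δ₁ δ₂, lt_min hδ₁ hδ₂, ‖V t₀‖₊ + 1, ?_, ?_⟩
  · have hsub1 : ∀ t ∈ interior I ∩ Set.Ioo (t₀ - min δ₁ δ₂) (t₀ + min δ₁ δ₂),
        t ∈ Metric.ball t₀ δ₁ ∩ I := fun t ht => by
      refine ⟨?_, interior_subset ht.1⟩
      rw [← Real.ball_eq_Ioo] at ht
      exact Metric.ball_subset_ball (min_le_left _ _) ht.2
    have hsub2 : ∀ t ∈ interior I ∩ Set.Ioo (t₀ - min δ₁ δ₂) (t₀ + min δ₁ δ₂),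
        t ∈ Metric.ball t₀ δ₂ ∩ I := fun t ht => by
      refine ⟨?_, interior_subset ht.1⟩
      rw [← Real.ball_eq_Ioo] at ht
      exact Metric.ball_subset_ball (min_le_right _ _) ht.2
    refine ⟨hI.interior.inter Set.ordConnected_Ioo, isOpen_interior.inter isOpen_Ioo, ?_, ?_, hk0,
      ?_, ?_⟩
    · intro t ht
      have hn : I ∈ 𝓝 t := mem_interior_iff_mem_nhds.1 ht.1
      exact ((hΓ.differentiableOn two_ne_zero t (interior_subset ht.1)).hasDerivWithinAt).hasDerivAt
        hn
    · intro t ht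
      have hn : I ∈ 𝓝 t := mem_interior_iff_mem_nhds.1 ht.1
      exact ((hVdiff.differentiableOn one_ne_zero t
        (interior_subset ht.1)).hasDerivWithinAt).hasDerivAt hn
    · intro s hs t ht
      exact (h1 (x := (s, t)) ⟨hsub1 s hs, hsub1 t ht⟩).le
    · intro t ht
      exact (h2 (hsub2 t ht)).1
  · intro t ht
    have hmem : t ∈ Metric.ball t₀ δ₂ ∩ I := by
      refine ⟨?_, ht.1⟩
      rw [← Real.ball_eq_Ioo] at ht
      exact Metric.ball_subset_ball (min_le_right _ _) ht.2
    have := (h2 hmem).2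
    exact ENNReal.coe_le_coe.2 (NNReal.coe_le_coe.1 (by simpa using this.le))

end PlaneCurve

namespace PlaneCurve

variable {Γ : ℝ → Plane} {I : Set ℝ}

theorem curvedArclength_le_arclength : curvedArclength Γ I ≤ arclength Γ I :=
  Measure.restrict_le_self

theorem aemeasurable_curve (hI : I.OrdConnected) (hΓ : ContinuousOn Γ I) :
    AEMeasurable Γ (curvedArclength Γ I) :=
  (hΓ.aemeasurable hI.measurableSet).mono_ac
    ((Measure.absolutelyContinuous_of_le curvedArclength_le_arclength).trans
      (withDensity_absolutelyContinuous _ _))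

/-- The end points of I are Lebesgue null. The turning arc may therefore live in the interior of I,
where the derivatives are two-sided. -/
theorem curvedArclength_restrict_le (hI : I.OrdConnected) {U : Set ℝ} (hU : MeasurableSet U)
    {M : ℝ≥0} (hM : ∀ t ∈ I ∩ U, ‖velocity Γ I t‖ₑ ≤ M) :
    (curvedArclength Γ I).restrict U ≤ (M : ℝ≥0∞) • volume.restrict (interior I ∩ U) := by
  have hIm := hI.measurableSet
  have hint : (interior I ∩ U : Set ℝ) =ᵐ[volume] (I ∩ U : Set ℝ) := by
    refine (ae_eq_set_inter ?_ (ae_eq_refl U))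
    exact interior_ae_eq_of_null_frontier (hI.convex.addHaar_frontier volume)
  calc (curvedArclength Γ I).restrict U ≤ (arclength Γ I).restrict U :=
        Measure.restrict_mono le_rfl curvedArclength_le_arclength
    _ = (volume.restrict (I ∩ U)).withDensity (fun t => ‖velocity Γ I t‖ₑ) := by
        rw [arclength, restrict_withDensity hU, Measure.restrict_restrict hU, Set.inter_comm]
    _ ≤ (volume.restrict (I ∩ U)).withDensity (fun _ => (M : ℝ≥0∞)) := by
        refine withDensity_mono ?_
        filter_upwards [ae_restrict_mem (hIm.inter hU)] with t ht
        exact hM t ht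
    _ = (M : ℝ≥0∞) • volume.restrict (interior I ∩ U) := by
        rw [withDensity_const, Measure.restrict_congr_set hint]

theorem exists_local_bound (hI : I.OrdConnected) (hΓ : ContDiffOn ℝ 2 Γ I) (χ : 𝓢(Plane, ℂ))
    {p : ℝ} (hp : 1 < p) (hp' : p < 4 / 3) {t₀ : ℝ} (ht₀ : t₀ ∈ curvedSet Γ I) :
    ∃ U ∈ 𝓝 t₀, ∃ C : ℝ≥0, ∀ ε : ℕ → ℝ, (∀ n, 0 < ε n) → ∀ f : Plane → ℂ,
      MemLp f (ENNReal.ofReal p) →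
      ∫⁻ t in U, fourierMaximal χ ε f (Γ t) ^ (p / (3 * (p - 1))) ∂(curvedArclength Γ I)
        ≤ C * (∫⁻ x, ‖f x‖ₑ ^ p) ^ ((p / (3 * (p - 1))) / p) := by
  classical
  obtain ⟨δ, hδ, M, harc, hM⟩ := exists_isTurningArc hI hΓ ht₀
  set U := Set.Ioo (t₀ - δ) (t₀ + δ) with hU
  set J := interior I ∩ U with hJ
  have hJm : MeasurableSet J := harc.isOpen.measurableSet
  -- The curve is only continuous on I and may fail to be measurable elsewhere, so it is replaced by
  -- 0 off J.
  set Γ' : ℝ → Plane := J.piecewise Γ (fun _ => 0) with hΓ'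
  have hΓ'm : Measurable Γ' := ContinuousOn.measurable_piecewise
    (hΓ.continuousOn.mono (Set.inter_subset_left.trans interior_subset))
    continuousOn_const hJm
  have hΓ'eq : ∀ t ∈ J, Γ' t = Γ t := fun t ht => Set.piecewise_eq_of_mem _ _ _ ht
  have hCV : SumMapBound Γ' J (2 * (2 / |kappa Γ I t₀|)).toNNReal := by
    intro N hN
    refine le_of_eq_of_le ?_ (harc.sumMapBound N hN)
    refine setLIntegral_congr_fun (hJm.prod hJm) fun z hz => ?_
    rw [hΓ'eq _ hz.1, hΓ'eq _ hz.2]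
  obtain ⟨C, hC⟩ := exists_strongType_fourierMaximal χ
    (2 * (2 / |kappa Γ I t₀|)).toNNReal hp hp'
  have hJfin : volume J ≠ ∞ :=
    ((measure_mono Set.inter_subset_right).trans_lt (by simp [hU])).ne
  refine ⟨U, Ioo_mem_nhds (by linarith) (by linarith), M * C, fun ε hε f hf => ?_⟩
  calc _ ≤ ∫⁻ t, fourierMaximal χ ε f (Γ t) ^ (p / (3 * (p - 1)))
        ∂((M : ℝ≥0∞) • volume.restrict J) :=
        lintegral_mono' (curvedArclength_restrict_le hI measurableSet_Ioo hM) le_rfl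
    _ = M * ∫⁻ t in J, fourierMaximal χ ε f (Γ' t) ^ (p / (3 * (p - 1))) := by
        rw [lintegral_smul_measure, smul_eq_mul]
        congr 1
        exact setLIntegral_congr_fun hJm fun t ht => by rw [hΓ'eq t ht]
    _ ≤ _ := by
        rw [ENNReal.coe_mul, mul_assoc]
        exact mul_le_mul_right (hC Γ' J hΓ'm hJm hJfin hCV ε hε f hf) _

theorem exists_compact_bound (hI : I.OrdConnected) (hΓ : ContDiffOn ℝ 2 Γ I) (χ : 𝓢(Plane, ℂ))
    {p : ℝ} (hp : 1 < p) (hp' : p < 4 / 3) {K : Set ℝ} (hK : IsCompact K)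
    (hKs : K ⊆ curvedSet Γ I) :
    ∃ C : ℝ≥0, ∀ ε : ℕ → ℝ, (∀ n, 0 < ε n) → ∀ f : Plane → ℂ, MemLp f (ENNReal.ofReal p) →
      ∫⁻ t in K, fourierMaximal χ ε f (Γ t) ^ (p / (3 * (p - 1))) ∂(curvedArclength Γ I)
        ≤ C * (∫⁻ x, ‖f x‖ₑ ^ p) ^ ((p / (3 * (p - 1))) / p) := by
  refine hK.induction_on (p := fun S => ∃ C : ℝ≥0, ∀ ε : ℕ → ℝ, (∀ n, 0 < ε n) →
    ∀ f : Plane → ℂ, MemLp f (ENNReal.ofReal p) →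
      ∫⁻ t in S, fourierMaximal χ ε f (Γ t) ^ (p / (3 * (p - 1))) ∂(curvedArclength Γ I)
        ≤ C * (∫⁻ x, ‖f x‖ₑ ^ p) ^ ((p / (3 * (p - 1))) / p)) ?_ ?_ ?_ ?_
  · exact ⟨0, fun ε _ f _ => by simp⟩
  · rintro s t hst ⟨C, hC⟩
    exact ⟨C, fun ε hε f hf => (lintegral_mono_set hst).trans (hC ε hε f hf)⟩
  · rintro s t ⟨C, hC⟩ ⟨D, hD⟩
    refine ⟨C + D, fun ε hε f hf => (lintegral_union_le _ _ _).trans ?_⟩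
    rw [ENNReal.coe_add, add_mul]
    exact add_le_add (hC ε hε f hf) (hD ε hε f hf)
  · intro t ht
    obtain ⟨U, hU, C, hC⟩ := exists_local_bound hI hΓ χ hp hp' (hKs ht)
    exact ⟨U, mem_nhdsWithin_of_mem_nhds hU, C, hC⟩

theorem curvedArclength_lt_top_of_isCompact (hI : I.OrdConnected) (hΓ : ContDiffOn ℝ 2 Γ I)
    {K : Set ℝ} (hK : IsCompact K) (hKs : K ⊆ curvedSet Γ I) : curvedArclength Γ I K < ∞ := by
  refine hK.measure_lt_top_of_nhdsWithin fun t₀ ht₀ => ?_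
  obtain ⟨δ, hδ, M, -, hM⟩ := exists_isTurningArc hI hΓ (hKs ht₀)
  refine ⟨Set.Ioo (t₀ - δ) (t₀ + δ), mem_nhdsWithin_of_mem_nhds
    (Ioo_mem_nhds (by linarith) (by linarith)), ?_⟩
  have := curvedArclength_restrict_le hI measurableSet_Ioo hM Set.univ
  rw [Measure.restrict_apply_univ] at this
  refine this.trans_lt ?_
  rw [Measure.smul_apply, Measure.restrict_apply_univ, smul_eq_mul]
  exact ENNReal.mul_lt_top ENNReal.coe_lt_top
    ((measure_mono Set.inter_subset_right).trans_lt (by simp))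

/-- The maximal restriction theorem on compact sets of points of nonvanishing curvature. -/
theorem exists_eLpNorm_fourierMaximal_le (hI : I.OrdConnected) (hΓ : ContDiffOn ℝ 2 Γ I)
    (χ : 𝓢(Plane, ℂ)) {p q : ℝ≥0∞} (hp1 : 1 ≤ p) (hp : p < 4 / 3)
    (hpq : 3 * q ≤ p.conjExponent) {K : Set ℝ} (hK : IsCompact K) (hKs : K ⊆ curvedSet Γ I) :
    ∃ C : ℝ≥0, ∀ ε : ℕ → ℝ, (∀ n, 0 < ε n) → ∀ f : Plane → ℂ, MemLp f p →
      eLpNorm (fun t => fourierMaximal χ ε f (Γ t)) q ((curvedArclength Γ I).restrict K)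
        ≤ C * eLpNorm f p volume := by
  have hμK : (curvedArclength Γ I).restrict K Set.univ ≠ ∞ := by
    rw [Measure.restrict_apply_univ]
    exact (curvedArclength_lt_top_of_isCompact hI hΓ hK hKs).ne
  set μ := (curvedArclength Γ I).restrict K with hμ
  have hmeas : ∀ ε : ℕ → ℝ, (∀ n, 0 < ε n) → ∀ f : Plane → ℂ, MemLp f p →
      AEStronglyMeasurable (fun t => fourierMaximal χ ε f (Γ t)) μ := fun ε hε f hf =>
    ((measurable_fourierMaximal χ ε fun n =>
      integrable_dilate_mul_memLp _ hp1 hf (hε n)).comp_aemeasurable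
      ((aemeasurable_curve hI hΓ.continuousOn).mono_measure
        Measure.restrict_le_self)).aestronglyMeasurable
  -- For p = 1 every q is allowed and the trivial L^∞ bound suffices. For p > 1 the bound holds at
  -- the critical exponent s = p'/3 and passes down to q ≤ s. Both cases use that K has finite
  -- measure.
  rcases eq_or_lt_of_le hp1 with rfl | hp1'
  · obtain ⟨B, -, hB⟩ := (𝓕⁻ χ : 𝓢(Plane, ℂ)).exists_nnreal_norm_le
    have hfin : μ Set.univ ^ (1 / q.toReal) ≠ ∞ :=
      ENNReal.rpow_ne_top_of_nonneg (by positivity) hμK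
    refine ⟨B * (μ Set.univ ^ (1 / q.toReal)).toNNReal, fun ε hε f hf => ?_⟩
    refine (eLpNorm_le_eLpNorm_mul_rpow_measure_univ le_top (hmeas ε hε f hf)).trans ?_
    rw [ENNReal.coe_mul, ENNReal.coe_toNNReal hfin, eLpNorm_exponent_top,
      eLpNorm_one_eq_lintegral_enorm]
    simp only [ENNReal.toReal_top, _root_.div_zero, sub_zero]
    rw [mul_assoc, mul_comm (_ ^ _) (lintegral _ _), ← mul_assoc]
    refine mul_le_mul_left ?_ _
    refine eLpNormEssSup_le_of_ae_enorm_bound (ae_of_all _ fun t => ?_)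
    exact fourierMaximal_le χ hB ε f _
  · have hpt : p ≠ ∞ := (hp.trans (by finiteness)).ne
    obtain ⟨r, hr⟩ : ∃ r : ℝ, r = p.toReal := ⟨_, rfl⟩
    have hpr : p = ENNReal.ofReal r := by rw [hr, ENNReal.ofReal_toReal hpt]
    have hr1 : 1 < r := by
      rw [hr, ← ENNReal.toReal_one]
      exact (ENNReal.toReal_lt_toReal (by simp) hpt).2 hp1'
    have hr43 : r < 4 / 3 := by
      have := (ENNReal.toReal_lt_toReal hpt (by finiteness)).2 hp
      rw [← hr] at this
      simpa using this
    have hr10 : 0 < r - 1 := by linarith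
    set s : ℝ := r / (3 * (r - 1)) with hs
    have hs0 : 0 < s := by positivity
    have hconj : p.conjExponent = ENNReal.ofReal (r / (r - 1)) := by
      rw [ENNReal.conjExponent, hpr, ← ENNReal.ofReal_one, ← ENNReal.ofReal_sub _ zero_le_one,
        ← ENNReal.ofReal_inv_of_pos hr10, ← ENNReal.ofReal_add zero_le_one (by positivity)]
      congr 1
      field_simp
      ring
    have hqs : q ≤ ENNReal.ofReal s := by
      have h3 : (3 : ℝ≥0∞) * ENNReal.ofReal s = p.conjExponent := by
        rw [hconj, ← ENNReal.ofReal_ofNat 3, ← ENNReal.ofReal_mul (by norm_num), hs]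
        congr 1
        field_simp
      rw [← h3] at hpq
      exact (ENNReal.mul_le_mul_iff_right (by simp) (by simp)).1 hpq
    obtain ⟨C, hC⟩ := exists_compact_bound hI hΓ χ hr1 hr43 hK hKs
    have hq0 : q.toReal ≤ s := ENNReal.toReal_le_of_le_ofReal hs0.le hqs
    by_cases hqz : q = 0
    · exact ⟨0, fun ε _ f _ => by simp [hqz]⟩
    have hqpos : 0 < q.toReal := ENNReal.toReal_pos hqz (hqs.trans_lt ENNReal.ofReal_lt_top).ne
    have hexp : 0 ≤ 1 / q.toReal - 1 / (ENNReal.ofReal s).toReal := by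
      rw [ENNReal.toReal_ofReal hs0.le, sub_nonneg]
      exact one_div_le_one_div_of_le hqpos hq0
    have hfin : μ Set.univ ^ (1 / q.toReal - 1 / (ENNReal.ofReal s).toReal) ≠ ∞ :=
      ENNReal.rpow_ne_top_of_nonneg hexp hμK
    refine ⟨C ^ (1 / s) *
      (μ Set.univ ^ (1 / q.toReal - 1 / (ENNReal.ofReal s).toReal)).toNNReal,
      fun ε hε f hf => ?_⟩
    refine (eLpNorm_le_eLpNorm_mul_rpow_measure_univ hqs (hmeas ε hε f hf)).trans ?_
    rw [ENNReal.coe_mul, ENNReal.coe_toNNReal hfin, mul_assoc, mul_comm (_ ^ _) (eLpNorm f p volume),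
      ← mul_assoc]
    refine mul_le_mul_left ?_ _
    have hpz : p ≠ 0 := (zero_lt_one.trans hp1').ne'
    rw [eLpNorm_eq_lintegral_rpow_enorm_toReal (by simpa using hs0) ENNReal.ofReal_ne_top,
      eLpNorm_eq_lintegral_rpow_enorm_toReal hpz hpt, ENNReal.toReal_ofReal hs0.le, ← hr]
    simp only [enorm_eq_self]
    calc _ ≤ (C * (∫⁻ x, ‖f x‖ₑ ^ r) ^ (s / r)) ^ (1 / s) :=
          ENNReal.rpow_le_rpow (hC ε hε f (hpr ▸ hf)) (by positivity)
      _ = _ := by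
          rw [ENNReal.mul_rpow_of_nonneg _ _ (by positivity), ← ENNReal.rpow_mul,
            ENNReal.coe_rpow_of_nonneg _ (by positivity)]
          congr 2
          field_simp

end PlaneCurve

-- Pointwise convergence of the averages.

attribute [local irreducible] regularizedFourier

theorem regularizedFourier_sub (χ : 𝓢(Plane, ℂ)) (ε : ℝ) {f g : Plane → ℂ}
    (hf : Integrable (fun x => (𝓕⁻ χ) (ε • x) * f x))
    (hg : Integrable (fun x => (𝓕⁻ χ) (ε • x) * g x)) (ξ : Plane) :
    regularizedFourier χ ε (f - g) ξ = regularizedFourier χ ε f ξ - regularizedFourier χ ε g ξ := by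
  have hg' : Integrable (fun x => (𝓕⁻ χ) (ε • x) * ((-1 : ℂ) • g) x) := by
    simpa using hg.neg
  have h : f - g = f + (-1 : ℂ) • g := by simp [sub_eq_add_neg]
  rw [h, regularizedFourier_add χ ε hf hg', regularizedFourier_smul]
  ring

theorem SchwartzMap.continuousAt_integral_dilate_mul (ψ : 𝓢(Plane, ℂ)) {p : ℝ≥0∞} (hp1 : 1 ≤ p)
    (hp : p ≠ ∞) {f : Plane → ℂ} (hf : MemLp f p) (ξ : Plane) {ε₀ : ℝ} (hε₀ : 0 < ε₀) :
    ContinuousAt (fun ε : ℝ => ∫ x, (Real.fourierChar (-inner ℝ x ξ) : ℂ) * (ψ (ε • x) * f x))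
      ε₀ := by
  have hp0 : p ≠ 0 := (zero_lt_one.trans_le hp1).ne'
  have hp1' : 1 ≤ p.toReal := by
    rw [← ENNReal.toReal_one]
    exact (ENNReal.toReal_le_toReal (by simp) hp).2 hp1
  obtain ⟨C, hC⟩ : ∃ C : ℝ, ∀ x, (1 + ‖x‖) ^ 3 * ‖ψ x‖ ≤ C :=
    ⟨2 ^ 3 * (Finset.Iic ((3, 0) : ℕ × ℕ)).sup (fun m => SchwartzMap.seminorm ℝ m.1 m.2) ψ,
      fun x => by
        have := SchwartzMap.one_add_le_sup_seminorm_apply (𝕜 := ℝ) (m := (3, 0)) (k := 3) (n := 0)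
          le_rfl le_rfl ψ x
        rwa [norm_iteratedFDeriv_zero] at this⟩
  have hC0 : 0 ≤ C := le_trans (by positivity) (hC 0)
  set c := ε₀ / 2 with hc
  have hc0 : 0 < c := by positivity
  have hmeas : ∀ ε : ℝ, AEStronglyMeasurable
      (fun x => (Real.fourierChar (-inner ℝ x ξ) : ℂ) * (ψ (ε • x) * f x)) := fun ε => by
    refine AEStronglyMeasurable.mul (Continuous.aestronglyMeasurable ?_)
      (AEStronglyMeasurable.mul (Continuous.aestronglyMeasurable (by fun_prop)) hf.1)
    exact continuous_subtype_val.comp (Real.continuous_fourierChar.comp (by fun_prop))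
  have hg : Integrable (fun x : Plane => (1 + ‖c • x‖) ^ (-(3 : ℝ))) := by
    have h3 : Integrable (fun x : Plane => (1 + ‖x‖) ^ (-(3 : ℝ))) :=
      integrable_one_add_norm (by simp; norm_num)
    exact h3.comp_smul hc0.ne'
  refine continuousAt_of_dominated
    (bound := fun x => C * ((1 + ‖c • x‖) ^ (-(3 : ℝ)) + ‖f x‖ ^ p.toReal)) ?_ ?_ ?_ ?_
  · exact Eventually.of_forall hmeas
  · filter_upwards [lt_mem_nhds (show c < ε₀ by linarith)] with ε hε
    refine ae_of_all _ fun x => ?_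
    rw [norm_mul, Circle.norm_coe, one_mul, norm_mul]
    set G := (1 + ‖c • x‖) ^ (-(3 : ℝ)) with hG
    have hG1 : G ≤ 1 := Real.rpow_le_one_of_one_le_of_nonpos (by linarith [norm_nonneg (c • x)])
      (by norm_num)
    have hG0 : 0 ≤ G := by positivity
    have hψ : ‖ψ (ε • x)‖ ≤ C * G := by
      have h1 : (1 + ‖c • x‖) ^ 3 ≤ (1 + ‖ε • x‖) ^ 3 := by
        rw [norm_smul, norm_smul, Real.norm_of_nonneg hc0.le,
          Real.norm_of_nonneg (hc0.trans hε).le]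
        gcongr
      have h2 := (mul_le_mul_of_nonneg_right h1 (norm_nonneg (ψ (ε • x)))).trans (hC (ε • x))
      rw [hG, Real.rpow_neg (by positivity), ← div_eq_mul_inv, le_div_iff₀ (by positivity)]
      rw [mul_comm]
      exact_mod_cast h2
    -- With the decay (1 + ‖c x‖)^{-3}, uniform over the scales above c = ε₀/2, this yields a single
    -- integrable majorant; the power 3 exceeds the dimension.
    have hff : ‖f x‖ ≤ 1 + ‖f x‖ ^ p.toReal := by
      rcases le_total ‖f x‖ 1 with h | h
      · have : 0 ≤ ‖f x‖ ^ p.toReal := by positivity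
        linarith
      · have := Real.rpow_le_rpow_of_exponent_le h hp1'
        rw [Real.rpow_one] at this
        linarith
    have hr : 0 ≤ ‖f x‖ ^ p.toReal := by positivity
    calc ‖ψ (ε • x)‖ * ‖f x‖ ≤ (C * G) * (1 + ‖f x‖ ^ p.toReal) := by gcongr
      _ = C * (G + G * ‖f x‖ ^ p.toReal) := by ring
      _ ≤ C * (G + 1 * ‖f x‖ ^ p.toReal) := by gcongr
      _ = _ := by rw [one_mul]
  · exact (hg.add (hf.integrable_norm_rpow hp0 hp)).const_mul C
  · refine ae_of_all _ fun x => ?_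
    have : Continuous fun ε : ℝ => ψ (ε • x) := ψ.continuous.comp (by fun_prop)
    exact (continuous_const.mul (this.mul continuous_const)).continuousAt

theorem continuousAt_regularizedFourier (χ : 𝓢(Plane, ℂ)) {p : ℝ≥0∞} (hp1 : 1 ≤ p)
    (hp : p ≠ ∞) {f : Plane → ℂ} (hf : MemLp f p) (ξ : Plane) {ε₀ : ℝ} (hε₀ : 0 < ε₀) :
    ContinuousAt (fun ε : ℝ => regularizedFourier χ ε f ξ) ε₀ := by
  simp only [regularizedFourier_eq_integral]
  exact SchwartzMap.continuousAt_integral_dilate_mul _ hp1 hp hf ξ hε₀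

/-- A dense sequence of positive scales. -/
noncomputable def denseScale (n : ℕ) : ℝ := (TopologicalSpace.denseSeq (Set.Ioi (0 : ℝ)) n : ℝ)

theorem denseScale_pos (n : ℕ) : 0 < denseScale n :=
  (TopologicalSpace.denseSeq (Set.Ioi (0 : ℝ)) n).2

/-- The averages are continuous in ε > 0, so a countable dense set of scales controls all of them.
The supremum stays measurable and no exceptional null set depends on ε. -/
theorem enorm_regularizedFourier_le_fourierMaximal (χ : 𝓢(Plane, ℂ)) {p : ℝ≥0∞} (hp1 : 1 ≤ p)
    (hp : p ≠ ∞) {f : Plane → ℂ} (hf : MemLp f p) (ξ : Plane) {ε : ℝ} (hε : 0 < ε) :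
    ‖regularizedFourier χ ε f ξ‖ₑ ≤ fourierMaximal χ denseScale f ξ := by
  have hcont : Continuous fun δ : Set.Ioi (0 : ℝ) => ‖regularizedFourier χ δ f ξ‖ₑ := by
    refine continuous_enorm.comp (continuous_iff_continuousAt.2 fun δ => ?_)
    exact (continuousAt_regularizedFourier χ hp1 hp hf ξ δ.2).comp
      continuous_subtype_val.continuousAt
  have hclosed := isClosed_le hcont (continuous_const (y := fourierMaximal χ denseScale f ξ))
  have hsub : Set.range (TopologicalSpace.denseSeq (Set.Ioi (0 : ℝ))) ⊆
      {δ : Set.Ioi (0 : ℝ) |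
        ‖regularizedFourier χ δ f ξ‖ₑ ≤ fourierMaximal χ denseScale f ξ} := by
    rintro _ ⟨n, rfl⟩
    exact le_iSup (fun n => ‖regularizedFourier χ (denseScale n) f ξ‖ₑ) n
  have := hclosed.closure_subset_iff.2 hsub
  rw [(TopologicalSpace.denseRange_denseSeq (Set.Ioi (0 : ℝ))).closure_range] at this
  exact this (Set.mem_univ (⟨ε, hε⟩ : Set.Ioi (0 : ℝ)))

theorem SchwartzMap.fourierInv_zero (χ : 𝓢(Plane, ℂ)) :
    (𝓕⁻ χ : 𝓢(Plane, ℂ)) 0 = ∫ x, χ x := by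
  rw [SchwartzMap.fourierInv_coe, Real.fourierInv_eq]
  simp

/-- As ε → 0 the multiplier 𝓕⁻ χ (εx) tends boundedly to (𝓕⁻ χ)(0) = ∫ χ = 1. -/
theorem tendsto_regularizedFourier (χ : 𝓢(Plane, ℂ)) (hχ : ∫ x, χ x = 1) {w : Plane → ℂ}
    (hw : Integrable w) (ξ : Plane) :
    Tendsto (fun ε : ℝ => regularizedFourier χ ε w ξ) (𝓝[>] 0) (𝓝 (𝓕 w ξ)) := by
  simp only [regularizedFourier_eq_integral]
  have h0 := χ.fourierInv_zero
  rw [hχ] at h0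
  rw [Real.fourier_eq]
  generalize (𝓕⁻ χ : 𝓢(Plane, ℂ)) = ψ at *
  obtain ⟨B, hBpos, hB⟩ := ψ.exists_norm_le
  have hF : Continuous fun x : Plane => (Real.fourierChar (-inner ℝ x ξ) : ℂ) :=
    continuous_subtype_val.comp (Real.continuous_fourierChar.comp
      (by fun_prop : Continuous fun x : Plane => -inner ℝ x ξ))
  refine tendsto_integral_filter_of_dominated_convergence (fun x => B * ‖w x‖) ?_ ?_
    (hw.norm.const_mul B) ?_
  · refine Eventually.of_forall fun ε => ?_
    exact hF.aestronglyMeasurable.mul (integrable_dilate_mul ψ hw ε).1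
  · refine Eventually.of_forall fun ε => ae_of_all _ fun x => ?_
    rw [norm_mul, Circle.norm_coe, one_mul, norm_mul]
    gcongr
    exact hB _
  · refine ae_of_all _ fun x => ?_
    have hc : Continuous fun ε : ℝ => (Real.fourierChar (-inner ℝ x ξ) : ℂ) * (ψ (ε • x) * w x) :=
      continuous_const.mul ((ψ.continuous.comp (by fun_prop)).mul continuous_const)
    have := hc.tendsto 0
    rw [zero_smul, h0, one_mul] at this
    exact this.mono_left nhdsWithin_le_nhds

theorem SchwartzMap.exists_eLpNorm_sub_le_two_pow {p : ℝ≥0∞} (hp1 : 1 ≤ p) (hp : p ≠ ∞)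
    {f : Plane → ℂ} (hf : MemLp f p) :
    ∃ φ : ℕ → 𝓢(Plane, ℂ), ∀ n, eLpNorm (f - ⇑(φ n)) p ≤ 2⁻¹ ^ n := by
  have h : ∀ n : ℕ, ∃ φ : 𝓢(Plane, ℂ), eLpNorm (f - ⇑φ) p ≤ 2⁻¹ ^ n := fun n => by
    obtain ⟨g, hg₁, hg₂, hg₃⟩ := MemLp.exist_eLpNorm_sub_le hp hp1 hf
      (show (0 : ℝ) < 2⁻¹ ^ n by positivity)
    refine ⟨hg₁.toSchwartzMap hg₂, hg₃.trans (le_of_eq ?_)⟩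
    rw [ENNReal.ofReal_pow (by positivity), ENNReal.ofReal_inv_of_pos (by norm_num),
      ENNReal.ofReal_ofNat]
  exact ⟨fun n => (h n).choose, fun n => (h n).choose_spec⟩

/-- On a finite measure space L^q norms control L¹ norms, so the sum of the g_n is integrable and
hence finite almost everywhere. The whole sequence converges, without passing to a subsequence. -/
theorem ae_tendsto_zero_of_eLpNorm_le_two_pow {α : Type*} [MeasurableSpace α] {μ : Measure α}
    [IsFiniteMeasure μ] {q : ℝ≥0∞} (hq : 1 ≤ q) {C : ℝ≥0} {g : ℕ → α → ℝ≥0∞}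
    (hgm : ∀ n, AEMeasurable (g n) μ) (hg : ∀ n, eLpNorm (g n) q μ ≤ C * 2⁻¹ ^ n) :
    ∀ᵐ x ∂μ, Tendsto (fun n => g n x) atTop (𝓝 0) := by
  have hfin : μ Set.univ ^ (1 / (1 : ℝ≥0∞).toReal - 1 / q.toReal) ≠ ∞ := by
    refine ENNReal.rpow_ne_top_of_nonneg ?_ (measure_ne_top _ _)
    rw [ENNReal.toReal_one, sub_nonneg]
    by_cases hqt : q = ∞
    · simp [hqt]
    · refine one_div_le_one_div_of_le one_pos ?_
      rw [← ENNReal.toReal_one]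
      exact (ENNReal.toReal_le_toReal (by simp) hqt).2 hq
  set M := μ Set.univ ^ (1 / (1 : ℝ≥0∞).toReal - 1 / q.toReal) with hM
  have h1 : ∀ n, ∫⁻ x, g n x ∂μ ≤ C * 2⁻¹ ^ n * M := fun n => by
    have := eLpNorm_le_eLpNorm_mul_rpow_measure_univ hq (hgm n).aestronglyMeasurable
    rw [eLpNorm_one_eq_lintegral_enorm] at this
    exact this.trans (mul_le_mul_left (hg n) _)
  have h2 : ∫⁻ x, ∑' n, g n x ∂μ ≠ ∞ := by
    rw [lintegral_tsum hgm]
    refine ((ENNReal.tsum_le_tsum h1).trans_lt ?_).ne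
    rw [ENNReal.tsum_mul_right, ENNReal.tsum_mul_left, ENNReal.tsum_geometric]
    refine ENNReal.mul_lt_top (ENNReal.mul_lt_top ENNReal.coe_lt_top ?_) hfin.lt_top
    simp
  filter_upwards [ae_lt_top' (AEMeasurable.tsum hgm) h2] with x hx
  exact ENNReal.tendsto_atTop_zero_of_tsum_ne_top hx.ne

/-- Interchange of limits under uniform approximation. -/
theorem exists_tendsto_of_edist_le {α E : Type*} [PseudoEMetricSpace E] [CompleteSpace E]
    {l : Filter α} [l.NeBot] {r : α → E} {s : ℕ → α → E} {a : ℕ → E} {M : ℕ → ℝ≥0∞}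
    (hM : Tendsto M atTop (𝓝 0)) (hs : ∀ n, Tendsto (s n) l (𝓝 (a n)))
    (hrs : ∀ n, ∀ᶠ x in l, edist (r x) (s n x) ≤ M n) :
    ∃ c, Tendsto a atTop (𝓝 c) ∧ Tendsto r l (𝓝 c) := by
  have hcauchy : CauchySeq a := by
    rw [EMetric.cauchySeq_iff]
    intro η hη
    obtain ⟨N, hN⟩ := eventually_atTop.1 (hM.eventually (gt_mem_nhds (ENNReal.half_pos hη.ne')))
    refine ⟨N, fun m hm n hn => ?_⟩
    refine lt_of_le_of_lt ?_ ((ENNReal.add_lt_add (hN m hm) (hN n hn)).trans_eq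
      (ENNReal.add_halves η))
    refine le_of_tendsto ((hs m).edist (hs n)) ?_
    filter_upwards [hrs m, hrs n] with x h1 h2
    exact (edist_triangle_left _ _ (r x)).trans (add_le_add h1 h2)
  obtain ⟨c, hc⟩ := cauchySeq_tendsto_of_complete hcauchy
  refine ⟨c, hc, ?_⟩
  rw [EMetric.tendsto_nhds]
  intro η hη
  have hη3 : 0 < η / 3 := ENNReal.div_pos hη.ne' (by simp)
  obtain ⟨n, hn1, hn2⟩ := ((hM.eventually (gt_mem_nhds hη3)).and
    (EMetric.tendsto_nhds.1 hc _ hη3)).exists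
  filter_upwards [hrs n, EMetric.tendsto_nhds.1 (hs n) _ hη3] with x hx h3
  calc _ ≤ edist (r x) (s n x) + edist (s n x) (a n) + edist (a n) c := edist_triangle4 _ _ _ _
    _ < η / 3 + η / 3 + η / 3 :=
        ENNReal.add_lt_add (ENNReal.add_lt_add (hx.trans_lt hn1) h3) hn2
    _ = η := ENNReal.add_thirds η

theorem edist_regularizedFourier_le (χ : 𝓢(Plane, ℂ)) {p : ℝ≥0∞} (hp1 : 1 ≤ p) (hp : p ≠ ∞)
    {f g : Plane → ℂ} (hf : MemLp f p) (hg : MemLp g p) (ξ : Plane) {ε : ℝ} (hε : 0 < ε) :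
    edist (regularizedFourier χ ε f ξ) (regularizedFourier χ ε g ξ)
      ≤ fourierMaximal χ denseScale (f - g) ξ := by
  have h1 := integrable_dilate_mul_memLp (𝓕⁻ χ : 𝓢(Plane, ℂ)) hp1 hf hε
  have h2 := integrable_dilate_mul_memLp (𝓕⁻ χ : 𝓢(Plane, ℂ)) hp1 hg hε
  rw [edist_eq_enorm_sub, ← regularizedFourier_sub χ ε h1 h2 ξ]
  exact enorm_regularizedFourier_le_fourierMaximal χ hp1 hp (hf.sub hg) ξ hε

theorem exists_tendsto_regularizedFourier (χ : 𝓢(Plane, ℂ)) (hχ : ∫ x, χ x = 1) {p : ℝ≥0∞}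
    (hp1 : 1 ≤ p) (hp : p ≠ ∞) {f : Plane → ℂ} (hf : MemLp f p) {φ : ℕ → 𝓢(Plane, ℂ)} {ξ : Plane}
    (hφ : Tendsto (fun n => fourierMaximal χ denseScale (f - ⇑(φ n)) ξ) atTop (𝓝 0)) :
    ∃ c, Tendsto (fun n => 𝓕 (φ n : Plane → ℂ) ξ) atTop (𝓝 c) ∧
      Tendsto (fun ε : ℝ => regularizedFourier χ ε f ξ) (𝓝[>] 0) (𝓝 c) := by
  refine exists_tendsto_of_edist_le hφ
    (fun n => tendsto_regularizedFourier χ hχ (φ n).integrable ξ) fun n => ?_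
  filter_upwards [self_mem_nhdsWithin] with ε hε
  exact edist_regularizedFourier_le χ hp1 hp hf ((φ n).memLp p) ξ hε

namespace PlaneCurve

variable {Γ : ℝ → Plane} {I : Set ℝ}

theorem continuousOn_kappa (hI : UniqueDiffOn ℝ I) (hΓ : ContDiffOn ℝ 2 Γ I) :
    ContinuousOn (kappa Γ I) I := by
  have hVdiff : ContDiffOn ℝ 1 (velocity Γ I) I := hΓ.derivWithin hI (by norm_num)
  have hVc : ContinuousOn (velocity Γ I) I := hVdiff.continuousOn
  have hAc : ContinuousOn (acceleration Γ I) I := hVdiff.continuousOn_derivWithin hI le_rfl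
  have c : ∀ i : Fin 2, Continuous (fun v : Plane => v i) := fun i => by fun_prop
  exact (((c 0).comp_continuousOn hVc).mul ((c 1).comp_continuousOn hAc)).sub
    (((c 1).comp_continuousOn hVc).mul ((c 0).comp_continuousOn hAc))

/-- Interior curved points have compact interval neighbourhoods made of curved points, since `kappa`
is continuous. An exceptional set that is locally null is null, and the end points of I carry no
arclength. -/
theorem ae_curvedArclength_of_forall_isCompact (hI : I.OrdConnected) (hΓ : ContDiffOn ℝ 2 Γ I)
    {P : ℝ → Prop} (h : ∀ K, IsCompact K → K ⊆ curvedSet Γ I →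
      ∀ᵐ t ∂((curvedArclength Γ I).restrict K), P t) :
    ∀ᵐ t ∂(curvedArclength Γ I), P t := by
  have hac : arclength Γ I ≪ volume.restrict I := withDensity_absolutelyContinuous _ _
  have hint : ∀ᵐ t ∂(arclength Γ I), t ∈ interior I := by
    refine hac.ae_le ?_
    have hnull : volume (I \ interior I) = 0 :=
      measure_mono_null (Set.sdiff_subset_sdiff_left subset_closure)
        (hI.convex.addHaar_frontier volume)
    change volume.restrict I {t | ¬ t ∈ interior I} = 0
    rw [Measure.restrict_apply₀']
    · exact measure_mono_null (fun t ht => Set.mem_sdiff_of_mem ht.2 ht.1) hnull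
    · exact hI.measurableSet.nullMeasurableSet
  have hcov : ∀ t₀ ∈ curvedSet Γ I ∩ interior I, ∃ δ > 0,
      Set.Icc (t₀ - δ) (t₀ + δ) ⊆ curvedSet Γ I := by
    intro t₀ ht₀
    have hU := uniqueDiffOn_of_mem_curvedSet hI ht₀.1
    have hn : I ∈ 𝓝 t₀ := mem_interior_iff_mem_nhds.1 ht₀.2
    have hev : ∀ᶠ t in 𝓝 t₀, kappa Γ I t ≠ 0 :=
      ((continuousOn_kappa hU hΓ).continuousAt hn).eventually_ne ht₀.1.2
    obtain ⟨δ, hδ, hs⟩ := Metric.nhds_basis_closedBall.mem_iff.1 (inter_mem hn hev)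
    rw [Real.closedBall_eq_Icc] at hs
    exact ⟨δ, hδ, fun t ht => hs ht⟩
  have hmem : ∀ᵐ t ∂(curvedArclength Γ I), t ∈ interior I := ae_restrict_of_ae hint
  set N := {t | ¬ P t} ∩ (curvedSet Γ I ∩ interior I) with hN
  have hN0 : curvedArclength Γ I N = 0 := by
    refine measure_null_of_locally_null _ fun t₀ ht₀ => ?_
    obtain ⟨δ, hδ, hs⟩ := hcov t₀ ht₀.2
    refine ⟨N ∩ Set.Icc (t₀ - δ) (t₀ + δ), inter_mem self_mem_nhdsWithin
      (mem_nhdsWithin_of_mem_nhds (Icc_mem_nhds (by linarith) (by linarith))), ?_⟩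
    have := h _ isCompact_Icc hs
    rw [ae_iff, Measure.restrict_apply₀' measurableSet_Icc.nullMeasurableSet] at this
    exact measure_mono_null (Set.inter_subset_inter_left _ Set.inter_subset_left) this
  have hcs : ∀ᵐ t ∂(curvedArclength Γ I), t ∈ curvedSet Γ I := by
    have hm : MeasurableSet (curvedSet Γ I) := by
      rcases Set.eq_empty_or_nonempty (curvedSet Γ I) with he | ⟨t₀, ht₀⟩
      · rw [he]; exact MeasurableSet.empty
      · have hU := uniqueDiffOn_of_mem_curvedSet hI ht₀
        obtain ⟨V, hV, hVeq⟩ := continuousOn_iff'.1 (continuousOn_kappa hU hΓ) {0}ᶜ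
          isOpen_compl_singleton
        have : curvedSet Γ I = V ∩ I := by
          rw [← hVeq]
          ext t
          exact and_comm
        rw [this]
        exact hV.measurableSet.inter hI.measurableSet
    exact ae_restrict_mem hm
  filter_upwards [hmem, hcs, (measure_eq_zero_iff_ae_notMem.1 hN0)] with t h1 h2 h3
  by_contra hP
  exact h3 ⟨hP, h2, h1⟩

/-- Schwartz approximations of `f` are close to `f` in the sense of the maximal function at almost
every point of the curve. -/
theorem ae_tendsto_fourierMaximal_sub (hI : I.OrdConnected) (hΓ : ContDiffOn ℝ 2 Γ I)
    (χ : 𝓢(Plane, ℂ)) {p q : ℝ≥0∞} (hp1 : 1 ≤ p) (hp : p < 4 / 3) (hq : 1 ≤ q)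
    (hpq : 3 * q ≤ p.conjExponent) {f : Plane → ℂ} (hf : MemLp f p) {φ : ℕ → 𝓢(Plane, ℂ)}
    (hφ : ∀ n, eLpNorm (f - ⇑(φ n)) p ≤ 2⁻¹ ^ n) :
    ∀ᵐ t ∂(curvedArclength Γ I),
      Tendsto (fun n => fourierMaximal χ denseScale (f - ⇑(φ n)) (Γ t)) atTop (𝓝 0) := by
  refine ae_curvedArclength_of_forall_isCompact hI hΓ fun K hK hKs => ?_
  obtain ⟨C, hC⟩ := exists_eLpNorm_fourierMaximal_le hI hΓ χ hp1 hp hpq hK hKs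
  have : IsFiniteMeasure ((curvedArclength Γ I).restrict K) :=
    ⟨by rw [Measure.restrict_apply_univ]; exact curvedArclength_lt_top_of_isCompact hI hΓ hK hKs⟩
  have hm : ∀ n, MemLp (f - ⇑(φ n)) p := fun n => hf.sub ((φ n).memLp p)
  refine ae_tendsto_zero_of_eLpNorm_le_two_pow hq (C := C) (fun n => ?_) fun n => ?_
  · exact (measurable_fourierMaximal χ _ fun k =>
      integrable_dilate_mul_memLp _ hp1 (hm n) (denseScale_pos k)).comp_aemeasurable
      ((aemeasurable_curve hI hΓ.continuousOn).mono_measure Measure.restrict_le_self)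
  · exact (hC _ denseScale_pos _ (hm n)).trans (mul_le_mul_right (hφ n) _)

end PlaneCurve

/-! ### Existence of the restriction operator and identification of the limit. -/

theorem SchwartzMap.exists_nonneg_bump : ∃ (χ : 𝓢(Plane, ℂ)) (θ : Plane → ℝ) (c : ℝ), 0 < c ∧
    (∀ x, χ x = θ x) ∧ (∀ x, 0 ≤ θ x) ∧ (∀ x, ‖x‖ ≤ 1 → c ≤ θ x) ∧ ∫ x, χ x = 1 := by
  let b : ContDiffBump (0 : Plane) := ⟨1, 2, one_pos, one_lt_two⟩
  have hint : 0 < ∫ x, b x := b.integral_pos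
  have hsupp : HasCompactSupport fun x => ((b.normed volume x : ℝ) : ℂ) :=
    (b.hasCompactSupport_normed (μ := volume)).comp_left (g := fun r : ℝ => (r : ℂ)) (by simp)
  have hsmooth : ContDiff ℝ (⊤ : ℕ∞) fun x => ((b.normed volume x : ℝ) : ℂ) :=
    Complex.ofRealCLM.contDiff.comp b.contDiff_normed
  refine ⟨hsupp.toSchwartzMap hsmooth, b.normed volume, (∫ x, b x)⁻¹, by positivity,
    fun x => rfl, fun x => b.nonneg_normed x, fun x hx => ?_, ?_⟩
  · rw [ContDiffBump.normed, b.one_of_mem_closedBall (by simpa [b] using hx), one_div]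
  · change ∫ x, ((b.normed volume x : ℝ) : ℂ) = 1
    rw [integral_complex_ofReal, b.integral_normed, Complex.ofReal_one]

namespace PlaneCurve

variable {Γ : ℝ → Plane} {I : Set ℝ}

/-- The regularizations of the Fourier transform of an `L^p` function converge almost everywhere on
the curve. -/
theorem exists_ae_tendsto_regularizedFourier (hI : I.OrdConnected) (hΓ : ContDiffOn ℝ 2 Γ I)
    (χ : 𝓢(Plane, ℂ)) (hχ : ∫ x, χ x = 1) {p q : ℝ≥0∞} (hp1 : 1 ≤ p) (hp : p < 4 / 3) (hq : 1 ≤ q)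
    (hpq : 3 * q ≤ p.conjExponent) {f : Plane → ℂ} (hf : MemLp f p) :
    ∃ g : ℝ →ₘ[curvedArclength Γ I] ℂ, ∀ᵐ t ∂(curvedArclength Γ I),
      Tendsto (fun ε : ℝ => regularizedFourier χ ε f (Γ t)) (𝓝[>] 0) (𝓝 (g t)) := by
  have hpt : p ≠ ∞ := (hp.trans (by finiteness)).ne
  obtain ⟨φ, hφ⟩ := SchwartzMap.exists_eLpNorm_sub_le_two_pow hp1 hpt hf
  have hlim : ∀ᵐ t ∂(curvedArclength Γ I), ∃ c,
      Tendsto (fun ε : ℝ => regularizedFourier χ ε f (Γ t)) (𝓝[>] 0) (𝓝 c) := by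
    filter_upwards [ae_tendsto_fourierMaximal_sub hI hΓ χ hp1 hp hq hpq hf hφ] with t ht
    obtain ⟨c, -, hc⟩ := exists_tendsto_regularizedFourier χ hχ hp1 hpt hf ht
    exact ⟨c, hc⟩
  obtain ⟨ε, -, hεpos, hε0⟩ := exists_seq_strictAnti_tendsto (0 : ℝ)
  have hεlim : Tendsto ε atTop (𝓝[>] 0) :=
    tendsto_nhdsWithin_iff.2 ⟨hε0, Eventually.of_forall hεpos⟩
  have hmeas : ∀ n, AEMeasurable (fun t => regularizedFourier χ (ε n) f (Γ t))
      (curvedArclength Γ I) := fun n =>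
    (continuous_regularizedFourier χ (ε n)
      (integrable_dilate_mul_memLp _ hp1 hf (hεpos n))).measurable.comp_aemeasurable
      (aemeasurable_curve hI hΓ.continuousOn)
  obtain ⟨g, hgm, hg⟩ := measurable_limit_of_tendsto_metrizable_ae (L := atTop) hmeas
    (hlim.mono fun t ht => ⟨ht.choose, ht.choose_spec.comp hεlim⟩)
  refine ⟨AEEqFun.mk g hgm.aestronglyMeasurable, ?_⟩
  filter_upwards [hlim, hg, AEEqFun.coeFn_mk g hgm.aestronglyMeasurable] with t ⟨c, hc⟩ h2 h3
  rw [h3, tendsto_nhds_unique h2 (hc.comp hεlim)]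
  exact hc

theorem exists_isRestrictionOperator (hI : I.OrdConnected) (hΓ : ContDiffOn ℝ 2 Γ I)
    {p q : ℝ≥0∞} [Fact (1 ≤ p)] (hp : p < 4 / 3) (hq : 1 ≤ q) (hpq : 3 * q ≤ p.conjExponent) :
    ∃ R, IsRestrictionOperator Γ I p q R := by
  have hp1 : 1 ≤ p := Fact.out
  have hpt : p ≠ ∞ := (hp.trans (by finiteness)).ne
  obtain ⟨χ, -, -, -, -, -, -, hχ⟩ := SchwartzMap.exists_nonneg_bump
  -- The operator is defined as the almost everywhere limit of the averages for one fixed χ.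
  -- Linearity and the values on Schwartz functions follow from uniqueness of limits, boundedness
  -- from the maximal inequality.
  choose! g hg using fun f : Lp ℂ p (volume : Measure Plane) =>
    exists_ae_tendsto_regularizedFourier hI hΓ χ hχ hp1 hp hq hpq (Lp.memLp f)
  have hint : ∀ (f : Lp ℂ p (volume : Measure Plane)) (ε : ℝ), 0 < ε →
      Integrable (fun x => (𝓕⁻ χ : 𝓢(Plane, ℂ)) (ε • x) * f x) := fun f ε hε =>
    integrable_dilate_mul_memLp _ hp1 (Lp.memLp f) hε
  have hadd : ∀ f₁ f₂, g (f₁ + f₂) = g f₁ + g f₂ := fun f₁ f₂ => by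
    refine AEEqFun.ext ?_
    filter_upwards [hg (f₁ + f₂), hg f₁, hg f₂, AEEqFun.coeFn_add (g f₁) (g f₂)] with t h h₁ h₂ hs
    rw [hs]
    refine tendsto_nhds_unique h ((h₁.add h₂).congr' ?_)
    filter_upwards [self_mem_nhdsWithin] with ε hε
    rw [← regularizedFourier_add χ ε (hint f₁ ε hε) (hint f₂ ε hε),
      regularizedFourier_congr_ae χ ε (Lp.coeFn_add f₁ f₂)]
  have hsmul : ∀ (c : ℂ) f, g (c • f) = c • g f := fun c f => by
    refine AEEqFun.ext ?_
    filter_upwards [hg (c • f), hg f, AEEqFun.coeFn_smul c (g f)] with t h h₁ hs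
    rw [hs]
    refine tendsto_nhds_unique h ((h₁.const_mul c).congr fun ε => ?_)
    rw [← regularizedFourier_smul, regularizedFourier_congr_ae χ ε (Lp.coeFn_smul c f)]
  refine ⟨⟨⟨g, hadd⟩, hsmul⟩, fun φ => ?_, fun K hK hKs => ?_⟩
  · filter_upwards [hg (φ.toLp p)] with t ht
    refine tendsto_nhds_unique ht ?_
    rw [SchwartzMap.fourier_coe]
    refine (tendsto_regularizedFourier χ hχ φ.integrable (Γ t)).congr fun ε => ?_
    exact (regularizedFourier_congr_ae χ ε (φ.coeFn_toLp p) (Γ t)).symm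
  · obtain ⟨C, hC⟩ := exists_eLpNorm_fourierMaximal_le hI hΓ χ hp1 hp hpq hK hKs
    refine ⟨C, fun f => ?_⟩
    rw [Lp.enorm_def]
    refine le_trans ?_ (hC denseScale denseScale_pos f (Lp.memLp f))
    refine eLpNorm_mono_enorm_ae (ae_restrict_of_ae ?_)
    filter_upwards [hg f] with t ht
    rw [enorm_eq_self]
    refine le_of_tendsto ht.enorm ?_
    filter_upwards [self_mem_nhdsWithin] with ε hε
    exact enorm_regularizedFourier_le_fourierMaximal χ hp1 hpt (Lp.memLp f) _ hε

/-- The bound for R applied to f − φ_n is summable in n. This identifies Rf almost everywhere as a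
limit which does not involve R, so all restriction operators agree. -/
theorem IsRestrictionOperator.ae_tendsto_fourier (hI : I.OrdConnected) (hΓ : ContDiffOn ℝ 2 Γ I)
    {p q : ℝ≥0∞} [Fact (1 ≤ p)] (hq : 1 ≤ q)
    {R : Lp ℂ p (volume : Measure Plane) →ₗ[ℂ] (ℝ →ₘ[curvedArclength Γ I] ℂ)}
    (hR : IsRestrictionOperator Γ I p q R) (f : Lp ℂ p (volume : Measure Plane))
    {φ : ℕ → 𝓢(Plane, ℂ)} (hφ : ∀ n, eLpNorm ((f : Plane → ℂ) - ⇑(φ n)) p ≤ 2⁻¹ ^ n) :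
    ∀ᵐ t ∂(curvedArclength Γ I),
      Tendsto (fun n => 𝓕 (φ n : Plane → ℂ) (Γ t)) atTop (𝓝 (R f t)) := by
  refine ae_curvedArclength_of_forall_isCompact hI hΓ fun K hK hKs => ?_
  obtain ⟨C, hC⟩ := hR.bounded K hK hKs
  have : IsFiniteMeasure ((curvedArclength Γ I).restrict K) :=
    ⟨by rw [Measure.restrict_apply_univ]; exact curvedArclength_lt_top_of_isCompact hI hΓ hK hKs⟩
  have h0 : ∀ᵐ t ∂((curvedArclength Γ I).restrict K),
      Tendsto (fun n => ‖R (f - (φ n).toLp p volume) t‖ₑ) atTop (𝓝 0) := by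
    refine ae_tendsto_zero_of_eLpNorm_le_two_pow hq (C := C) (fun n => ?_) fun n => ?_
    · exact ((AEEqFun.stronglyMeasurable _).measurable.enorm).aemeasurable
    · rw [eLpNorm_enorm]
      refine (hC _).trans (mul_le_mul_right ?_ _)
      rw [Lp.enorm_def]
      refine le_trans (le_of_eq (eLpNorm_congr_ae ?_)) (hφ n)
      filter_upwards [Lp.coeFn_sub f ((φ n).toLp p), (φ n).coeFn_toLp p] with x h1 h2
      rw [h1, Pi.sub_apply, Pi.sub_apply, h2]
  have hsub : ∀ᵐ t ∂((curvedArclength Γ I).restrict K), ∀ n,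
      R (f - (φ n).toLp p volume) t = R f t - 𝓕 (φ n : Plane → ℂ) (Γ t) := by
    refine ae_all_iff.2 fun n => ae_restrict_of_ae ?_
    filter_upwards [hR.schwartz (φ n), AEEqFun.coeFn_sub (R f) (R ((φ n).toLp p))] with t h1 h2
    rw [map_sub, h2, Pi.sub_apply, h1, SchwartzMap.fourier_coe]
  filter_upwards [h0, hsub] with t h1 h2
  rw [tendsto_iff_edist_tendsto_0]
  refine h1.congr fun n => ?_
  rw [h2, edist_comm, edist_eq_enorm_sub]

theorem IsRestrictionOperator.ae_tendsto_regularizedFourier (hI : I.OrdConnected)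
    (hΓ : ContDiffOn ℝ 2 Γ I) {p q : ℝ≥0∞} [Fact (1 ≤ p)] (hp : p < 4 / 3) (hq : 1 ≤ q)
    (hpq : 3 * q ≤ p.conjExponent)
    {R : Lp ℂ p (volume : Measure Plane) →ₗ[ℂ] (ℝ →ₘ[curvedArclength Γ I] ℂ)}
    (hR : IsRestrictionOperator Γ I p q R) (f : Lp ℂ p (volume : Measure Plane))
    (χ : 𝓢(Plane, ℂ)) (hχ : ∫ x, χ x = 1) :
    ∀ᵐ t ∂(curvedArclength Γ I),
      Tendsto (fun ε : ℝ => regularizedFourier χ ε f (Γ t)) (𝓝[>] 0) (𝓝 (R f t)) := by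
  have hp1 : 1 ≤ p := Fact.out
  have hpt : p ≠ ∞ := (hp.trans (by finiteness)).ne
  obtain ⟨φ, hφ⟩ := SchwartzMap.exists_eLpNorm_sub_le_two_pow hp1 hpt (Lp.memLp f)
  filter_upwards [ae_tendsto_fourierMaximal_sub hI hΓ χ hp1 hp hq hpq (Lp.memLp f) hφ,
    hR.ae_tendsto_fourier hI hΓ hq f hφ] with t h1 h2
  obtain ⟨c, hc1, hc2⟩ := exists_tendsto_regularizedFourier χ hχ hp1 hpt (Lp.memLp f) h1
  rwa [tendsto_nhds_unique h2 hc1]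

end PlaneCurve

/-! ### Functions representing the distributional Fourier transform. -/

theorem isFourierTransform_iff {p : ℝ≥0∞} [Fact (1 ≤ p)] (f : Lp ℂ p (volume : Measure Plane))
    (F : Plane → ℂ) : IsFourierTransform f F ↔ ∀ φ : 𝓢(Plane, ℂ),
      Integrable (fun x => φ x * F x) ∧ ∫ x, (𝓕 φ) x * f x = ∫ x, φ x * F x := by
  simp only [IsFourierTransform, TemperedDistribution.fourier_apply,
    Lp.toTemperedDistribution_apply, smul_eq_mul]

theorem IsFourierTransform.ae_eq {p : ℝ≥0∞} [Fact (1 ≤ p)] {f : Lp ℂ p (volume : Measure Plane)}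
    {F G : Plane → ℂ} (hF : IsFourierTransform f F) (hG : IsFourierTransform f G) :
    F =ᵐ[volume] G :=
  ae_eq_of_forall_schwartz (fun φ => (hF φ).1) (fun φ => (hG φ).1)
    fun φ => (hF φ).2.symm.trans (hG φ).2

theorem SchwartzMap.isFourierTransform_toLp (ψ : 𝓢(Plane, ℂ)) (p : ℝ≥0∞) [Fact (1 ≤ p)] :
    IsFourierTransform (ψ.toLp p volume) (𝓕 (ψ : Plane → ℂ)) := by
  refine (isFourierTransform_iff _ _).2 fun φ => ⟨?_, ?_⟩
  · exact integrable_schwartz_mul_bounded φ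
      (continuous_fourier_of_integrable ψ.integrable).aestronglyMeasurable norm_fourier_le
  · rw [integral_schwartz_mul_fourier ψ.integrable]
    refine integral_congr_ae ?_
    filter_upwards [ψ.coeFn_toLp p volume] with x hx
    rw [hx]

theorem IsFourierTransform.sub {p : ℝ≥0∞} [Fact (1 ≤ p)] {f g : Lp ℂ p (volume : Measure Plane)}
    {F G : Plane → ℂ} (hF : IsFourierTransform f F) (hG : IsFourierTransform g G) :
    IsFourierTransform (f - g) (F - G) := by
  rw [isFourierTransform_iff] at hF hG ⊢
  intro φ
  have h1 : (fun x => φ x * (F - G) x) = fun x => φ x * F x - φ x * G x := by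
    ext x; simp [mul_sub]
  have hp1 : 1 ≤ p := Fact.out
  refine ⟨h1 ▸ (hF φ).1.sub (hG φ).1, ?_⟩
  rw [h1, integral_sub (hF φ).1 (hG φ).1, ← (hF φ).2, ← (hG φ).2,
    ← integral_sub (integrable_schwartz_mul_memLp _ hp1 (Lp.memLp f))
      (integrable_schwartz_mul_memLp _ hp1 (Lp.memLp g))]
  refine integral_congr_ae ?_
  filter_upwards [Lp.coeFn_sub f g] with x hx
  rw [hx, Pi.sub_apply, mul_sub]

/-- Read as a test function of y, the convolution kernel χ_ε(ξ − y) has Fourier transform e^{-2πi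
x·ξ} (𝓕⁻ χ)(εx). Inserted into the definition of the distributional transform, it turns the
convolution into the regularized transform. -/
theorem SchwartzMap.exists_dilate_sub (χ : 𝓢(Plane, ℂ)) {ε : ℝ} (hε : 0 < ε) (ξ : Plane) :
    ∃ φ : 𝓢(Plane, ℂ), (∀ y, φ y = dilate χ ε (ξ - y)) ∧
      ∀ x, (𝓕 φ) x = (Real.fourierChar (-inner ℝ x ξ) : ℂ) * (𝓕⁻ χ) (ε • x) := by
  obtain ⟨φ₀, hφ₀⟩ := χ.exists_dilation (neg_ne_zero.2 (inv_ne_zero hε.ne'))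
  have hφ : ∀ y, ((((ε ^ 2)⁻¹ : ℝ) : ℂ) • φ₀.compSubConstCLM ℂ ξ) y = dilate χ ε (ξ - y) := by
    intro y
    rw [_root_.smul_apply, SchwartzMap.compSubConstCLM_apply, hφ₀, dilate, smul_eq_mul,
      neg_smul, ← smul_neg, neg_sub]
  refine ⟨_, hφ, fun x => ?_⟩
  rw [SchwartzMap.fourier_coe, Real.fourier_eq, SchwartzMap.fourierInv_coe, Real.fourierInv_eq]
  simp only [hφ, Circle.smul_def, smul_eq_mul]
  rw [← integral_sub_left_eq_self _ volume ξ]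
  simp only [sub_sub_cancel]
  have h1 := Measure.integral_comp_smul (volume : Measure Plane)
    (fun z => (Real.fourierChar (-inner ℝ (ξ - z) x) : ℂ) * dilate χ ε z) ε
  have h2 : |(ε ^ Module.finrank ℝ Plane)⁻¹| = (ε ^ 2)⁻¹ := by
    rw [finrank_euclideanSpace_fin, abs_of_pos (by positivity)]
  rw [h2, eq_inv_smul_iff₀ (by positivity)] at h1
  rw [← h1, ← integral_smul, ← integral_const_mul]
  refine integral_congr_ae (ae_of_all _ fun z => ?_)
  have h3 : -inner ℝ (ξ - ε • z) x = -inner ℝ x ξ + inner ℝ z (ε • x) := by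
    rw [inner_sub_left, real_inner_smul_left, real_inner_smul_right, real_inner_comm x ξ]
    ring
  have h4 : (ε : ℂ) ≠ 0 := by exact_mod_cast hε.ne'
  simp only [dilate, h3, AddChar.map_add_eq_mul, Circle.coe_mul, smul_smul,
    inv_mul_cancel₀ hε.ne', one_smul, Complex.real_smul]
  push_cast
  field_simp

/-- The convolution of the Fourier transform with a dilated Schwartz function is the regularized
Fourier transform. -/
theorem IsFourierTransform.convolution_dilate {p : ℝ≥0∞} [Fact (1 ≤ p)]
    {f : Lp ℂ p (volume : Measure Plane)} {F : Plane → ℂ} (hF : IsFourierTransform f F)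
    (χ : 𝓢(Plane, ℂ)) {ε : ℝ} (hε : 0 < ε) (ξ : Plane) :
    convolution F (dilate χ ε) (ContinuousLinearMap.mul ℂ ℂ) volume ξ
      = regularizedFourier χ ε f ξ := by
  obtain ⟨φ, hφ, hφF⟩ := χ.exists_dilate_sub hε ξ
  have h := ((isFourierTransform_iff f F).1 hF φ).2
  rw [convolution_def, regularizedFourier_eq_integral]
  simp only [ContinuousLinearMap.mul_apply']
  simp only [hφ, hφF] at h
  simp only [mul_comm (F _), ← h, mul_assoc]

/-- The Fourier transform of an `L^p` function, `1 ≤ p ≤ 2`, is the sum of a bounded and a square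
integrable function, the transforms of the parts where the function is large and small. -/
theorem exists_fourier_decomposition {p : ℝ≥0∞} [Fact (1 ≤ p)] (hp : p ≤ 2)
    (f : Lp ℂ p (volume : Measure Plane)) : ∃ G₁ G₂ : Plane → ℂ, IsFourierTransform f (G₁ + G₂) ∧
      (∀ ξ, ‖G₁ ξ‖ₑ ≤ ∫⁻ x, ‖f x‖ₑ ^ p.toReal) ∧ AEStronglyMeasurable G₂ ∧
      ∫⁻ ξ, ‖G₂ ξ‖ₑ ^ (2 : ℝ) ≤ ∫⁻ x, ‖f x‖ₑ ^ p.toReal := by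
  have hp1 : 1 ≤ p := Fact.out
  have hpt : p ≠ ∞ := (hp.trans_lt (by simp)).ne
  have hp0 : p ≠ 0 := (zero_lt_one.trans_le hp1).ne'
  have hr1 : 1 ≤ p.toReal := by
    rw [← ENNReal.toReal_one]
    exact (ENNReal.toReal_le_toReal (by simp) hpt).2 hp1
  have hr2 : p.toReal ≤ 2 := by
    have := (ENNReal.toReal_le_toReal hpt (by simp)).2 hp
    simpa using this
  have hfm := (Lp.stronglyMeasurable f).measurable
  have hfin : ∫⁻ x, ‖f x‖ₑ ^ p.toReal < ∞ :=
    (lintegral_rpow_enorm_lt_top_of_eLpNorm_lt_top hp0 hpt (Lp.memLp f).2)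
  -- Cutting at height 1 gives |f₁| ≤ |f|^p and |f₂|² ≤ |f|^p, because 1 ≤ p ≤ 2.
  set s : Set Plane := {x | 1 ≤ ‖f x‖ₑ} with hs
  have hsm : MeasurableSet s := measurableSet_le measurable_const hfm.enorm
  set f₁ : Plane → ℂ := s.indicator f with hf₁
  set f₂ : Plane → ℂ := sᶜ.indicator f with hf₂
  have hf₁m : Measurable f₁ := hfm.indicator hsm
  have hf₂m : Measurable f₂ := hfm.indicator hsm.compl
  have hle₁ : ∀ x, ‖f₁ x‖ₑ ≤ ‖f x‖ₑ ^ p.toReal := fun x => by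
    by_cases hx : x ∈ s
    · rw [hf₁, Set.indicator_of_mem hx]
      exact ENNReal.le_rpow_self_of_one_le hx hr1
    · rw [hf₁, Set.indicator_of_notMem hx]
      simp
  have hle₂ : ∀ x, ‖f₂ x‖ₑ ^ (2 : ℝ) ≤ ‖f x‖ₑ ^ p.toReal := fun x => by
    by_cases hx : x ∈ s
    · rw [hf₂, Set.indicator_of_notMem (by simpa using hx)]
      simp
    · rw [hf₂, Set.indicator_of_mem (by simpa using hx)]
      exact ENNReal.rpow_le_rpow_of_exponent_ge (not_le.1 hx).le hr2
  have hint₁ : Integrable f₁ := ⟨hf₁m.aestronglyMeasurable, (lintegral_mono hle₁).trans_lt hfin⟩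
  have hmem₂ : MemLp f₂ 2 := by
    refine ⟨hf₂m.aestronglyMeasurable, ?_⟩
    refine (eLpNorm_lt_top_iff_lintegral_rpow_enorm_lt_top two_ne_zero ENNReal.ofNat_ne_top).2 ?_
    simpa using (lintegral_mono hle₂).trans_lt hfin
  refine ⟨𝓕 f₁, (𝓕 (hmem₂.toLp f₂) : Lp ℂ 2 (volume : Measure Plane)), ?_, fun ξ => ?_,
    Lp.aestronglyMeasurable _, ?_⟩
  · have hint2 : ∀ φ : 𝓢(Plane, ℂ), Integrable fun x =>
        φ x * (𝓕 (hmem₂.toLp f₂) : Lp ℂ 2 (volume : Measure Plane)) x := fun φ =>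
      integrable_schwartz_mul_memLp φ one_le_two (Lp.memLp _)
    have hint1 : ∀ φ : 𝓢(Plane, ℂ), Integrable fun x => φ x * 𝓕 f₁ x := fun φ =>
      integrable_schwartz_mul_bounded φ
        (continuous_fourier_of_integrable hint₁).aestronglyMeasurable norm_fourier_le
    refine (isFourierTransform_iff _ _).2 fun φ => ?_
    simp only [Pi.add_apply, mul_add]
    refine ⟨(hint1 φ).add (hint2 φ), ?_⟩
    have h1 := Lp.toTemperedDistribution_apply (𝓕 (hmem₂.toLp f₂)) φ
    rw [← Lp.fourier_toTemperedDistribution_eq, TemperedDistribution.fourier_apply,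
      Lp.toTemperedDistribution_apply] at h1
    simp only [smul_eq_mul] at h1
    rw [integral_add (hint1 φ) (hint2 φ), ← h1, integral_schwartz_mul_fourier hint₁,
      ← integral_add]
    · refine integral_congr_ae ?_
      filter_upwards [hmem₂.coeFn_toLp] with x hx
      rw [hx, ← mul_add, hf₁, hf₂, ← Pi.add_apply, Set.indicator_self_add_compl]
    · exact integrable_schwartz_mul_memLp _ le_rfl (memLp_one_iff_integrable.2 hint₁)
    · exact integrable_schwartz_mul_memLp _ one_le_two (Lp.memLp _)
  · refine le_trans ?_ (lintegral_mono hle₁)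
    rw [Real.fourier_eq]
    refine (enorm_integral_le_lintegral_enorm _).trans (lintegral_mono fun x => ?_)
    rw [Circle.smul_def, enorm_smul, ← ofReal_norm (_ : ℂ), Circle.norm_coe, ENNReal.ofReal_one,
      one_mul]
  · refine le_trans (le_of_eq ?_) (lintegral_mono hle₂)
    have h2 : ∀ F : Plane → ℂ, ∫⁻ x, ‖F x‖ₑ ^ (2 : ℝ) = eLpNorm F 2 volume ^ (2 : ℝ) := fun F => by
      rw [eLpNorm_eq_lintegral_rpow_enorm_toReal two_ne_zero ENNReal.ofNat_ne_top,
        ← ENNReal.rpow_mul]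
      simp
    rw [h2, h2, ← eLpNorm_congr_ae hmem₂.coeFn_toLp, ← Lp.enorm_def, ← Lp.enorm_def,
      ← ofReal_norm, ← ofReal_norm, Lp.norm_fourier_eq]

/-- The Fourier transforms of rapidly converging Schwartz approximations converge almost
everywhere. -/
theorem IsFourierTransform.ae_tendsto {p : ℝ≥0∞} [Fact (1 ≤ p)] (hp : p ≤ 2)
    {f : Lp ℂ p (volume : Measure Plane)} {F : Plane → ℂ} (hF : IsFourierTransform f F)
    {φ : ℕ → 𝓢(Plane, ℂ)} (hφ : ∀ n, eLpNorm ((f : Plane → ℂ) - ⇑(φ n)) p ≤ 2⁻¹ ^ n) :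
    ∀ᵐ y, Tendsto (fun n => 𝓕 (φ n : Plane → ℂ) y) atTop (𝓝 (F y)) := by
  have hp1 : 1 ≤ p := Fact.out
  have hpt : p ≠ ∞ := (hp.trans_lt (by simp)).ne
  have hp0 : p ≠ 0 := (zero_lt_one.trans_le hp1).ne'
  have hr1 : 1 ≤ p.toReal := by
    rw [← ENNReal.toReal_one]
    exact (ENNReal.toReal_le_toReal (by simp) hpt).2 hp1
  -- Since (2^{-n})^p ≤ 2^{-n}, the p-th powers of the errors are summable. The bounded parts then
  -- tend to 0 uniformly, and the squares of the others have an integrable sum.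
  have hnorm : ∀ n, ∫⁻ x, ‖(f - (φ n).toLp p volume : Lp ℂ p (volume : Measure Plane)) x‖ₑ ^ p.toReal
      ≤ 2⁻¹ ^ n := fun n => by
    have h1 : (∫⁻ x, ‖(f - (φ n).toLp p volume : Lp ℂ p (volume : Measure Plane)) x‖ₑ ^ p.toReal)
        ^ (1 / p.toReal) ≤ 2⁻¹ ^ n := by
      rw [← eLpNorm_eq_lintegral_rpow_enorm_toReal hp0 hpt]
      refine le_trans (le_of_eq (eLpNorm_congr_ae ?_)) (hφ n)
      filter_upwards [Lp.coeFn_sub f ((φ n).toLp p volume), (φ n).coeFn_toLp p volume] with x h1 h2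
      rw [h1, Pi.sub_apply, Pi.sub_apply, h2]
    rw [one_div, ENNReal.rpow_inv_le_iff (by linarith)] at h1
    refine h1.trans (ENNReal.rpow_le_self_of_le_one ?_ hr1)
    exact pow_le_one₀ (by simp) (by simp)
  choose G₁ G₂ hG hG₁ hG₂m hG₂ using fun n =>
    exists_fourier_decomposition hp (f - (φ n).toLp p volume)
  have hae : ∀ᵐ y, ∀ n, F y - 𝓕 (φ n : Plane → ℂ) y = G₁ n y + G₂ n y :=
    ae_all_iff.2 fun n => (hF.sub ((φ n).isFourierTransform_toLp p)).ae_eq (hG n)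
  have hG₂0 : ∀ᵐ y, Tendsto (fun n => ‖G₂ n y‖ₑ ^ (2 : ℝ)) atTop (𝓝 0) := by
    have hm : ∀ n, AEMeasurable fun y => ‖G₂ n y‖ₑ ^ (2 : ℝ) := fun n =>
      (hG₂m n).enorm.pow_const _
    have h2 : ∫⁻ y, ∑' n, ‖G₂ n y‖ₑ ^ (2 : ℝ) ≠ ∞ := by
      rw [lintegral_tsum hm]
      refine ((ENNReal.tsum_le_tsum fun n => (hG₂ n).trans (hnorm n)).trans_lt ?_).ne
      rw [ENNReal.tsum_geometric]
      simp
    filter_upwards [ae_lt_top' (AEMeasurable.tsum hm) h2] with x hx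
    exact ENNReal.tendsto_atTop_zero_of_tsum_ne_top hx.ne
  filter_upwards [hae, hG₂0] with y h1 h2
  have h3 : Tendsto (fun n => ‖G₂ n y‖ₑ) atTop (𝓝 0) := by
    have := (ENNReal.continuous_rpow_const (y := (2 : ℝ)⁻¹)).tendsto 0 |>.comp h2
    rw [ENNReal.zero_rpow_of_pos (by norm_num)] at this
    refine this.congr fun n => ?_
    simp only [Function.comp]
    rw [ENNReal.rpow_rpow_inv (by norm_num)]
  have h4 : Tendsto (fun n => ‖G₁ n y‖ₑ) atTop (𝓝 0) :=
    tendsto_of_tendsto_of_tendsto_of_le_of_le tendsto_const_nhds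
      (ENNReal.tendsto_pow_atTop_nhds_zero_of_lt_one (by simp))
      (fun _ => zero_le) fun n => (hG₁ n y).trans (hnorm n)
  rw [tendsto_iff_edist_tendsto_0]
  refine tendsto_of_tendsto_of_tendsto_of_le_of_le tendsto_const_nhds
    (by simpa using h4.add h3) (fun _ => zero_le) fun n => ?_
  rw [edist_comm, edist_eq_enorm_sub, h1]
  exact enorm_add_le _ _

/-! ### Autocorrelations, quadratic means and Lebesgue points. -/

/-- Young's convolution inequality for two functions in the same `L^p` space. -/
theorem lintegral_convolution_rpow_le {a b : Plane → ℝ≥0∞} (ha : Measurable a) (hb : Measurable b)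
    {p : ℝ} (hp1 : 1 ≤ p) (hp2 : p < 2) :
    ∫⁻ z, (∫⁻ t, a t * b (z - t)) ^ (p / (2 - p))
      ≤ (∫⁻ x, a x ^ p) ^ (1 / (2 - p)) * (∫⁻ x, b x ^ p) ^ (1 / (2 - p)) := by
  have h2p : 0 < 2 - p := by linarith
  have hp0 : 0 < p := by linarith
  set A := ∫⁻ x, a x ^ p with hA
  set B := ∫⁻ x, b x ^ p with hB
  have hbz : ∀ z, Measurable fun t => b (z - t) := fun z => hb.comp (by fun_prop)
  have hBz : ∀ z, ∫⁻ t, b (z - t) ^ p = B := fun z =>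
    lintegral_sub_left_eq_self (fun t => b t ^ p) z
  have hpt : ∀ c : ℝ≥0∞, c ^ (2 - p) * c ^ (p - 1) = c := fun c => by
    rw [← ENNReal.rpow_add_of_nonneg _ _ h2p.le (by linarith)]
    norm_num
  have hholder : ∀ z, ∫⁻ t, a t * b (z - t) ≤
      (∫⁻ t, a t ^ p * b (z - t) ^ p) ^ ((2 - p) / p) * (A ^ ((p - 1) / p) * B ^ ((p - 1) / p)) := by
    intro z
    -- Hölder for three factors with exponents (2 − p)/p, (p − 1)/p, (p − 1)/p, which sum to 1. Only
    -- the first factor still depends on z once t is integrated out.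
    have h := ENNReal.lintegral_prod_norm_pow_le (μ := (volume : Measure Plane))
      (Finset.univ : Finset (Fin 3))
      (f := ![fun t => a t ^ p * b (z - t) ^ p, fun t => a t ^ p, fun t => b (z - t) ^ p])
      (p := ![(2 - p) / p, (p - 1) / p, (p - 1) / p]) ?_ ?_ ?_
    · simp only [Fin.prod_univ_three] at h
      refine le_trans (le_of_eq (lintegral_congr fun t => ?_)) (h.trans (le_of_eq ?_))
      · simp only [Matrix.cons_val_zero, Matrix.cons_val_one, Matrix.cons_val]
        rw [ENNReal.mul_rpow_of_nonneg _ _ (by positivity), ← ENNReal.rpow_mul, ← ENNReal.rpow_mul,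
          ← ENNReal.rpow_mul, ← ENNReal.rpow_mul, mul_div_cancel₀ _ hp0.ne',
          mul_div_cancel₀ _ hp0.ne']
        calc a t * b (z - t) = (a t ^ (2 - p) * a t ^ (p - 1)) *
              (b (z - t) ^ (2 - p) * b (z - t) ^ (p - 1)) := by rw [hpt, hpt]
          _ = _ := by ring
      · simp only [Matrix.cons_val_zero, Matrix.cons_val_one, Matrix.cons_val]
        rw [hBz, mul_assoc]
    · intro i _
      fin_cases i
      · exact ((ha.pow_const p).mul ((hbz z).pow_const p)).aemeasurable
      · exact (ha.pow_const p).aemeasurable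
      · exact ((hbz z).pow_const p).aemeasurable
    · simp only [Fin.sum_univ_three, Matrix.cons_val_zero, Matrix.cons_val_one, Matrix.cons_val]
      field_simp
      ring
    · intro i _
      fin_cases i
      · exact div_nonneg h2p.le hp0.le
      · exact div_nonneg (by linarith) hp0.le
      · exact div_nonneg (by linarith) hp0.le
  have hswap : ∫⁻ z, ∫⁻ t, a t ^ p * b (z - t) ^ p = A * B := by
    rw [lintegral_lintegral_swap]
    · have hinner : ∀ t, ∫⁻ z, a t ^ p * b (z - t) ^ p = a t ^ p * B := fun t => by
        have hbt : Measurable fun z => b (z - t) ^ p := (hb.comp (by fun_prop)).pow_const p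
        rw [lintegral_const_mul _ hbt, lintegral_sub_right_eq_self (fun z => b z ^ p) t]
      simp only [hinner]
      rw [lintegral_mul_const _ (ha.pow_const p)]
    · exact ((((ha.comp measurable_snd).pow_const p).mul
        ((hb.comp (measurable_fst.sub measurable_snd)).pow_const p))).aemeasurable
  have hM : Measurable fun z => ∫⁻ t, a t ^ p * b (z - t) ^ p :=
    Measurable.lintegral_prod_right' (f := fun w : Plane × Plane => a w.2 ^ p * b (w.1 - w.2) ^ p)
      (((ha.comp measurable_snd).pow_const p).mul
        ((hb.comp (measurable_fst.sub measurable_snd)).pow_const p))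
  calc ∫⁻ z, (∫⁻ t, a t * b (z - t)) ^ (p / (2 - p))
      ≤ ∫⁻ z, ((∫⁻ t, a t ^ p * b (z - t) ^ p) ^ ((2 - p) / p) *
          (A ^ ((p - 1) / p) * B ^ ((p - 1) / p))) ^ (p / (2 - p)) :=
        lintegral_mono fun z => ENNReal.rpow_le_rpow (hholder z) (by positivity)
    _ = ∫⁻ z, (∫⁻ t, a t ^ p * b (z - t) ^ p) *
          (A ^ ((p - 1) / (2 - p)) * B ^ ((p - 1) / (2 - p))) := by
        refine lintegral_congr fun z => ?_
        rw [ENNReal.mul_rpow_of_nonneg _ _ (by positivity), ← ENNReal.rpow_mul,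
          ENNReal.mul_rpow_of_nonneg _ _ (by positivity), ← ENNReal.rpow_mul, ← ENNReal.rpow_mul]
        rw [show (2 - p) / p * (p / (2 - p)) = 1 by field_simp, ENNReal.rpow_one,
          show (p - 1) / p * (p / (2 - p)) = (p - 1) / (2 - p) by field_simp]
    _ = (A * A ^ ((p - 1) / (2 - p))) * (B * B ^ ((p - 1) / (2 - p))) := by
        rw [lintegral_mul_const _ hM, hswap]
        ring
    _ = _ := by
        have h1 : ∀ c : ℝ≥0∞, c * c ^ ((p - 1) / (2 - p)) = c ^ (1 / (2 - p)) := fun c => by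
          nth_rewrite 1 [← ENNReal.rpow_one c]
          rw [← ENNReal.rpow_add_of_nonneg _ _ zero_le_one
            (div_nonneg (by linarith) h2p.le)]
          congr 1
          field_simp
          ring
        rw [h1, h1]

/-- The autocorrelation of a Schwartz function `ψ`: its Fourier transform is `|ψ̂|²`. -/
theorem SchwartzMap.exists_autocorrelation (ψ : 𝓢(Plane, ℂ)) :
    ∃ k : 𝓢(Plane, ℂ), (∀ ξ, 𝓕 (k : Plane → ℂ) ξ = ((‖𝓕 (ψ : Plane → ℂ) ξ‖ ^ 2 : ℝ) : ℂ)) ∧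
      ∀ p : ℝ, 1 ≤ p → p < 2 →
        ∫⁻ x, ‖k x‖ₑ ^ (p / (2 - p)) ≤ (∫⁻ x, ‖ψ x‖ₑ ^ p) ^ (2 / (2 - p)) := by
  obtain ⟨ψ₁, hψ₁⟩ := ψ.exists_dilation (ε := -1) (by norm_num)
  obtain ⟨ψ₂, hψ₂⟩ : ∃ ψ₂ : 𝓢(Plane, ℂ), ∀ x, ψ₂ x = starRingEnd ℂ (ψ (-x)) :=
    ⟨SchwartzMap.postcompCLM (Complex.conjCLE : ℂ →L[ℝ] ℂ) ψ₁, fun x => by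
      have : SchwartzMap.postcompCLM (Complex.conjCLE : ℂ →L[ℝ] ℂ) ψ₁ x
        = starRingEnd ℂ (ψ₁ x) := rfl
      rw [this, hψ₁, neg_one_smul]⟩
  have hF₂ : ∀ ξ, 𝓕 (ψ₂ : Plane → ℂ) ξ = starRingEnd ℂ (𝓕 (ψ : Plane → ℂ) ξ) := fun ξ => by
    rw [Real.fourier_eq, Real.fourier_eq, ← integral_conj, ← integral_neg_eq_self]
    refine integral_congr_ae (ae_of_all _ fun x => ?_)
    simp only [hψ₂, neg_neg, Circle.smul_def, smul_eq_mul, map_mul, inner_neg_left,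
      ← Circle.coe_inv_eq_conj, ← AddChar.map_neg_eq_inv]
  refine ⟨SchwartzMap.convolution (ContinuousLinearMap.mul ℂ ℂ) ψ ψ₂, fun ξ => ?_,
    fun p hp1 hp2 => ?_⟩
  · rw [← SchwartzMap.fourier_coe, SchwartzMap.fourier_convolution]
    simp only [SchwartzMap.pairing_apply_apply, ContinuousLinearMap.mul_apply',
      SchwartzMap.fourier_coe, hF₂]
    rw [Complex.mul_conj, Complex.normSq_eq_norm_sq]
  · have hm : Measurable fun x => ‖ψ x‖ₑ := ψ.continuous.measurable.enorm
    have hm₂ : Measurable fun x => ‖ψ₂ x‖ₑ := ψ₂.continuous.measurable.enorm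
    have h2p : 0 < 2 - p := by linarith
    have hnorm : ∀ x, ‖ψ₂ x‖ₑ = ‖ψ (-x)‖ₑ := fun x => by
      rw [hψ₂, ← ofReal_norm, RCLike.norm_conj, ofReal_norm]
    calc _ ≤ ∫⁻ z, (∫⁻ t, ‖ψ t‖ₑ * ‖ψ₂ (z - t)‖ₑ) ^ (p / (2 - p)) := by
          refine lintegral_mono fun z => ENNReal.rpow_le_rpow ?_ (by positivity)
          rw [SchwartzMap.convolution_apply, convolution_def]
          refine (enorm_integral_le_lintegral_enorm _).trans (lintegral_mono fun t => ?_)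
          rw [ContinuousLinearMap.mul_apply', enorm_mul]
      _ ≤ _ := lintegral_convolution_rpow_le hm hm₂ hp1 hp2
      _ = _ := by
          have : ∫⁻ x, ‖ψ₂ x‖ₑ ^ p = ∫⁻ x, ‖ψ x‖ₑ ^ p := by
            simp only [hnorm]
            exact lintegral_neg_eq_self (fun x => ‖ψ x‖ₑ ^ p)
          rw [this, ← ENNReal.rpow_add_of_nonneg _ _ (by positivity) (by positivity)]
          congr 1
          field_simp
          norm_num

/-- The transform of the autocorrelation k is |ψ̂|² ≥ 0 and the bump is nonnegative. No cancellation
occurs, so the modulus of the average of k̂ is exactly the weighted quadratic mean. -/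
theorem lintegral_mul_bump_eq {χ : 𝓢(Plane, ℂ)} {θ : Plane → ℝ} (hχ : ∀ x, χ x = θ x)
    (hθ : ∀ x, 0 ≤ θ x) {ψ k : 𝓢(Plane, ℂ)}
    (hk : ∀ ξ, 𝓕 (k : Plane → ℂ) ξ = ((‖𝓕 (ψ : Plane → ℂ) ξ‖ ^ 2 : ℝ) : ℂ)) {ε : ℝ} (hε : 0 < ε)
    (ξ : Plane) :
    ∫⁻ y, ‖𝓕 (ψ : Plane → ℂ) y‖ₑ ^ (2 : ℝ) * ENNReal.ofReal (θ (ε⁻¹ • (ξ - y)))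
      = ENNReal.ofReal (ε ^ 2) * ‖regularizedFourier χ ε k ξ‖ₑ := by
  have hFc : Continuous (𝓕 (ψ : Plane → ℂ)) := continuous_fourier_of_integrable ψ.integrable
  have hθc : Continuous θ := by
    have : θ = fun x => (χ x).re := by ext x; simp [hχ]
    rw [this]
    exact Complex.continuous_re.comp χ.continuous
  have h0 : regularizedFourier χ ε k ξ
      = ((∫ y, θ y * ‖𝓕 (ψ : Plane → ℂ) (ξ - ε • y)‖ ^ 2 : ℝ) : ℂ) := by
    rw [regularizedFourier, fourier_fourierInv_smul_mul χ k.integrable, ← integral_complex_ofReal]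
    refine integral_congr_ae (ae_of_all _ fun y => ?_)
    simp only [hk, hχ]
    push_cast
    ring
  have hnn : ∀ y, 0 ≤ θ y * ‖𝓕 (ψ : Plane → ℂ) (ξ - ε • y)‖ ^ 2 := fun y =>
    mul_nonneg (hθ y) (by positivity)
  have hint : Integrable fun y => θ y * ‖𝓕 (ψ : Plane → ℂ) (ξ - ε • y)‖ ^ 2 := by
    have := (integrable_schwartz_mul_bounded χ (F := fun y => 𝓕 (k : Plane → ℂ) (ξ - ε • y))
      (((continuous_fourier_of_integrable k.integrable).comp (by fun_prop)).aestronglyMeasurable)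
      (fun y => norm_fourier_le _)).re
    refine this.congr (ae_of_all _ fun y => ?_)
    simp only [hk, hχ, ← Complex.ofReal_mul]
    rfl
  have h1 : ‖regularizedFourier χ ε k ξ‖ₑ
      = ∫⁻ y, ENNReal.ofReal (θ y) * ‖𝓕 (ψ : Plane → ℂ) (ξ - ε • y)‖ₑ ^ (2 : ℝ) := by
    rw [h0, ← ofReal_norm, Complex.norm_real, Real.norm_of_nonneg (integral_nonneg hnn),
      ofReal_integral_eq_lintegral_ofReal hint (ae_of_all _ hnn)]
    refine lintegral_congr fun y => ?_
    rw [ENNReal.ofReal_mul (hθ y), ← ofReal_norm, ENNReal.ofReal_pow (norm_nonneg _)]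
    norm_cast
  have h2 := lintegral_comp_sub_smul
    (G := fun y => ‖𝓕 (ψ : Plane → ℂ) y‖ₑ ^ (2 : ℝ) * ENNReal.ofReal (θ (ε⁻¹ • (ξ - y))))
    ((hFc.measurable.enorm.pow_const _).mul
      (ENNReal.measurable_ofReal.comp (hθc.comp (by fun_prop)).measurable)) ξ hε
  simp only [sub_sub_cancel, smul_smul, inv_mul_cancel₀ hε.ne', one_smul] at h2
  rw [h1]
  simp only [mul_comm (ENNReal.ofReal (θ _))]
  rw [h2, ← mul_assoc, ← ENNReal.ofReal_mul (by positivity),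
    mul_inv_cancel₀ (by positivity), ENNReal.ofReal_one, one_mul]

theorem lintegral_ball_sq_le {θ : Plane → ℝ} {c : ℝ} (hc : 0 < c)
    (hθc : ∀ x, ‖x‖ ≤ 1 → c ≤ θ x) (H : Plane → ℂ) {ε : ℝ} (hε : 0 < ε) (ξ : Plane) :
    ∫⁻ y in Metric.ball ξ ε, ‖H y‖ₑ ^ (2 : ℝ)
      ≤ ENNReal.ofReal c⁻¹ * ∫⁻ y, ‖H y‖ₑ ^ (2 : ℝ) * ENNReal.ofReal (θ (ε⁻¹ • (ξ - y))) := by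
  rw [← lintegral_const_mul' _ _ ENNReal.ofReal_ne_top]
  refine le_trans ?_ (setLIntegral_le_lintegral (Metric.ball ξ ε) _)
  refine setLIntegral_mono' measurableSet_ball fun y hy => ?_
  have h1 : ‖ε⁻¹ • (ξ - y)‖ ≤ 1 := by
    rw [norm_smul, norm_inv, Real.norm_of_nonneg hε.le, inv_mul_le_one₀ hε]
    rw [Metric.mem_ball', dist_eq_norm] at hy
    exact hy.le
  have h2 : 1 ≤ ENNReal.ofReal c⁻¹ * ENNReal.ofReal (θ (ε⁻¹ • (ξ - y))) := by
    rw [← ENNReal.ofReal_mul (by positivity), ← ENNReal.ofReal_one]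
    refine ENNReal.ofReal_le_ofReal ?_
    calc (1 : ℝ) = c⁻¹ * c := (inv_mul_cancel₀ hc.ne').symm
      _ ≤ _ := mul_le_mul_of_nonneg_left (hθc _ h1) (by positivity)
  calc ‖H y‖ₑ ^ (2 : ℝ) = ‖H y‖ₑ ^ (2 : ℝ) * 1 := (mul_one _).symm
    _ ≤ ‖H y‖ₑ ^ (2 : ℝ) *
        (ENNReal.ofReal c⁻¹ * ENNReal.ofReal (θ (ε⁻¹ • (ξ - y)))) := mul_le_mul_right h2 _
    _ = _ := by ring

/-- Averages over discs are controlled by mean squares against a bump function. -/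
theorem laverage_ball_enorm_le {θ : Plane → ℝ} {c : ℝ} (hc : 0 < c)
    (hθc : ∀ x, ‖x‖ ≤ 1 → c ≤ θ x) {H : Plane → ℂ} (hH : AEStronglyMeasurable H) {ε : ℝ}
    (hε : 0 < ε) (ξ : Plane) {U : ℝ≥0∞}
    (hU : ∫⁻ y, ‖H y‖ₑ ^ (2 : ℝ) * ENNReal.ofReal (θ (ε⁻¹ • (ξ - y))) ≤ ENNReal.ofReal (ε ^ 2) * U) :
    (volume (Metric.ball ξ ε))⁻¹ * ∫⁻ y in Metric.ball ξ ε, ‖H y‖ₑ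
      ≤ (ENNReal.ofReal c⁻¹ * U) ^ ((1 : ℝ) / 2) := by
  set V := volume (Metric.ball ξ ε) with hV
  have hVeq : V = ENNReal.ofReal (ε ^ 2) * ENNReal.ofReal Real.pi := by
    rw [hV, EuclideanSpace.volume_ball_fin_two, ENNReal.ofReal_pow hε.le]
  have hV0 : V ≠ 0 := by rw [hVeq]; positivity
  have hVt : V ≠ ∞ := by rw [hVeq]; finiteness
  -- The area is πε² and π ≥ 1; the factor π is simply given away.
  have hεV : ENNReal.ofReal (ε ^ 2) ≤ V := by
    rw [hVeq]
    refine le_mul_of_one_le_right' ?_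
    rw [← ENNReal.ofReal_one]
    exact ENNReal.ofReal_le_ofReal (by linarith [Real.pi_gt_three])
  have h1 : ∫⁻ y in Metric.ball ξ ε, ‖H y‖ₑ
      ≤ (∫⁻ y in Metric.ball ξ ε, ‖H y‖ₑ ^ (2 : ℝ)) ^ ((1 : ℝ) / 2) * V ^ ((1 : ℝ) / 2) := by
    have := eLpNorm_le_eLpNorm_mul_rpow_measure_univ (p := 1) (q := 2) one_le_two
      (hH.restrict (s := Metric.ball ξ ε))
    rw [eLpNorm_one_eq_lintegral_enorm, eLpNorm_eq_lintegral_rpow_enorm_toReal two_ne_zero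
      ENNReal.ofNat_ne_top, Measure.restrict_apply_univ] at this
    simp only [ENNReal.toReal_ofNat, ENNReal.toReal_one] at this
    convert this using 3
    norm_num
  have h2 : ∫⁻ y in Metric.ball ξ ε, ‖H y‖ₑ ^ (2 : ℝ) ≤ (ENNReal.ofReal c⁻¹ * U) * V := by
    refine (lintegral_ball_sq_le hc hθc H hε ξ).trans ?_
    refine (mul_le_mul_right (hU.trans (mul_le_mul_left hεV U)) _).trans (le_of_eq ?_)
    ring
  calc _ ≤ V⁻¹ * (((ENNReal.ofReal c⁻¹ * U) * V) ^ ((1 : ℝ) / 2) * V ^ ((1 : ℝ) / 2)) := by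
        refine mul_le_mul_right (h1.trans (mul_le_mul_left ?_ _)) _
        exact ENNReal.rpow_le_rpow h2 (by norm_num)
    _ = (ENNReal.ofReal c⁻¹ * U) ^ ((1 : ℝ) / 2) * (V⁻¹ * (V ^ ((1 : ℝ) / 2) * V ^ ((1 : ℝ) / 2))) := by
        rw [ENNReal.mul_rpow_of_nonneg _ V (by norm_num)]
        ring
    _ = _ := by
        rw [← ENNReal.rpow_add_of_nonneg _ _ (by norm_num) (by norm_num)]
        norm_num
        rw [ENNReal.inv_mul_cancel hV0 hVt, mul_one]

theorem tendsto_laverage_ball_of_continuous {g : Plane → ℂ} (hg : Continuous g) (ξ : Plane) :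
    Tendsto (fun ε : ℝ => (volume (Metric.ball ξ ε))⁻¹ *
      ∫⁻ y in Metric.ball ξ ε, ‖g y - g ξ‖ₑ) (𝓝[>] 0) (𝓝 0) := by
  rw [ENNReal.tendsto_nhds_zero]
  intro η hη
  have hc : Tendsto (fun y => ‖g y - g ξ‖ₑ) (𝓝 ξ) (𝓝 0) := by
    have : Continuous fun y => ‖g y - g ξ‖ₑ := by fun_prop
    simpa using this.tendsto ξ
  obtain ⟨δ, hδ, hball⟩ := Metric.eventually_nhds_iff_ball.1 (ENNReal.tendsto_nhds_zero.1 hc η hη)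
  filter_upwards [Ioo_mem_nhdsGT hδ] with ε hε
  have hV0 : volume (Metric.ball ξ ε) ≠ 0 := (Metric.measure_ball_pos volume ξ hε.1).ne'
  calc _ ≤ (volume (Metric.ball ξ ε))⁻¹ * ∫⁻ _ in Metric.ball ξ ε, η := by
        refine mul_le_mul_right (setLIntegral_mono' measurableSet_ball fun y hy => ?_) _
        exact hball y (Metric.ball_subset_ball hε.2.le hy)
    _ = η := by
        rw [setLIntegral_const, mul_comm η, ← mul_assoc,
          ENNReal.inv_mul_cancel hV0 measure_ball_lt_top.ne, one_mul]

/-- A criterion for Lebesgue points by approximation with continuous functions. -/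
theorem isLebesguePointWithValue_of_approx {F : Plane → ℂ} (hF : AEStronglyMeasurable F)
    {g : ℕ → Plane → ℂ} (hg : ∀ n, Continuous (g n)) {ξ : Plane} {c : ℂ}
    (hgc : Tendsto (fun n => g n ξ) atTop (𝓝 c)) {M : ℕ → ℝ≥0∞} (hM : Tendsto M atTop (𝓝 0))
    (hFg : ∀ n, ∀ ε : ℝ, 0 < ε → (volume (Metric.ball ξ ε))⁻¹ *
      ∫⁻ y in Metric.ball ξ ε, ‖F y - g n y‖ₑ ≤ M n) :
    IsLebesguePointWithValue F ξ c := by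
  have hkey : Tendsto (fun ε : ℝ => (volume (Metric.ball ξ ε))⁻¹ *
      ∫⁻ y in Metric.ball ξ ε, ‖F y - c‖ₑ) (𝓝[>] 0) (𝓝 0) := by
    rw [ENNReal.tendsto_nhds_zero]
    intro η hη
    have hη3 : 0 < η / 3 := ENNReal.div_pos hη.ne' (by simp)
    have hgc' := tendsto_iff_edist_tendsto_0.1 hgc
    obtain ⟨n, hn1, hn2⟩ := ((ENNReal.tendsto_nhds_zero.1 hM _ hη3).and
      (ENNReal.tendsto_nhds_zero.1 hgc' _ hη3)).exists
    filter_upwards [self_mem_nhdsWithin, ENNReal.tendsto_nhds_zero.1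
      (tendsto_laverage_ball_of_continuous (hg n) ξ) _ hη3] with ε hε h3
    have hε' : 0 < ε := hε
    have hV0 : volume (Metric.ball ξ ε) ≠ 0 := (Metric.measure_ball_pos volume ξ hε').ne'
    have hVt : volume (Metric.ball ξ ε) ≠ ∞ := measure_ball_lt_top.ne
    set V := volume (Metric.ball ξ ε) with hV
    have hm1 : AEMeasurable (fun y => ‖F y - g n y‖ₑ) (volume.restrict (Metric.ball ξ ε)) :=
      (hF.sub (hg n).aestronglyMeasurable).enorm.restrict
    have hm2 : Measurable fun y => ‖g n y - g n ξ‖ₑ :=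
      ((hg n).measurable.sub_const _).enorm
    calc V⁻¹ * ∫⁻ y in Metric.ball ξ ε, ‖F y - c‖ₑ
        ≤ V⁻¹ * ∫⁻ y in Metric.ball ξ ε, (‖F y - g n y‖ₑ + (‖g n y - g n ξ‖ₑ + ‖g n ξ - c‖ₑ)) := by
          refine mul_le_mul_right (lintegral_mono fun y => ?_) _
          refine (le_of_eq ?_).trans ((enorm_add_le _ _).trans
            (add_le_add le_rfl (enorm_add_le _ _)))
          congr 1
          ring
      _ = V⁻¹ * (∫⁻ y in Metric.ball ξ ε, ‖F y - g n y‖ₑ)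
            + (V⁻¹ * (∫⁻ y in Metric.ball ξ ε, ‖g n y - g n ξ‖ₑ) + ‖g n ξ - c‖ₑ) := by
          rw [lintegral_add_left' hm1, lintegral_add_left hm2, setLIntegral_const, ← hV, mul_add,
            mul_add, mul_comm ‖g n ξ - c‖ₑ, ← mul_assoc V⁻¹ V, ENNReal.inv_mul_cancel hV0 hVt,
            one_mul]
      _ ≤ η / 3 + (η / 3 + η / 3) := by
          refine add_le_add ((hFg n ε hε').trans hn1) (add_le_add h3 ?_)
          rw [← edist_eq_enorm_sub]
          exact hn2
      _ = η := by rw [← add_assoc, ENNReal.add_thirds]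
  have hreal := (ENNReal.continuousAt_toReal ENNReal.zero_ne_top).tendsto.comp hkey
  rw [ENNReal.toReal_zero] at hreal
  refine hreal.congr fun ε => ?_
  simp only [Function.comp]
  have hm : AEStronglyMeasurable (fun y => F y - c) (volume.restrict (Metric.ball ξ ε)) :=
    (hF.sub aestronglyMeasurable_const).restrict
  rw [average_eq, integral_norm_eq_lintegral_enorm hm, ENNReal.toReal_mul, ENNReal.toReal_inv,
    smul_eq_mul]
  congr 2
  simp [Measure.real]

theorem SchwartzMap.eLpNorm_autocorrelation_le {p : ℝ≥0∞} (hp1 : 1 ≤ p) (hp2 : p < 2)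
    {ψ k : 𝓢(Plane, ℂ)}
    (hk : ∀ p : ℝ, 1 ≤ p → p < 2 →
        ∫⁻ x, ‖k x‖ₑ ^ (p / (2 - p)) ≤ (∫⁻ x, ‖ψ x‖ₑ ^ p) ^ (2 / (2 - p))) :
    eLpNorm k (ENNReal.ofReal (p.toReal / (2 - p.toReal))) ≤ eLpNorm ψ p ^ 2 := by
  have hpt : p ≠ ∞ := (hp2.trans (by simp)).ne
  have hr1 : 1 ≤ p.toReal := by
    rw [← ENNReal.toReal_one]
    exact (ENNReal.toReal_le_toReal (by simp) hpt).2 hp1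
  have hr2 : p.toReal < 2 := by
    simpa using (ENNReal.toReal_lt_toReal hpt (by simp)).2 hp2
  have h2p : 0 < 2 - p.toReal := by linarith
  have hr0 : 0 < p.toReal / (2 - p.toReal) := by positivity
  rw [eLpNorm_eq_lintegral_rpow_enorm_toReal (by simpa using hr0) ENNReal.ofReal_ne_top,
    eLpNorm_eq_lintegral_rpow_enorm_toReal (zero_lt_one.trans_le hp1).ne' hpt,
    ENNReal.toReal_ofReal hr0.le, ← ENNReal.rpow_natCast, ← ENNReal.rpow_mul]
  refine (ENNReal.rpow_le_rpow (hk _ hr1 hr2) (by positivity)).trans (le_of_eq ?_)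
  rw [← ENNReal.rpow_mul]
  congr 1
  push_cast
  field_simp

namespace PlaneCurve

variable {Γ : ℝ → Plane} {I : Set ℝ}

/-- For `p < 8/7`, quadratic means of the Fourier transform of an `L^p` function around almost every
point of the curve are controlled by those of Schwartz approximations. -/
theorem ae_exists_quadratic_mean_bound (hI : I.OrdConnected) (hΓ : ContDiffOn ℝ 2 Γ I)
    {p : ℝ≥0∞} [Fact (1 ≤ p)] (hp : p < 8 / 7) {f : Lp ℂ p (volume : Measure Plane)}
    {F : Plane → ℂ} (hF : IsFourierTransform f F) {χ : 𝓢(Plane, ℂ)} {θ : Plane → ℝ}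
    (hχ : ∀ x, χ x = θ x) (hθ : ∀ x, 0 ≤ θ x) {φ : ℕ → 𝓢(Plane, ℂ)}
    (hφ : ∀ n, eLpNorm ((f : Plane → ℂ) - ⇑(φ n)) p ≤ 2⁻¹ ^ n) :
    ∀ᵐ t ∂(curvedArclength Γ I), ∃ U : ℕ → ℝ≥0∞, Tendsto U atTop (𝓝 0) ∧
      ∀ n, ∀ ε : ℝ, 0 < ε →
        ∫⁻ y, ‖F y - 𝓕 (φ n : Plane → ℂ) y‖ₑ ^ (2 : ℝ) * ENNReal.ofReal (θ (ε⁻¹ • (Γ t - y)))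
          ≤ ENNReal.ofReal (ε ^ 2) * U n := by
  have hp1 : 1 ≤ p := Fact.out
  have hp2 : p < 2 := hp.trans (by
    rw [ENNReal.div_lt_iff (by simp) (by simp)]; norm_num)
  have hpt : p ≠ ∞ := (hp2.trans (by simp)).ne
  choose k hkF hkY using fun ψ : 𝓢(Plane, ℂ) => ψ.exists_autocorrelation
  obtain ⟨r, hr⟩ : ∃ r : ℝ≥0∞, r = ENNReal.ofReal (p.toReal / (2 - p.toReal)) := ⟨_, rfl⟩
  have hP1 : 1 ≤ p.toReal := by
    rw [← ENNReal.toReal_one]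
    exact (ENNReal.toReal_le_toReal (by simp) hpt).2 hp1
  have hP2 : p.toReal < 8 / 7 := by
    simpa using (ENNReal.toReal_lt_toReal hpt (by finiteness)).2 hp
  have h2p : 0 < 2 - p.toReal := by linarith
  have hr1 : 1 ≤ r := by
    rw [hr, ← ENNReal.ofReal_one]
    refine ENNReal.ofReal_le_ofReal ?_
    rw [one_le_div h2p]
    linarith
  -- This is where 8/7 enters: p/(2 − p) < 4/3 is equivalent to p < 8/7.
  have hr43 : r < 4 / 3 := by
    have h43 : (4 / 3 : ℝ≥0∞) = ENNReal.ofReal (4 / 3) := by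
      rw [ENNReal.ofReal_div_of_pos (by norm_num)]; simp
    rw [hr, h43, ENNReal.ofReal_lt_ofReal_iff (by norm_num), div_lt_div_iff₀ h2p (by norm_num)]
    linarith
  have hrt : r ≠ ∞ := by rw [hr]; exact ENNReal.ofReal_ne_top
  -- Here r' = 1 + 1/(r − 1) exceeds 4, so the maximal theorem is available with q = 1; an L¹ bound
  -- on compact sets is all that is needed.
  have hrq : 3 * 1 ≤ r.conjExponent := by
    rw [ENNReal.conjExponent, mul_one]
    refine le_add_left ?_
    rw [← inv_inv (3 : ℝ≥0∞), ENNReal.inv_le_inv, tsub_le_iff_right]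
    refine hr43.le.trans (le_of_eq ?_)
    rw [← ENNReal.toReal_eq_toReal_iff' (by finiteness) (by finiteness)]
    rw [ENNReal.toReal_add (by finiteness) (by finiteness)]
    simp
    norm_num
  -- Only autocorrelations of differences of Schwartz functions are used. They are quadratic in φ_m
  -- − φ_n, hence even 4 · 4^{-n}; the weaker 4 · 2^{-n} suffices.
  have hdiff : ∀ m n, n ≤ m → eLpNorm (k (φ m - φ n)) r ≤ 4 * 2⁻¹ ^ n := fun m n hmn => by
    have h1 : eLpNorm (φ m - φ n) p ≤ 2 * 2⁻¹ ^ n := by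
      have h2 : ((φ m - φ n : 𝓢(Plane, ℂ)) : Plane → ℂ)
          = ((f : Plane → ℂ) - φ n) - ((f : Plane → ℂ) - φ m) := by
        ext x; simp
      rw [h2]
      refine (eLpNorm_sub_le ((Lp.aestronglyMeasurable f).sub (φ n).continuous.aestronglyMeasurable)
        ((Lp.aestronglyMeasurable f).sub (φ m).continuous.aestronglyMeasurable) hp1).trans ?_
      rw [two_mul]
      exact add_le_add (hφ n) ((hφ m).trans (pow_le_pow_of_le_one (by simp) (by simp) hmn))
    rw [hr]
    refine (SchwartzMap.eLpNorm_autocorrelation_le hp1 hp2 (hkY _)).trans ?_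
    refine (pow_le_pow_left₀ zero_le h1 2).trans ?_
    rw [mul_pow]
    norm_num
    refine mul_le_mul_right ?_ _
    rw [pow_two]
    exact mul_le_of_le_one_right' (pow_le_one₀ (by simp) (by simp))
  -- The bounds U_n are lower limits in m of maximal functions; Fatou's lemma on the curve passes
  -- the estimate, uniform in m, to them.
  have hU0 : ∀ᵐ t ∂(curvedArclength Γ I), Tendsto (fun n => liminf (fun m =>
      fourierMaximal χ denseScale (k (φ m - φ n)) (Γ t)) atTop) atTop (𝓝 0) := by
    refine ae_curvedArclength_of_forall_isCompact hI hΓ fun K hK hKs => ?_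
    obtain ⟨C, hC⟩ := exists_eLpNorm_fourierMaximal_le hI hΓ χ hr1 hr43 hrq hK hKs
    have : IsFiniteMeasure ((curvedArclength Γ I).restrict K) :=
      ⟨by rw [Measure.restrict_apply_univ]; exact curvedArclength_lt_top_of_isCompact hI hΓ hK hKs⟩
    have hm : ∀ m n, Measurable (fourierMaximal χ denseScale (k (φ m - φ n))) := fun m n =>
      measurable_fourierMaximal χ _ fun j =>
        integrable_dilate_mul_memLp _ hr1 ((k (φ m - φ n)).memLp r) (denseScale_pos j)
    have hΓm : AEMeasurable Γ ((curvedArclength Γ I).restrict K) :=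
      (aemeasurable_curve hI hΓ.continuousOn).mono_measure Measure.restrict_le_self
    refine ae_tendsto_zero_of_eLpNorm_le_two_pow le_rfl (C := C * 4) (fun n => ?_) fun n => ?_
    · exact (Measurable.liminf fun m => hm m n).comp_aemeasurable hΓm
    · rw [eLpNorm_one_eq_lintegral_enorm]
      simp only [enorm_eq_self]
      refine (lintegral_liminf_le' fun m => (hm m n).comp_aemeasurable hΓm).trans ?_
      refine liminf_le_of_frequently_le' (Eventually.frequently ?_)
      filter_upwards [eventually_ge_atTop n] with m hmn
      have h1 := hC denseScale denseScale_pos _ ((k (φ m - φ n)).memLp r)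
      rw [eLpNorm_one_eq_lintegral_enorm] at h1
      simp only [enorm_eq_self] at h1
      refine h1.trans ((mul_le_mul_right (hdiff m n hmn) _).trans (le_of_eq ?_))
      push_cast
      ring
  have hconv := hF.ae_tendsto hp2.le hφ
  filter_upwards [hU0] with t ht
  refine ⟨_, ht, fun n ε hε => ?_⟩
  have hsub : ∀ m y, 𝓕 ((φ m - φ n : 𝓢(Plane, ℂ)) : Plane → ℂ) y
      = 𝓕 (φ m : Plane → ℂ) y - 𝓕 (φ n : Plane → ℂ) y := fun m y => by
    simp only [← SchwartzMap.fourier_coe]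
    exact congrArg (fun ψ : 𝓢(Plane, ℂ) => ψ y)
      (map_sub (FourierTransform.fourierCLM ℂ 𝓢(Plane, ℂ)) (φ m) (φ n))
  have hFc : ∀ m, Continuous (𝓕 (φ m : Plane → ℂ)) := fun m =>
    continuous_fourier_of_integrable (φ m).integrable
  have hθm : Measurable θ := by
    have : θ = fun x => (χ x).re := by ext x; simp [hχ]
    rw [this]
    exact (Complex.continuous_re.comp χ.continuous).measurable
  have hw : Measurable fun y => ENNReal.ofReal (θ (ε⁻¹ • (Γ t - y))) :=
    ENNReal.measurable_ofReal.comp (hθm.comp (by fun_prop))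
  -- In the plane F is the almost everywhere limit of φ̂_m, so Fatou's lemma bounds the quadratic
  -- mean of F − φ̂_n by the lower limit of those of φ̂_m − φ̂_n. The bound does not depend on ε.
  calc ∫⁻ y, ‖F y - 𝓕 (φ n : Plane → ℂ) y‖ₑ ^ (2 : ℝ) * ENNReal.ofReal (θ (ε⁻¹ • (Γ t - y)))
      = ∫⁻ y, liminf (fun m => ‖𝓕 ((φ m - φ n : 𝓢(Plane, ℂ)) : Plane → ℂ) y‖ₑ ^ (2 : ℝ) *
          ENNReal.ofReal (θ (ε⁻¹ • (Γ t - y)))) atTop := by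
        refine lintegral_congr_ae ?_
        filter_upwards [hconv] with y hy
        refine (Tendsto.liminf_eq ?_).symm
        refine ENNReal.Tendsto.mul_const ?_ (Or.inr ENNReal.ofReal_ne_top)
        simp only [hsub]
        exact ((ENNReal.continuous_rpow_const (y := 2)).tendsto _).comp
          (hy.sub_const (𝓕 (φ n : Plane → ℂ) y)).enorm
    _ ≤ liminf (fun m => ∫⁻ y, ‖𝓕 ((φ m - φ n : 𝓢(Plane, ℂ)) : Plane → ℂ) y‖ₑ ^ (2 : ℝ) *
          ENNReal.ofReal (θ (ε⁻¹ • (Γ t - y)))) atTop := by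
        refine lintegral_liminf_le fun m => ?_
        exact ((continuous_fourier_of_integrable
          (φ m - φ n).integrable).measurable.enorm.pow_const _).mul hw
    _ ≤ liminf (fun m => ENNReal.ofReal (ε ^ 2) *
          fourierMaximal χ denseScale (k (φ m - φ n)) (Γ t)) atTop := by
        refine liminf_le_liminf (Eventually.of_forall fun m => ?_)
        rw [lintegral_mul_bump_eq hχ hθ (hkF _) hε]
        exact mul_le_mul_right (enorm_regularizedFourier_le_fourierMaximal χ hr1 hrt
          ((k (φ m - φ n)).memLp r) _ hε) _
    _ = _ := ENNReal.liminf_const_mul_of_ne_top ENNReal.ofReal_ne_top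

theorem IsRestrictionOperator.ae_isLebesguePointWithValue (hI : I.OrdConnected)
    (hΓ : ContDiffOn ℝ 2 Γ I) {p q : ℝ≥0∞} [Fact (1 ≤ p)] (hp : p < 8 / 7) (hq : 1 ≤ q)
    {R : Lp ℂ p (volume : Measure Plane) →ₗ[ℂ] (ℝ →ₘ[curvedArclength Γ I] ℂ)}
    (hR : IsRestrictionOperator Γ I p q R) {f : Lp ℂ p (volume : Measure Plane)}
    {F : Plane → ℂ} (hF : IsFourierTransform f F) :
    ∀ᵐ t ∂(curvedArclength Γ I), IsLebesguePointWithValue F (Γ t) (R f t) := by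
  have hpt : p ≠ ∞ := (hp.trans (by finiteness)).ne
  obtain ⟨χ, θ, c, hc, hχ, hθ, hθc, -⟩ := SchwartzMap.exists_nonneg_bump
  obtain ⟨φ, hφ⟩ := SchwartzMap.exists_eLpNorm_sub_le_two_pow (Fact.out : 1 ≤ p) hpt (Lp.memLp f)
  have hFm : AEStronglyMeasurable F :=
    (locallyIntegrable_of_forall_schwartz fun φ => (hF φ).1).aestronglyMeasurable
  have hFc : ∀ m, Continuous (𝓕 (φ m : Plane → ℂ)) := fun m =>
    continuous_fourier_of_integrable (φ m).integrable
  filter_upwards [ae_exists_quadratic_mean_bound hI hΓ hp hF hχ hθ hφ,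
    hR.ae_tendsto_fourier hI hΓ hq f hφ] with t ⟨U, hU0, hU⟩ h2
  have hM : Tendsto (fun n => (ENNReal.ofReal c⁻¹ * U n) ^ ((1 : ℝ) / 2)) atTop (𝓝 0) := by
    have h1 := ENNReal.Tendsto.const_mul (a := ENNReal.ofReal c⁻¹) hU0
      (Or.inr ENNReal.ofReal_ne_top)
    have h3 := ((ENNReal.continuous_rpow_const (y := (1 : ℝ) / 2)).tendsto _).comp h1
    rwa [mul_zero, ENNReal.zero_rpow_of_pos (by norm_num)] at h3
  refine isLebesguePointWithValue_of_approx hFm hFc h2 hM fun n ε hε => ?_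
  exact laverage_ball_enorm_le hc hθc (hFm.sub (hFc n).aestronglyMeasurable) hε (Γ t) (hU n ε hε)

end PlaneCurve

theorem theorem1 (I : Set ℝ) (hI : I.OrdConnected) (Γ : ℝ → Plane) (hΓ : ContDiffOn ℝ 2 Γ I)
    (p q : ℝ≥0∞) [Fact (1 ≤ p)] (hp : p < 4 / 3) (hq : 1 ≤ q) (hpq : 3 * q ≤ p.conjExponent) :
    (∃ R, PlaneCurve.IsRestrictionOperator Γ I p q R) ∧
    ∀ R, PlaneCurve.IsRestrictionOperator Γ I p q R →
      ∀ f : Lp ℂ p (volume : Measure Plane),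
        (∃ F, IsFourierTransform f F) ∧
        ∀ F, IsFourierTransform f F →
          (∀ χ : 𝓢(Plane, ℂ), ∫ x, χ x = 1 →
            ∀ᵐ t ∂(PlaneCurve.curvedArclength Γ I),
              Tendsto (fun ε : ℝ =>
                  convolution F (dilate χ ε) (ContinuousLinearMap.mul ℂ ℂ) volume (Γ t))
                (𝓝[>] 0) (𝓝 (R f t))) ∧
          (p < 8 / 7 →
            ∀ᵐ t ∂(PlaneCurve.curvedArclength Γ I),
              IsLebesguePointWithValue F (Γ t) (R f t)) := by
  refine ⟨PlaneCurve.exists_isRestrictionOperator hI hΓ hp hq hpq, fun R hR f => ⟨?_, ?_⟩⟩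
  · have hp2 : p ≤ 2 := hp.le.trans (by
      rw [ENNReal.div_le_iff (by simp) (by simp)]; norm_num)
    obtain ⟨G₁, G₂, hG, -⟩ := exists_fourier_decomposition hp2 f
    exact ⟨_, hG⟩
  · intro F hF
    refine ⟨fun χ hχ => ?_, fun hp8 => hR.ae_isLebesguePointWithValue hI hΓ hp8 hq hF⟩
    filter_upwards [hR.ae_tendsto_regularizedFourier hI hΓ hp hq hpq f χ hχ] with t ht
    refine ht.congr' ?_
    filter_upwards [self_mem_nhdsWithin] with ε hε
    exact (hF.convolution_dilate χ hε (Γ t)).symm
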